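/- **Model.** Let $T,\zeta>0$, $\delta>2$, $N_0\ge 0$, $0\le H<1$, and $0<\alpha\le 2$, $\sigma\ge 0$, $\mu\in\mathbb R$. Let $\mathbb S(\alpha,\sigma,\mu)$ be the $\alpha$-stable law with skewness $1$, i.e. with characteristic function $$\Phi(\omega)=\begin{cases}\exp\{-\sigma^\alpha|\omega|^\alpha(1-j\,\mathrm{sgn}(\omega)\tan\frac{\pi\alpha}{2})+j\mu\omega\}, & \alpha\ne1,\\ \exp\{-\sigma|\omega|(1+j\frac2\pi\,\mathrm{sgn}(\omega)\ln|\omega|)+j\mu\omega\}, & \alpha=1.\end{cases}$$ For $R>0$ and $a>1$, let $\lambda\sim\mathbb S(\alpha,\sigma,\mu)$ and, independently, let $\lambda_S$ be distributed as $a^{H-2}\lambda$. Given $(\lambda,\lambda_S)$, the base stations (BSs) form independent homogeneous Poisson processes of density $\lambda$ in the disc $\Delta=\{|x|<R\}$ and of density $\lambda_S$ in the annulus $\Delta_S=\{R\le|x|<aR\}$. The user is at the origin and is served by the nearest BS $b_0$, which lies in $\Delta$ (if $\Delta$ contains no BS, the user is not covered); $r$ is its distance. The user is covered if $$\mathrm{SINR}=\frac{h\,r^{-\delta}}{N_0+I_r}>T,\qquad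 I_r=\sum_{i\in(\Delta\cup\Delta_S)\setminus\{b_0\}} g_i\hat R_i^{-\delta},$$ where $\hat R_i$ is the distance of BS $i$ from the user, $h$ is exponential with rate $\zeta$, the $g_i$ are i.i.d. copies of an almost surely positive random variable $g$ with $\mathbb E[g^{2/\delta}]<\infty$ (for instance exponential), and $h$, the $g_i$ and the BSs are independent. Let $p_c(R,a)$ be the coverage probability: the expectation over $(\lambda,\lambda_S)$ of the sum over $n,m\ge0$ of the Poisson weights $e^{-\lambda|\Delta|}\frac{(\lambda|\Delta|)^n}{n!}\,e^{-\lambda_S|\Delta_S|}\frac{(\lambda_S|\Delta_S|)^m}{m!}$ times the probability of coverage given $n$ independent uniform BSs in $\Delta$ and $m$ in $\Delta_S$. This is a genuine probability if $\lambda\ge0$ almost surely (e.g. if $\alpha<1$, $\mu\ge0$); if the stable law also charges negative densities, $p_c(R,a)$ is defined by the same expression. Put $$B(r)=\pi\,\mathbb E_g\Big[\frac{2(\zeta Tg)^{2/\delta}r^2}{\delta}\Big(\Gamma\big(-\tfrac2\delta,\zeta Tg\big)-\Gamma\big(-\tfrac2\delta\big)\Big)\Big],$$ where $\Gamma(d,x)=\int_x^\infty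 t^{d-1}e^{-t}\,dt$ for $x>0$ and $\Gamma(d)$ is the Gamma function (continued to non-integer $d<0$). **Theorem.** The coverage probability has, first as $a\to\infty$ and then as $R\to\infty$, the following closed form. 1. If $\alpha\neq1$, then for every $R>0$ the limit $\lim_{a\to\infty}p_c(R,a)$ exists, and $$\lim_{R\to\infty}\lim_{a\to\infty}p_c(R,a)=\int_0^\infty 2\pi r\Big[\frac{\sigma^\alpha\alpha}{\cos\frac{\pi\alpha}2}B(r)^{\alpha-1}+\mu\Big]\exp\Big\{-\frac{\sigma^\alpha}{\cos\frac{\pi\alpha}2}B(r)^\alpha-\zeta Tr^\delta N_0-\mu B(r)\Big\}\,dr,$$ provided that the integral on the right converges absolutely. It does so whenever $\alpha<1$ and $\mu\ge0$, or $\sigma=0$ and $\mu\ge0$, or $N_0>0$ and $2\alpha<\delta$. 2. If $\alpha=1$, then for every $R>0$ the limit $\lim_{a\to\infty}p_c(R,a)$ exists, and $$\lim_{R\to\infty}\lim_{a\to\infty}p_c(R,a)=\int_0^\infty 2\pi r\Big[\mu-\frac{2\sigma}\pi\big(\ln B(r)+1\big)\Big]\exp\Big\{-\zeta Tr^\delta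 N_0+\frac{2\sigma}\pi B(r)\ln B(r)-\mu B(r)\Big\}\,dr,$$ provided that the integral on the right converges absolutely. It does so whenever $\sigma=0$ and $\mu\ge0$, or $N_0>0$. -/

import Mathlib

open MeasureTheory ProbabilityTheory Filter Topology Set

namespace AlphaStableNetwork

noncomputable section

/-! ### Stable laws -/

/-- The exponent of the characteristic function of the `α`-stable law with skewness `β`,
scale `σ` and shift `μ`. -/
def stableExponent (α β σ μ ω : ℝ) : ℂ :=
  if α = 1 then
    -((σ * |ω| : ℝ) : ℂ) *
        (1 + Complex.I * ((2 * β / Real.pi * Real.sign ω * Real.log |ω| : ℝ) : ℂ))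
      + Complex.I * ((μ * ω : ℝ) : ℂ)
  else
    -((σ ^ α * |ω| ^ α : ℝ) : ℂ) *
        (1 - Complex.I * ((β * Real.sign ω * Real.tan (Real.pi * α / 2) : ℝ) : ℂ))
      + Complex.I * ((μ * ω : ℝ) : ℂ)

/-- `ν` is the law `𝕊(α, σ, μ)`: the `α`-stable law with skewness `1`, scale `σ`, shift `μ`. -/
def IsStableLaw (α σ μ : ℝ) (ν : Measure ℝ) : Prop :=
  ∀ ω : ℝ, charFun ν ω = Complex.exp (stableExponent α 1 σ μ ω)

/-! ### The network -/

/-- The plane; the user equipment sits at the origin. -/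
abbrev Plane : Type := EuclideanSpace ℝ (Fin 2)

/-- The inner circle `Δ`, of radius `R`. -/
def innerDisc (R : ℝ) : Set Plane := Metric.ball 0 R

/-- The outer circle `Δ_S`, with radius spanning from `R` to `a R`. -/
def outerAnnulus (R a : ℝ) : Set Plane := Metric.ball 0 (a * R) \ Metric.ball 0 R

/-- The signal-to-interference-plus-noise ratio when the base stations are at `x i` (inner circle)
and `y j` (outer circle), the serving base station is `x i₀`, the fading gain of its link is `h`,
and the interfering links have fading gains `g i` and `k j`. It is infinite if the signal is
positive and there is neither noise nor interference. -/
def sinr (δ N₀ : ℝ) {n m : ℕ} (x : Fin n → Plane) (y : Fin m → Plane)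
    (h : ℝ) (g : Fin n → ℝ) (k : Fin m → ℝ) (i₀ : Fin n) : ENNReal :=
  ENNReal.ofReal (h * ‖x i₀‖ ^ (-δ)) /
    ENNReal.ofReal (N₀ + (∑ i ∈ Finset.univ.erase i₀, g i * ‖x i‖ ^ (-δ)
      + ∑ j, k j * ‖y j‖ ^ (-δ)))

/-- The event that the user is covered: the `SINR` exceeds the threshold `T` for the link
to the nearest base station, which lies in the inner circle. -/
def coverageEvent (T δ N₀ : ℝ) (n m : ℕ) :
    Set (((Fin n → Plane) × (Fin m → Plane)) × ℝ × (Fin n → ℝ) × (Fin m → ℝ)) :=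
  {w | ∃ i₀ : Fin n, (∀ i, ‖w.1.1 i₀‖ ≤ ‖w.1.1 i‖) ∧
    ENNReal.ofReal T < sinr δ N₀ w.1.1 w.1.2 w.2.1 w.2.2.1 w.2.2.2 i₀}

/-- The joint law of positions and fading gains, given that there are `n` base stations in the
inner and `m` in the outer circle: the positions are uniform in their circles, the gain of the
serving link is exponential with rate `ζ`, the gains of the interfering links have law `G`,
and everything is independent. -/
def configLaw (ζ : ℝ) (G : Measure ℝ) (R a : ℝ) (n m : ℕ) :
    Measure (((Fin n → Plane) × (Fin m → Plane)) × ℝ × (Fin n → ℝ) × (Fin m → ℝ)) :=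
  ((Measure.pi fun _ : Fin n => cond volume (innerDisc R)).prod
      (Measure.pi fun _ : Fin m => cond volume (outerAnnulus R a))).prod
    ((expMeasure ζ).prod
      ((Measure.pi fun _ : Fin n => G).prod (Measure.pi fun _ : Fin m => G)))

/-- The Poisson weight `e^{-x} x^n / n!`. -/
def poissonWeight (x : ℝ) (n : ℕ) : ℝ := Real.exp (-x) * x ^ n / (n.factorial : ℝ)

theorem poissonWeight_eq (x : NNReal) (n : ℕ) :
    (poissonMeasure x).real {n} = poissonWeight x n := by
  rw [poissonMeasure_real_singleton, poissonWeight]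

/-- The coverage probability given the spatial densities `l` (inner circle) and `lS` (outer
circle), under which the base stations form independent homogeneous Poisson processes there:
a Poisson number of independent uniform points. The same expression, with the Poisson weights
`e^{-x} x^n / n!` at a negative mean `x`, is used if a density is negative. -/
def coverageGivenDensity (T ζ δ N₀ : ℝ) (G : Measure ℝ) (R a l lS : ℝ) : ℝ :=
  ∑' p : ℕ × ℕ,
    poissonWeight (l * volume.real (innerDisc R)) p.1 *
      poissonWeight (lS * volume.real (outerAnnulus R a)) p.2 *
      (configLaw ζ G R a p.1 p.2).real (coverageEvent T δ N₀ p.1 p.2)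

/-- The coverage probability of the doubly stochastic network: the density `l` of the inner
circle has law `ν`, and the density of the outer circle is independent of it and distributed as
`a ^ (H - 2)` times a variable of law `ν` (self-similarity with Hurst parameter `H`). -/
def coverageProbability (T ζ δ N₀ H : ℝ) (G ν : Measure ℝ) (R a : ℝ) : ℝ :=
  ∫ q : ℝ × ℝ, coverageGivenDensity T ζ δ N₀ G R a q.1 q.2
    ∂(ν.prod (ν.map fun l => a ^ (H - 2) * l))

/-! ### The limiting integrand -/

/-- The upper incomplete Gamma function `Γ(d, x) = ∫_x^∞ t^(d-1) e^(-t) dt`. -/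
def incGamma (d x : ℝ) : ℝ := ∫ t in Ioi x, t ^ (d - 1) * Real.exp (-t)

/-- `𝔼_g [ (2 (ζ T g)^(2/δ) r² / δ) (Γ(-2/δ, ζ T g) - Γ(-2/δ)) ]`. -/
def interferenceTerm (T ζ δ : ℝ) (G : Measure ℝ) (r : ℝ) : ℝ :=
  ∫ g, 2 * (ζ * T * g) ^ (2 / δ) * r ^ 2 / δ *
    (incGamma (-2 / δ) (ζ * T * g) - Real.Gamma (-2 / δ)) ∂G

/-- The integrand of the closed form for `α ≠ 1`. -/
def limitIntegrand (T ζ δ N₀ : ℝ) (G : Measure ℝ) (α σ μ r : ℝ) : ℝ :=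
  2 * Real.pi * r *
    (σ ^ α * α / Real.cos (Real.pi * α / 2) *
        (Real.pi * interferenceTerm T ζ δ G r) ^ (α - 1) + μ) *
    Real.exp
      (-(σ ^ α / Real.cos (Real.pi * α / 2) * (Real.pi * interferenceTerm T ζ δ G r) ^ α)
        - ζ * T * r ^ δ * N₀
        - μ * Real.pi * interferenceTerm T ζ δ G r)

/-- The integrand of the closed form for `α = 1`. -/
def limitIntegrandOne (T ζ δ N₀ : ℝ) (G : Measure ℝ) (σ μ r : ℝ) : ℝ :=
  2 * Real.pi * r *
    (μ - 2 * σ / Real.pi * (Real.log (Real.pi * interferenceTerm T ζ δ G r) + 1)) *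
    Real.exp
      (-(ζ * T * r ^ δ * N₀)
        + 2 * σ * interferenceTerm T ζ δ G r * Real.log (Real.pi * interferenceTerm T ζ δ G r)
        - μ * Real.pi * interferenceTerm T ζ δ G r)

end

end AlphaStableNetwork

open AlphaStableNetwork

/-!
# Coverage probability of a doubly stochastic network with stable densities

Write `B r = π * interferenceTerm r = b r²`, with `b ≥ π`, and `F s = ∫ l e^{-s l} dν(l)`
(`weightedMean`). Given the densities, exponential fading of the serving link makes the
probability that its `SINR` exceeds `T` a product over the interferers, so the Poisson series can
be summed under the integral over the distance `r` of the serving base station. This gives `∫_0^R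
2 π r w(r) l e^{-l A_R(r)} e^{-l_S C_{R,a}(r)} dr` for densities `l`, `l_S` of either sign
(`coverageGivenDensity_eq`), where `w` is the noise factor and `A_R`, `C_{R,a}` are the exponents
`innerExponent`, `outerExponent` of the two circles. Averaging over the densities replaces `l
e^{-l A_R(r)}` by `F (A_R(r))` and the last factor by the Laplace transform of `ν` at `a^(H-2)
C_{R,a}(r)`. Since `δ > 2` and `𝔼 g^(2/δ) < ∞`, `C_{R,a}(r)` is bounded in `a`, and this factor
tends to `1` as `a → ∞` (`tendsto_coverageProbability`).

As `R → ∞`, `A_R(r)` tends to the exponent of the whole plane, which an explicit antiderivative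
identifies with `B r` (`integral_one_sub_fartherFactor`). Domination needs no case distinction in
the parameters: `F` is antitone, and `π r² ≤ A_R(r) ≤ b r²`, so `|F (A_R(r))|` is at most `|F (π
r²)| + |F (b r²)|`. The second term is integrable against `2 π r w(r)` by hypothesis, and the
first then is as well, by scaling `r` and monotonicity of `w` (`tendsto_integral_weightedMean`).

What is left is that a stable law of skewness `1` has a Laplace transform on `s > 0`, with the
expected closed form; `F` is minus its derivative. The characteristic function is the boundary
value on the imaginary axis of a function `Λ` holomorphic in the right half-plane and of at most
exponential growth on vertical strips. With a Gaussian damping factor, Fubini and a shift of the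
line of integration express `∫ e^{-s x} e^{-x²/4b} dν(x)` by the values of `Λ` on `re z = s`, and
these integrals converge to `Λ s` when the damping is removed (`laplace_of_charFun`).

The integral of the closed form converges either because its integrand is, up to the factor `w ≤
1`, the derivative of a monotone bounded function (`integrableOn_limit_of_nonneg`), or because the
noise term `r^δ` dominates the rest of the exponent (`integrableOn_limit_of_noise`,
`integrableOn_limitOne_of_noise`).
-/

namespace AlphaStableNetwork

/-! ### Laplace transforms from analytic continuations of characteristic functions -/

/-- Shift of a line of integration, from the imaginary axis to the line `re z = s`. -/
theorem integral_vertical_line_eq {f : ℂ → ℂ} {s M c : ℝ} (hs : 0 < s) (hc : 0 < c)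
    (hd : DifferentiableOn ℂ f {z | 0 < z.re}) (hf : ContinuousOn f {z | 0 ≤ z.re})
    (hM : ∀ x y : ℝ, 0 ≤ x → x ≤ s → ‖f (x + y * Complex.I)‖ ≤ M * Real.exp (-c * y ^ 2)) :
    ∫ y : ℝ, f (s + y * Complex.I) = ∫ y : ℝ, f (y * Complex.I) := by
  have hcont : ∀ x : ℝ, 0 ≤ x → Continuous fun y : ℝ => f (x + y * Complex.I) := by
    intro x hx
    refine hf.comp_continuous (by fun_prop) ?_
    intro y; simpa using hx
  have hint : ∀ x : ℝ, 0 ≤ x → x ≤ s → Integrable fun y : ℝ => f (x + y * Complex.I) := by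
    intro x hx hxs
    refine Integrable.mono' ((integrable_exp_neg_mul_sq hc).const_mul M)
      (hcont x hx).aestronglyMeasurable (ae_of_all _ fun y => hM x y hx hxs)
  have h0 : Integrable fun y : ℝ => f (y * Complex.I) := by
    simpa using hint 0 le_rfl hs.le
  -- the horizontal sides of the rectangle `[0, s] × [-Y, Y]` vanish as `Y → ∞`
  have hside : ∀ e : ℝ, e ^ 2 = 1 →
      Tendsto (fun Y : ℝ => ∫ x in (0 : ℝ)..s, f (x + ((e * Y : ℝ) : ℂ) * Complex.I))
        atTop (𝓝 0) := by
    intro e he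
    rw [tendsto_zero_iff_norm_tendsto_zero]
    have hlim : Tendsto (fun Y : ℝ => M * Real.exp (-c * Y ^ 2) * |s - 0|) atTop (𝓝 0) := by
      have h1 : Tendsto (fun Y : ℝ => -c * Y ^ 2) atTop atBot :=
        (tendsto_pow_atTop (two_ne_zero)).const_mul_atTop_of_neg (by linarith)
      simpa using ((Real.tendsto_exp_atBot.comp h1).const_mul M).mul_const |s - 0|
    refine squeeze_zero (fun _ => norm_nonneg _) (fun Y => ?_) hlim
    refine intervalIntegral.norm_integral_le_of_norm_le_const fun x hx => ?_
    rw [uIoc_of_le hs.le] at hx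
    have := hM x (e * Y) hx.1.le hx.2
    rwa [mul_pow, he, one_mul] at this
  have hrect : ∀ Y : ℝ, 0 < Y →
      (∫ x in (0 : ℝ)..s, f (x + ((-1 * Y : ℝ) : ℂ) * Complex.I))
        - (∫ x in (0 : ℝ)..s, f (x + ((1 * Y : ℝ) : ℂ) * Complex.I))
        + Complex.I * (∫ y in (-Y)..Y, f (s + y * Complex.I))
        - Complex.I * (∫ y in (-Y)..Y, f (y * Complex.I)) = 0 := by
    intro Y hY
    have := Complex.integral_boundary_rect_eq_zero_of_continuousOn_of_differentiableOn f
      (0 + (-Y : ℝ) * Complex.I) (s + (Y : ℝ) * Complex.I)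
      (hf.mono fun z hz => by
        have := hz.1
        simp [uIcc_of_le hs.le] at this
        exact this.1)
      (hd.mono fun z hz => by
        have := hz.1
        simp [hs.le] at this
        exact this.1)
    simpa using this
  have hlim : Tendsto (fun Y : ℝ =>
      (∫ x in (0 : ℝ)..s, f (x + ((-1 * Y : ℝ) : ℂ) * Complex.I))
        - (∫ x in (0 : ℝ)..s, f (x + ((1 * Y : ℝ) : ℂ) * Complex.I))
        + Complex.I * (∫ y in (-Y)..Y, f (s + y * Complex.I))
        - Complex.I * (∫ y in (-Y)..Y, f (y * Complex.I))) atTop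
      (𝓝 (0 - 0 + Complex.I * (∫ y : ℝ, f (s + y * Complex.I))
        - Complex.I * (∫ y : ℝ, f (y * Complex.I)))) := by
    refine ((((hside (-1) (by norm_num)).sub (hside 1 (by norm_num))).add
      (Tendsto.const_mul _ ?_)).sub (Tendsto.const_mul _ ?_))
    · exact intervalIntegral_tendsto_integral (hint s hs.le le_rfl)
        tendsto_neg_atTop_atBot tendsto_id
    · exact intervalIntegral_tendsto_integral h0 tendsto_neg_atTop_atBot tendsto_id
  have hz := tendsto_nhds_unique
    (hlim.congr' ((eventually_gt_atTop 0).mono hrect)) tendsto_const_nhds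
  have : Complex.I * ((∫ y : ℝ, f (s + y * Complex.I)) - ∫ y : ℝ, f (y * Complex.I)) = 0 := by
    linear_combination hz
  rcases mul_eq_zero.1 this with h | h
  · exact absurd h Complex.I_ne_zero
  · exact sub_eq_zero.1 h

/-- The Fourier transform of a Gaussian, with the line of integration shifted by `s`. -/
theorem integral_cexp_gaussian_shift {b : ℝ} (hb : 0 < b) (s x : ℝ) :
    ∫ y : ℝ, Complex.exp (-(y * Complex.I) * x) * Complex.exp (b * (y * Complex.I - s) ^ 2)
      = ((√(Real.pi / b) * (Real.exp (-s * x) * Real.exp (-(x ^ 2 / (4 * b)))) : ℝ) : ℂ) := by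
  have hb' : (-(b : ℂ)).re < 0 := by simpa using hb
  have hbc : (b : ℂ) ≠ 0 := by exact_mod_cast hb.ne'
  have h := integral_cexp_quadratic hb' (-(2 * b * s * Complex.I) - Complex.I * x) (b * s ^ 2)
  have he : ∀ y : ℝ, Complex.exp (-(y * Complex.I) * x) * Complex.exp (b * (y * Complex.I - s) ^ 2)
      = Complex.exp (-(b : ℂ) * y ^ 2 + (-(2 * b * s * Complex.I) - Complex.I * x) * y
        + b * s ^ 2) := by
    intro y
    rw [← Complex.exp_add]
    congr 1
    linear_combination (b * (y : ℂ) ^ 2) * Complex.I_sq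
  simp_rw [he, h]
  have h1 : ((Real.pi : ℂ) / - -(b : ℂ)) ^ (1 / 2 : ℂ) = ((√(Real.pi / b) : ℝ) : ℂ) := by
    rw [neg_neg, Real.sqrt_eq_rpow, Complex.ofReal_cpow (by positivity)]
    norm_num
  rw [h1]
  push_cast
  rw [← Complex.exp_add]
  congr 2
  field_simp
  linear_combination ((2 * b * s + x) ^ 2 : ℂ) * Complex.I_sq

/-- Damped Laplace transform: Fubini turns it into an integral along the imaginary axis, and a shift
of that line brings the continuation `Λ` of the characteristic function to `re z = s`. -/
theorem integral_exp_mul_gaussian_eq (ν : Measure ℝ) [IsProbabilityMeasure ν] {Λ : ℂ → ℂ}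
    (hd : DifferentiableOn ℂ Λ {z | 0 < z.re}) (hc : ContinuousOn Λ {z | 0 ≤ z.re})
    {s C D : ℝ} (hs : 0 < s)
    (hg : ∀ z : ℂ, 0 ≤ z.re → z.re ≤ s → ‖Λ z‖ ≤ C * Real.exp (D * |z.im|))
    (hν : ∀ t : ℝ, charFun ν t = Λ (-t * Complex.I)) {b : ℝ} (hb : 0 < b) :
    ((√(Real.pi / b) * ∫ x, Real.exp (-s * x) * Real.exp (-(x ^ 2 / (4 * b))) ∂ν : ℝ) : ℂ)
      = ∫ y : ℝ, Λ (s + y * Complex.I) * Complex.exp (-b * y ^ 2) := by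
  have hC : 0 ≤ C := by
    have := (norm_nonneg _).trans (hg 0 le_rfl hs.le)
    simpa using this
  have hshift := integral_vertical_line_eq (f := fun z => Λ z * Complex.exp (b * (z - s) ^ 2))
    (M := C * Real.exp (b * s ^ 2 + D ^ 2 / (2 * b))) (c := b / 2) hs (by positivity)
    (hd.mul (by fun_prop)) (hc.mul (by fun_prop)) (by
      intro x y hx hxs
      have h1 := hg (x + y * Complex.I) (by simpa using hx) (by simpa using hxs)
      rw [norm_mul, Complex.norm_exp, mul_assoc, ← Real.exp_add]
      have h2 : ((b : ℂ) * (x + y * Complex.I - s) ^ 2).re = b * ((x - s) ^ 2 - y ^ 2) := by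
        simp [pow_two]
      rw [h2]
      simp only [Complex.add_im, Complex.ofReal_im, Complex.mul_im, Complex.ofReal_re,
        Complex.I_im, mul_one, Complex.I_re, mul_zero, add_zero, zero_add] at h1
      refine (mul_le_mul_of_nonneg_right h1 (Real.exp_pos _).le).trans ?_
      rw [mul_assoc, ← Real.exp_add]
      refine mul_le_mul_of_nonneg_left (Real.exp_le_exp.2 ?_) hC
      have h3 : D * |y| ≤ D ^ 2 / (2 * b) + b / 2 * y ^ 2 := by
        have : D ^ 2 / (2 * b) + b / 2 * y ^ 2 - D * |y| = (D - b * |y|) ^ 2 / (2 * b) := by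
          rw [← sq_abs y]; field_simp; ring
        have h4 : 0 ≤ (D - b * |y|) ^ 2 / (2 * b) := by positivity
        linarith
      have h5 : b * (x - s) ^ 2 ≤ b * s ^ 2 := by
        refine mul_le_mul_of_nonneg_left ?_ hb.le
        nlinarith
      nlinarith)
  simp only [add_sub_cancel_left] at hshift
  have e1 : ∫ y : ℝ, Λ (s + y * Complex.I) * Complex.exp (-b * y ^ 2)
      = ∫ y : ℝ, Λ (s + y * Complex.I) * Complex.exp (b * (y * Complex.I) ^ 2) := by
    congr with y
    congr 2
    linear_combination (-(b : ℂ) * y ^ 2) * Complex.I_sq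
  have e2 : ∀ y : ℝ, Λ (y * Complex.I) = ∫ x, Complex.exp (-(y * Complex.I) * x) ∂ν := by
    intro y
    have := hν (-y)
    rw [charFun_apply_real] at this
    rw [show (y : ℂ) * Complex.I = -((-y : ℝ) : ℂ) * Complex.I by push_cast; ring, ← this]
    congr with x
    congr 1
    push_cast; ring
  have hgi : Integrable fun y : ℝ => Complex.exp (b * (y * Complex.I - s) ^ 2) := by
    have := integrable_cexp_quadratic (b := b) (by simpa using hb) (-(2 * b * s * Complex.I))
      (b * s ^ 2)
    refine this.congr (ae_of_all _ fun y => ?_)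
    dsimp only
    congr 1
    linear_combination (-(b : ℂ) * y ^ 2) * Complex.I_sq
  rw [e1, hshift]
  simp_rw [e2, ← integral_mul_const]
  rw [integral_integral_swap]
  · simp_rw [integral_cexp_gaussian_shift hb]
    rw [← integral_const_mul]
    exact integral_ofReal.symm
  · refine (hgi.mul_prod (integrable_const (1 : ℂ) : Integrable _ ν)).mono
      (by fun_prop) (ae_of_all _ ?_)
    rintro ⟨y, x⟩
    simp [Complex.norm_exp]

/-- If the characteristic function of a probability measure is the boundary value on the imaginary
axis of a function `Λ` that is holomorphic in the right half-plane and of at most exponential growth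
along vertical strips, then the measure has a Laplace transform, and it is `Λ`. -/
theorem laplace_of_charFun (ν : Measure ℝ) [IsProbabilityMeasure ν] {Λ : ℂ → ℂ}
    (hd : DifferentiableOn ℂ Λ {z | 0 < z.re}) (hc : ContinuousOn Λ {z | 0 ≤ z.re})
    {s C D : ℝ} (hs : 0 < s)
    (hg : ∀ z : ℂ, 0 ≤ z.re → z.re ≤ s → ‖Λ z‖ ≤ C * Real.exp (D * |z.im|))
    (hν : ∀ t : ℝ, charFun ν t = Λ (-t * Complex.I)) :
    Integrable (fun x => Real.exp (-s * x)) ν ∧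
      ((∫ x, Real.exp (-s * x) ∂ν : ℝ) : ℂ) = Λ s := by
  have hC : 0 ≤ C := by
    have := (norm_nonneg _).trans (hg 0 le_rfl hs.le)
    simpa using this
  -- the damped exponentials, with `b = (n + 1)²`
  set G : ℕ → ℝ → ℝ := fun n x =>
    Real.exp (-s * x) * Real.exp (-(x ^ 2 / (4 * ((n : ℝ) + 1) ^ 2))) with hG
  have hGle : ∀ n x, G n x ≤ Real.exp (-s * x) := by
    intro n x
    refine mul_le_of_le_one_right (Real.exp_pos _).le (Real.exp_le_one_iff.2 ?_)
    have : 0 ≤ x ^ 2 / (4 * ((n : ℝ) + 1) ^ 2) := by positivity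
    linarith
  have hGlim : ∀ x, Tendsto (fun n => G n x) atTop (𝓝 (Real.exp (-s * x))) := by
    intro x
    have h1 : Tendsto (fun n : ℕ => (4 * ((n : ℝ) + 1) ^ 2)) atTop atTop :=
      ((tendsto_pow_atTop two_ne_zero).comp
        (tendsto_atTop_add_const_right _ _ tendsto_natCast_atTop_atTop)).const_mul_atTop (by norm_num)
    have h2 := ((Real.continuous_exp.tendsto _).comp
      (h1.const_div_atTop (x ^ 2)).neg).const_mul (Real.exp (-s * x))
    simpa [hG] using h2
  have hGint : ∀ n, Integrable (G n) ν := by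
    intro n
    have h0 : ∀ x, ‖G n x‖ ≤ Real.exp (s ^ 2 * ((n : ℝ) + 1) ^ 2) := by
      intro x
      rw [Real.norm_of_nonneg (by positivity), hG]
      dsimp only
      rw [← Real.exp_add]
      refine Real.exp_le_exp.2 ?_
      have : s ^ 2 * ((n : ℝ) + 1) ^ 2 - (-s * x + -(x ^ 2 / (4 * ((n : ℝ) + 1) ^ 2)))
          = (2 * s * ((n : ℝ) + 1) ^ 2 + x) ^ 2 / (4 * ((n : ℝ) + 1) ^ 2) := by
        field_simp; ring
      have h4 : 0 ≤ (2 * s * ((n : ℝ) + 1) ^ 2 + x) ^ 2 / (4 * ((n : ℝ) + 1) ^ 2) := by positivity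
      linarith
    exact (integrable_const (Real.exp (s ^ 2 * ((n : ℝ) + 1) ^ 2))).mono'
      (by fun_prop) (ae_of_all _ h0)
  have hpi : 0 < √Real.pi := Real.sqrt_pos.2 Real.pi_pos
  -- the substitution `y = u / (n + 1)` makes the Gaussian weight independent of `n`
  have hval : ∀ n : ℕ, ((√Real.pi * ∫ x, G n x ∂ν : ℝ) : ℂ)
      = ∫ u : ℝ, Λ (s + ((u / ((n : ℝ) + 1) : ℝ) : ℂ) * Complex.I) * Complex.exp (-u ^ 2) := by
    intro n
    have hn : (0 : ℝ) < (n : ℝ) + 1 := by positivity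
    have h1 := integral_exp_mul_gaussian_eq ν hd hc hs hg hν (b := ((n : ℝ) + 1) ^ 2)
      (by positivity)
    have h2 := Measure.integral_comp_div (fun y : ℝ => Λ (s + y * Complex.I) *
      Complex.exp (-((((n : ℝ) + 1) ^ 2 : ℝ) : ℂ) * y ^ 2)) ((n : ℝ) + 1)
    rw [← h1, abs_of_pos hn, Complex.real_smul, ← Complex.ofReal_mul] at h2
    rw [Real.sqrt_div Real.pi_pos.le, Real.sqrt_sq hn.le, ← mul_assoc,
      mul_div_cancel₀ _ hn.ne'] at h2
    rw [← h2]
    congr with u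
    congr 2
    push_cast
    have : ((n : ℂ) + 1) ≠ 0 := by exact_mod_cast hn.ne'
    field_simp
  have hrhs : Tendsto (fun n : ℕ => ((√Real.pi * ∫ x, G n x ∂ν : ℝ) : ℂ)) atTop
      (𝓝 ((√Real.pi : ℝ) * Λ s)) := by
    have e : ((√Real.pi : ℝ) : ℂ) * Λ s = ∫ u : ℝ, Λ s * Complex.exp (-u ^ 2) := by
      rw [integral_const_mul, mul_comm]
      congr 1
      have := integral_gaussian 1
      rw [div_one] at this
      rw [← this]
      refine integral_ofReal.symm.trans ?_
      congr with u
      simp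
    simp_rw [hval]
    rw [e]
    have hline : ∀ u v : ℝ, (0 : ℝ) ≤ ((s : ℂ) + ((u / v : ℝ) : ℂ) * Complex.I).re := by
      intro u v
      simpa using hs.le
    refine tendsto_integral_of_dominated_convergence
      (fun u => C * Real.exp (D ^ 2 / 2 ) * Real.exp (-(1 / 2) * u ^ 2)) ?_ ?_ ?_ ?_
    · intro n
      refine Continuous.aestronglyMeasurable (Continuous.mul ?_ (by fun_prop))
      exact hc.comp_continuous (by fun_prop) fun u => hline u _
    · exact (integrable_exp_neg_mul_sq (by norm_num)).const_mul _
    · intro n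
      refine ae_of_all _ fun u => ?_
      have hn : (1 : ℝ) ≤ (n : ℝ) + 1 := by
        have : (0 : ℝ) ≤ n := by positivity
        linarith
      have h1 := hg (s + ((u / ((n : ℝ) + 1) : ℝ) : ℂ) * Complex.I) (hline u _) (by
        simp only [Complex.add_re, Complex.ofReal_re, Complex.re_ofReal_mul, Complex.I_re,
          mul_zero, add_zero, le_refl])
      rw [norm_mul, Complex.norm_exp]
      have h2 : (-(u : ℂ) ^ 2).re = - u ^ 2 := by
        rw [← Complex.ofReal_pow, ← Complex.ofReal_neg, Complex.ofReal_re]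
      rw [h2]
      refine (mul_le_mul_of_nonneg_right h1 (Real.exp_pos _).le).trans ?_
      rw [mul_assoc, mul_assoc, ← Real.exp_add, ← Real.exp_add]
      refine mul_le_mul_of_nonneg_left (Real.exp_le_exp.2 ?_) hC
      simp only [Complex.add_im, Complex.ofReal_im, Complex.mul_im, Complex.ofReal_re,
        Complex.I_im, mul_one, Complex.I_re, mul_zero, add_zero, zero_add]
      have h3 : |u / ((n : ℝ) + 1)| ≤ |u| := by
        rw [abs_div, abs_of_pos (by linarith : (0 : ℝ) < (n : ℝ) + 1)]
        exact div_le_self (abs_nonneg _) hn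
      have h4 : D * |u / ((n : ℝ) + 1)| ≤ |D| * |u| :=
        (mul_le_mul_of_nonneg_right (le_abs_self D) (abs_nonneg _)).trans
          (mul_le_mul_of_nonneg_left h3 (abs_nonneg _))
      nlinarith [sq_nonneg (|D| - |u|), sq_abs D, sq_abs u]
    · refine ae_of_all _ fun u => Tendsto.mul_const _ ?_
      have h1 : Tendsto (fun n : ℕ => u / ((n : ℝ) + 1)) atTop (𝓝 0) :=
        (tendsto_atTop_add_const_right _ _ tendsto_natCast_atTop_atTop).const_div_atTop u
      have h2 : Tendsto (fun n : ℕ => (s : ℂ) + ((u / ((n : ℝ) + 1) : ℝ) : ℂ) * Complex.I) atTop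
          (𝓝 (s + ((0 : ℝ) : ℂ) * Complex.I)) :=
        (((Complex.continuous_ofReal.tendsto _).comp h1).mul_const _).const_add _
      rw [Complex.ofReal_zero, zero_mul, add_zero] at h2
      have h3 := hc (s : ℂ) (by simpa using hs.le)
      exact h3.tendsto.comp (tendsto_nhdsWithin_iff.2 ⟨h2, Eventually.of_forall fun n => hline u _⟩)
  have hpic : ((√Real.pi : ℝ) : ℂ) ≠ 0 := by exact_mod_cast hpi.ne'
  have hlim : Tendsto (fun n : ℕ => ((∫ x, G n x ∂ν : ℝ) : ℂ)) atTop (𝓝 (Λ s)) := by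
    have := hrhs.const_mul (((√Real.pi : ℝ) : ℂ)⁻¹)
    rw [inv_mul_cancel_left₀ hpic] at this
    refine this.congr fun n => ?_
    rw [Complex.ofReal_mul, inv_mul_cancel_left₀ hpic]
  have hlimr : Tendsto (fun n : ℕ => ∫ x, G n x ∂ν) atTop (𝓝 (Λ s).re) := by
    exact ((Complex.continuous_re.tendsto _).comp hlim).congr fun n => Complex.ofReal_re _
  have hInt : Integrable (fun x => Real.exp (-s * x)) ν := by
    refine integrable_of_tendsto (G := G) (ae_of_all _ hGlim)
      (fun n => (hGint n).aestronglyMeasurable) ?_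
    have h1 : ∀ n, ∫⁻ x, ‖G n x‖ₑ ∂ν = ENNReal.ofReal (∫ x, G n x ∂ν) := by
      intro n
      rw [ofReal_integral_eq_lintegral_ofReal (hGint n) (ae_of_all _ fun x => by positivity)]
      refine lintegral_congr fun x => ?_
      rw [Real.enorm_of_nonneg (by positivity)]
    simp_rw [h1]
    rw [(ENNReal.tendsto_ofReal hlimr).liminf_eq]
    exact ENNReal.ofReal_ne_top
  refine ⟨hInt, ?_⟩
  have hlim2 : Tendsto (fun n : ℕ => ∫ x, G n x ∂ν) atTop (𝓝 (∫ x, Real.exp (-s * x) ∂ν)) := by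
    refine tendsto_integral_of_dominated_convergence _ (fun n => (hGint n).aestronglyMeasurable)
      hInt (fun n => ae_of_all _ fun x => ?_) (ae_of_all _ hGlim)
    rw [Real.norm_of_nonneg (by positivity)]
    exact hGle n x
  exact tendsto_nhds_unique ((Complex.continuous_ofReal.tendsto _).comp hlim2) hlim

/-! ### Laplace transforms of stable laws -/

theorem arg_neg_mul_I {t : ℝ} (ht : t ≠ 0) :
    Complex.arg (-t * Complex.I) = -(Real.sign t * (Real.pi / 2)) := by
  rcases lt_or_gt_of_ne ht with h | h
  · rw [Real.sign_of_neg h]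
    have : (-(t : ℂ) * Complex.I) = ((-t : ℝ) : ℂ) * Complex.I := by push_cast; ring
    rw [this, Complex.arg_real_mul _ (by linarith), Complex.arg_I]
    ring
  · rw [Real.sign_of_pos h]
    have : (-(t : ℂ) * Complex.I) = ((t : ℝ) : ℂ) * (-Complex.I) := by ring
    rw [this, Complex.arg_real_mul _ h, Complex.arg_neg_I]
    ring

theorem norm_neg_mul_I (t : ℝ) : ‖(-t * Complex.I : ℂ)‖ = |t| := by simp

theorem cos_pi_mul_div_two_ne_zero {α : ℝ} (h0 : 0 < α) (h2 : α ≤ 2) (h1 : α ≠ 1) :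
    Real.cos (Real.pi * α / 2) ≠ 0 := by
  have hp := Real.pi_pos
  rcases lt_or_gt_of_ne h1 with h | h
  · exact (Real.cos_pos_of_mem_Ioo ⟨by nlinarith, by nlinarith⟩).ne'
  · exact (Real.cos_neg_of_pi_div_two_lt_of_lt (by nlinarith) (by nlinarith)).ne

/-- On the imaginary axis, `exp (-κ z ^ α - μ z)` is the characteristic function of the stable
law, if `κ cos (π α / 2) = σ ^ α`. -/
theorem stableExponent_eq_of_ne_one {α : ℝ} (σ μ : ℝ) (h0 : 0 < α) (h2 : α ≤ 2) (h1 : α ≠ 1)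
    (t : ℝ) :
    stableExponent α 1 σ μ t =
      -(((σ ^ α / Real.cos (Real.pi * α / 2) : ℝ) : ℂ) * (-t * Complex.I) ^ (α : ℂ))
        - μ * (-t * Complex.I) := by
  rw [stableExponent, if_neg h1]
  have hc := cos_pi_mul_div_two_ne_zero h0 h2 h1
  rcases eq_or_ne t 0 with rfl | ht
  · simp [Real.zero_rpow h0.ne', Complex.zero_cpow (by exact_mod_cast h0.ne' : (α : ℂ) ≠ 0)]
  · rw [Complex.cpow_ofReal, norm_neg_mul_I, arg_neg_mul_I ht, Real.tan_eq_sin_div_cos]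
    have hs : Real.cos (-(Real.sign t * (Real.pi / 2)) * α) = Real.cos (Real.pi * α / 2) ∧
        Real.sin (-(Real.sign t * (Real.pi / 2)) * α)
          = - (Real.sign t * Real.sin (Real.pi * α / 2)) := by
      rcases lt_or_gt_of_ne ht with h | h
      · rw [Real.sign_of_neg h]
        constructor
        · congr 1; ring
        · rw [neg_one_mul (Real.sin _), neg_neg]; congr 1; ring
      · rw [Real.sign_of_pos h]
        constructor
        · rw [← Real.cos_neg]; congr 1; ring
        · rw [one_mul, one_mul, ← Real.sin_neg]; congr 1; ring
    rw [hs.1, hs.2]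
    have hc' : Complex.cos (Real.pi * α / 2) ≠ 0 := by exact_mod_cast hc
    push_cast
    field_simp
    ring

/-- On the imaginary axis, `exp ((2 σ / π) z log z - μ z)` is the characteristic function of the
`1`-stable law. -/
theorem stableExponent_one_eq (σ μ t : ℝ) :
    stableExponent 1 1 σ μ t =
      ((2 * σ / Real.pi : ℝ) : ℂ) * ((-t * Complex.I) * Complex.log (-t * Complex.I))
        - μ * (-t * Complex.I) := by
  rw [stableExponent, if_pos rfl]
  rcases eq_or_ne t 0 with rfl | ht
  · simp
  · rw [Complex.log, norm_neg_mul_I, arg_neg_mul_I ht]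
    have hp : (Real.pi : ℂ) ≠ 0 := by exact_mod_cast Real.pi_ne_zero
    rcases lt_or_gt_of_ne ht with h | h
    · rw [Real.sign_of_neg h, abs_of_neg h]
      push_cast
      field_simp
      linear_combination (σ * t * Real.pi : ℂ) * Complex.I_sq
    · rw [Real.sign_of_pos h, abs_of_pos h]
      push_cast
      field_simp
      linear_combination (-σ * t * Real.pi : ℂ) * Complex.I_sq

/-- In a vertical strip, `re (κ z ^ α)` is bounded below, for `κ = σ ^ α / cos (π α / 2)`: if
`1 < α` then `κ ≤ 0`, and `re (z ^ α)` is positive only in a sector that meets the strip in a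
bounded set. -/
theorem exists_le_re_cpow {α σ : ℝ} (h0 : 0 < α) (h2 : α ≤ 2) (h1 : α ≠ 1) (hσ : 0 ≤ σ) (s : ℝ) :
    ∃ M : ℝ, ∀ z : ℂ, 0 ≤ z.re → z.re ≤ s →
      -(σ ^ α / Real.cos (Real.pi * α / 2) * (z ^ (α : ℂ)).re) ≤ M := by
  have hp := Real.pi_pos
  have hσα : 0 ≤ σ ^ α := Real.rpow_nonneg hσ α
  rcases lt_or_gt_of_ne h1 with h | h
  · refine ⟨0, fun z hz _ => ?_⟩
    have hc : 0 < Real.cos (Real.pi * α / 2) :=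
      Real.cos_pos_of_mem_Ioo ⟨by nlinarith, by nlinarith⟩
    have ha := Complex.abs_arg_le_pi_div_two_iff.2 hz
    have hre : 0 ≤ (z ^ (α : ℂ)).re := by
      rw [Complex.cpow_ofReal_re]
      refine mul_nonneg (by positivity) (Real.cos_nonneg_of_mem_Icc ?_)
      rw [abs_le] at ha
      constructor <;> nlinarith
    have : 0 ≤ σ ^ α / Real.cos (Real.pi * α / 2) * (z ^ (α : ℂ)).re := by positivity
    linarith
  · have hc : Real.cos (Real.pi * α / 2) < 0 :=
      Real.cos_neg_of_pi_div_two_lt_of_lt (by nlinarith) (by nlinarith)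
    set κ := σ ^ α / Real.cos (Real.pi * α / 2) with hκ
    have hκ0 : 0 ≤ -κ := by
      rw [neg_nonneg]; exact div_nonpos_of_nonneg_of_nonpos hσα hc.le
    set c := Real.cos (Real.pi / (2 * α)) with hcdef
    have hlt : Real.pi / (2 * α) < Real.pi / 2 := by
      apply div_lt_div_of_pos_left hp (by norm_num) (by linarith)
    have hc0 : 0 < c := Real.cos_pos_of_mem_Ioo ⟨by linarith [show 0 < Real.pi / (2 * α) by positivity], hlt⟩
    refine ⟨-κ * |s / c| ^ α, fun z hz hzs => ?_⟩
    rw [← neg_mul]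
    refine mul_le_mul_of_nonneg_left ?_ hκ0
    have ha := Complex.abs_arg_le_pi_div_two_iff.2 hz
    rw [Complex.cpow_ofReal_re]
    rw [← Real.cos_abs, abs_mul, abs_of_pos h0]
    by_cases hb : |z.arg| * α < Real.pi / 2
    · have hcz : c ≤ Real.cos z.arg := by
        rw [← Real.cos_abs]
        refine Real.cos_le_cos_of_nonneg_of_le_pi (abs_nonneg _) (by linarith) ?_
        rw [le_div_iff₀ (by positivity)]
        linarith
      have hn : ‖z‖ * c ≤ s := by
        refine (mul_le_mul_of_nonneg_left hcz (norm_nonneg z)).trans ?_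
        rwa [Complex.norm_mul_cos_arg]
      have hn' : ‖z‖ ≤ |s / c| := ((le_div_iff₀ hc0).2 hn).trans (le_abs_self _)
      calc ‖z‖ ^ α * Real.cos (|z.arg| * α) ≤ ‖z‖ ^ α * 1 :=
            mul_le_mul_of_nonneg_left (Real.cos_le_one _) (by positivity)
        _ ≤ |s / c| ^ α := by
            rw [mul_one]; exact Real.rpow_le_rpow (norm_nonneg _) hn' h0.le
    · have : Real.cos (|z.arg| * α) ≤ 0 :=
        Real.cos_nonpos_of_pi_div_two_le_of_le (not_lt.1 hb) (by nlinarith [abs_nonneg z.arg])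
      exact (mul_nonpos_of_nonneg_of_nonpos (by positivity) this).trans (by positivity)

theorem laplace_stable_of_ne_one {α σ μ : ℝ} {ν : Measure ℝ} [IsProbabilityMeasure ν]
    (h0 : 0 < α) (h2 : α ≤ 2) (h1 : α ≠ 1) (hσ : 0 ≤ σ) (hν : IsStableLaw α σ μ ν)
    {s : ℝ} (hs : 0 < s) :
    Integrable (fun x => Real.exp (-s * x)) ν ∧
      ∫ x, Real.exp (-s * x) ∂ν
        = Real.exp (-(σ ^ α / Real.cos (Real.pi * α / 2) * s ^ α) - μ * s) := by
  obtain ⟨M, hM⟩ := exists_le_re_cpow h0 h2 h1 hσ s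
  set κ := σ ^ α / Real.cos (Real.pi * α / 2) with hκ
  have hα : 0 < (α : ℂ).re := by simpa using h0
  have h := laplace_of_charFun ν
    (Λ := fun z => Complex.exp (-((κ : ℂ) * z ^ (α : ℂ)) - μ * z)) (s := s)
    (C := Real.exp (M + |μ| * s)) (D := 0) ?_ ?_ hs ?_ ?_
  · refine ⟨h.1, Complex.ofReal_injective ?_⟩
    rw [h.2]
    push_cast [Complex.ofReal_cpow hs.le]
    rfl
  · intro z hz
    have : DifferentiableAt ℂ (fun z : ℂ => z ^ (α : ℂ)) z :=
      differentiableAt_id.cpow_const (Or.inl hz)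
    exact DifferentiableAt.differentiableWithinAt (by fun_prop)
  · intro z hz
    have : ContinuousAt (fun z : ℂ => z ^ (α : ℂ)) z :=
      Complex.continuousAt_cpow_const_of_re_pos (Or.inl hz) hα
    exact ContinuousAt.continuousWithinAt (by fun_prop)
  · intro z hz hzs
    rw [Complex.norm_exp, zero_mul, Real.exp_zero, mul_one]
    refine Real.exp_le_exp.2 ?_
    rw [Complex.sub_re, Complex.neg_re, Complex.re_ofReal_mul, Complex.re_ofReal_mul]
    have h3 := hM z hz hzs
    have h4 : -(μ * z.re) ≤ |μ| * s := by
      rw [← neg_mul]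
      exact (mul_le_mul_of_nonneg_right (neg_le_abs μ) hz).trans
        (mul_le_mul_of_nonneg_left hzs (abs_nonneg _))
    linarith
  · intro t
    rw [hν t, stableExponent_eq_of_ne_one σ μ h0 h2 h1]

theorem laplace_stable_one {σ μ : ℝ} {ν : Measure ℝ} [IsProbabilityMeasure ν]
    (hσ : 0 ≤ σ) (hν : IsStableLaw 1 σ μ ν) {s : ℝ} (hs : 0 < s) :
    Integrable (fun x => Real.exp (-s * x)) ν ∧
      ∫ x, Real.exp (-s * x) ∂ν
        = Real.exp (2 * σ / Real.pi * (s * Real.log s) - μ * s) := by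
  have hp := Real.pi_pos
  set θ := 2 * σ / Real.pi with hθ
  have hθ0 : 0 ≤ θ := by positivity
  have h := laplace_of_charFun ν
    (Λ := fun z => Complex.exp ((θ : ℂ) * (z * Complex.log z) - μ * z)) (s := s)
    (C := Real.exp (θ * s * s + |μ| * s)) (D := θ * s) ?_ ?_ hs ?_ ?_
  · refine ⟨h.1, Complex.ofReal_injective ?_⟩
    rw [h.2]
    push_cast [Complex.ofReal_log hs.le]
    rfl
  · intro z hz
    have : DifferentiableAt ℂ Complex.log z := Complex.differentiableAt_log (Or.inl hz)
    exact DifferentiableAt.differentiableWithinAt (by fun_prop)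
  · intro z hz
    have hzl : ContinuousWithinAt (fun z : ℂ => z * Complex.log z) {z | 0 ≤ z.re} z := by
      rcases eq_or_ne z 0 with rfl | hz0
      · -- at the origin, `|z log z| ≤ |z| (|log |z|| + π)`
        refine ContinuousAt.continuousWithinAt ?_
        rw [ContinuousAt, zero_mul, tendsto_zero_iff_norm_tendsto_zero]
        have h1 : Tendsto (fun z : ℂ => |‖z‖ * Real.log ‖z‖| + ‖z‖ * Real.pi) (𝓝 0) (𝓝 0) := by
          have hc : Continuous fun z : ℂ => |‖z‖ * Real.log ‖z‖| + ‖z‖ * Real.pi := by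
            have := Real.continuous_mul_log.comp (continuous_norm (E := ℂ))
            exact (this.abs).add (by fun_prop)
          simpa using hc.tendsto 0
        refine squeeze_zero (fun _ => norm_nonneg _) (fun z => ?_) h1
        rw [norm_mul, abs_mul, abs_norm, ← mul_add]
        refine mul_le_mul_of_nonneg_left ?_ (norm_nonneg _)
        rw [Complex.log]
        refine (norm_add_le _ _).trans ?_
        rw [norm_mul, Complex.norm_I, mul_one, Complex.norm_real, Complex.norm_real,
          Real.norm_eq_abs, Real.norm_eq_abs]
        exact add_le_add le_rfl (Complex.abs_arg_le_pi z)
      · refine ContinuousAt.continuousWithinAt ?_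
        have hsl : z ∈ Complex.slitPlane := by
          rcases (show 0 ≤ z.re from hz).lt_or_eq with h | h
          · exact Or.inl h
          · right
            intro him
            exact hz0 (Complex.ext h.symm him)
        have := continuousAt_clog hsl
        fun_prop
    have hlin : ContinuousWithinAt (fun z : ℂ => (μ : ℂ) * z) {z | 0 ≤ z.re} z := by fun_prop
    exact ((hzl.const_mul (θ : ℂ)).sub hlin).cexp
  · intro z hz hzs
    rw [Complex.norm_exp, ← Real.exp_add]
    refine Real.exp_le_exp.2 ?_
    rw [Complex.sub_re, Complex.re_ofReal_mul, Complex.re_ofReal_mul, Complex.mul_re,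
      Complex.log_re, Complex.log_im]
    have h4 : -(μ * z.re) ≤ |μ| * s := by
      rw [← neg_mul]
      exact (mul_le_mul_of_nonneg_right (neg_le_abs μ) hz).trans
        (mul_le_mul_of_nonneg_left hzs (abs_nonneg _))
    have h5 : 0 ≤ z.im * z.arg := by
      rcases le_or_gt 0 z.im with h | h
      · exact mul_nonneg h (Complex.arg_nonneg_iff.2 h)
      · exact mul_nonneg_of_nonpos_of_nonpos h.le (Complex.arg_neg_iff.2 h).le
    have h6 : z.re * Real.log ‖z‖ ≤ s * (s + |z.im|) := by
      have h7 : Real.log ‖z‖ ≤ ‖z‖ := Real.log_le_self (norm_nonneg _)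
      have h8 : ‖z‖ ≤ s + |z.im| := by
        refine (Complex.norm_le_abs_re_add_abs_im z).trans ?_
        rw [abs_of_nonneg hz]
        linarith
      exact (mul_le_mul_of_nonneg_left (h7.trans h8) hz).trans
        (mul_le_mul_of_nonneg_right hzs (by positivity))
    have h9 : θ * (z.re * Real.log ‖z‖ - z.im * z.arg) ≤ θ * (s * (s + |z.im|)) :=
      mul_le_mul_of_nonneg_left (by linarith) hθ0
    linarith
  · intro t
    rw [hν t, stableExponent_one_eq σ μ]

/-! ### The exponentially weighted mean -/

/-- The mean `∫ x e^{-s x} dν(x)`, which is minus the derivative of the Laplace transform of `ν`. -/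
noncomputable def weightedMean (ν : Measure ℝ) (s : ℝ) : ℝ := ∫ x, x * Real.exp (-s * x) ∂ν

theorem neg_mem_interior_integrableExpSet {ν : Measure ℝ}
    (hν : ∀ s, 0 < s → Integrable (fun x => Real.exp (-s * x)) ν) {s : ℝ} (hs : 0 < s) :
    -s ∈ interior (integrableExpSet id ν) := by
  refine mem_interior.2 ⟨Iio 0, fun t ht => ?_, isOpen_Iio, by simpa using hs⟩
  have := hν (-t) (by simpa using ht)
  simpa [integrableExpSet] using this

theorem integrable_mul_exp {ν : Measure ℝ}
    (hν : ∀ s, 0 < s → Integrable (fun x => Real.exp (-s * x)) ν) {s : ℝ} (hs : 0 < s) :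
    Integrable (fun x => x * Real.exp (-s * x)) ν := by
  simpa using integrable_pow_mul_exp_of_mem_interior_integrableExpSet
    (neg_mem_interior_integrableExpSet hν hs) 1

theorem hasDerivAt_laplace {ν : Measure ℝ}
    (hν : ∀ s, 0 < s → Integrable (fun x => Real.exp (-s * x)) ν) {s : ℝ} (hs : 0 < s) :
    HasDerivAt (fun s => ∫ x, Real.exp (-s * x) ∂ν) (-weightedMean ν s) s := by
  have h := hasDerivAt_mgf (neg_mem_interior_integrableExpSet hν hs)
  have := h.scomp s (hasDerivAt_neg s)
  simpa [Function.comp_def, mgf, weightedMean] using this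

theorem continuousOn_weightedMean {ν : Measure ℝ}
    (hν : ∀ s, 0 < s → Integrable (fun x => Real.exp (-s * x)) ν) :
    ContinuousOn (weightedMean ν) (Ioi 0) := by
  have h1 : ContinuousOn (deriv (mgf id ν)) (interior (integrableExpSet id ν)) :=
    analyticOnNhd_mgf.deriv.continuousOn
  have h2 : ContinuousOn (fun s => deriv (mgf id ν) (-s)) (Ioi 0) :=
    h1.comp continuousOn_neg fun s hs => neg_mem_interior_integrableExpSet hν hs
  refine h2.congr fun s hs => ?_
  dsimp only
  rw [deriv_mgf (neg_mem_interior_integrableExpSet hν hs)]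
  rfl

/-- `x e^{-s x}` is antitone in `s`, for either sign of `x`. -/
theorem antitoneOn_weightedMean {ν : Measure ℝ}
    (hν : ∀ s, 0 < s → Integrable (fun x => Real.exp (-s * x)) ν) :
    AntitoneOn (weightedMean ν) (Ioi 0) := by
  intro s hs t ht hst
  refine integral_mono (integrable_mul_exp hν ht) (integrable_mul_exp hν hs) fun x => ?_
  dsimp only
  rcases le_total 0 x with hx | hx
  · exact mul_le_mul_of_nonneg_left (Real.exp_le_exp.2 (by nlinarith)) hx
  · exact mul_le_mul_of_nonpos_left (Real.exp_le_exp.2 (by nlinarith)) hx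

theorem weightedMean_stable_of_ne_one {α σ μ : ℝ} {ν : Measure ℝ} [IsProbabilityMeasure ν]
    (h0 : 0 < α) (h2 : α ≤ 2) (h1 : α ≠ 1) (hσ : 0 ≤ σ) (hν : IsStableLaw α σ μ ν)
    {s : ℝ} (hs : 0 < s) :
    weightedMean ν s = (σ ^ α * α / Real.cos (Real.pi * α / 2) * s ^ (α - 1) + μ)
      * Real.exp (-(σ ^ α / Real.cos (Real.pi * α / 2) * s ^ α) - μ * s) := by
  have hl := fun s hs => laplace_stable_of_ne_one h0 h2 h1 hσ hν (s := s) hs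
  have h := hasDerivAt_laplace (fun s hs => (hl s hs).1) hs
  have h' : HasDerivAt
      (fun s => Real.exp (-(σ ^ α / Real.cos (Real.pi * α / 2) * s ^ α) - μ * s)) _ s :=
    ((((Real.hasDerivAt_rpow_const (p := α) (Or.inl hs.ne')).const_mul
      (σ ^ α / Real.cos (Real.pi * α / 2))).neg).sub ((hasDerivAt_id s).const_mul μ)).exp
  have := h.unique (h'.congr_of_eventuallyEq
    ((lt_mem_nhds hs).mono fun t ht => (hl t ht).2))
  simp only [id] at this
  linear_combination -this

theorem weightedMean_stable_one {σ μ : ℝ} {ν : Measure ℝ} [IsProbabilityMeasure ν]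
    (hσ : 0 ≤ σ) (hν : IsStableLaw 1 σ μ ν) {s : ℝ} (hs : 0 < s) :
    weightedMean ν s = (μ - 2 * σ / Real.pi * (Real.log s + 1))
      * Real.exp (2 * σ / Real.pi * (s * Real.log s) - μ * s) := by
  have hl := fun s hs => laplace_stable_one hσ hν (s := s) hs
  have h := hasDerivAt_laplace (fun s hs => (hl s hs).1) hs
  have h' : HasDerivAt
      (fun s => Real.exp (2 * σ / Real.pi * (s * Real.log s) - μ * s)) _ s :=
    (((Real.hasDerivAt_mul_log hs.ne').const_mul (2 * σ / Real.pi)).sub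
      ((hasDerivAt_id s).const_mul μ)).exp
  have := h.unique (h'.congr_of_eventuallyEq
    ((lt_mem_nhds hs).mono fun t ht => (hl t ht).2))
  simp only [id] at this
  linear_combination -this

/-! ### Coverage given the numbers of base stations -/

/-- The mean factor `𝔼_g exp (-ζ T r^δ g ρ^(-δ))` by which an interferer at distance `ρ` reduces the
probability of coverage of a user whose serving base station is at distance `r`. -/
noncomputable def interfererFactor (T ζ δ : ℝ) (G : Measure ℝ) (r ρ : ℝ) : ℝ :=
  ∫ g, Real.exp (-(ζ * T * r ^ δ * (g * ρ ^ (-δ)))) ∂G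

/-- The mean factor of an interferer that is known only to be further away than the serving base
station: `interfererFactor` cut off at distances `ρ ≤ r`. -/
noncomputable def fartherFactor (T ζ δ : ℝ) (G : Measure ℝ) (r ρ : ℝ) : ℝ :=
  if r < ρ then interfererFactor T ζ δ G r ρ else 0

variable {T ζ δ N₀ : ℝ} {G : Measure ℝ}

theorem measurable_interfererFactor [IsProbabilityMeasure G] :
    Measurable fun q : ℝ × ℝ => interfererFactor T ζ δ G q.1 q.2 := by
  have : StronglyMeasurable fun p : (ℝ × ℝ) × ℝ =>
      Real.exp (-(ζ * T * p.1.1 ^ δ * (p.2 * p.1.2 ^ (-δ)))) :=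
    Measurable.stronglyMeasurable (by fun_prop)
  exact this.integral_prod_right.measurable

theorem measurable_fartherFactor [IsProbabilityMeasure G] :
    Measurable fun q : ℝ × ℝ => fartherFactor T ζ δ G q.1 q.2 :=
  Measurable.ite (measurableSet_lt measurable_fst measurable_snd) measurable_interfererFactor
    measurable_const

theorem exp_interferer_le_one (hT : 0 < T) (hζ : 0 < ζ) {r ρ g : ℝ} (hr : 0 ≤ r) (hρ : 0 ≤ ρ)
    (hg : 0 < g) : Real.exp (-(ζ * T * r ^ δ * (g * ρ ^ (-δ)))) ≤ 1 := by
  refine Real.exp_le_one_iff.2 (neg_nonpos.2 ?_)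
  have := Real.rpow_nonneg hr δ
  have := Real.rpow_nonneg hρ (-δ)
  positivity

theorem integrable_exp_interferer [IsProbabilityMeasure G] (hT : 0 < T) (hζ : 0 < ζ)
    (hG : ∀ᵐ g ∂G, 0 < g) {r ρ : ℝ} (hr : 0 ≤ r) (hρ : 0 ≤ ρ) :
    Integrable (fun g => Real.exp (-(ζ * T * r ^ δ * (g * ρ ^ (-δ))))) G := by
  refine (integrable_const (1 : ℝ)).mono' (by fun_prop) ?_
  filter_upwards [hG] with g hg
  rw [Real.norm_of_nonneg (Real.exp_pos _).le]
  exact exp_interferer_le_one hT hζ hr hρ hg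

theorem interfererFactor_nonneg (r ρ : ℝ) : 0 ≤ interfererFactor T ζ δ G r ρ :=
  integral_nonneg fun _ => (Real.exp_pos _).le

theorem interfererFactor_le_one [IsProbabilityMeasure G] (hT : 0 < T) (hζ : 0 < ζ)
    (hG : ∀ᵐ g ∂G, 0 < g) {r ρ : ℝ} (hr : 0 ≤ r) (hρ : 0 ≤ ρ) :
    interfererFactor T ζ δ G r ρ ≤ 1 := by
  have h : interfererFactor T ζ δ G r ρ ≤ ∫ _, (1 : ℝ) ∂G := by
    refine integral_mono_ae (integrable_exp_interferer hT hζ hG hr hρ) (integrable_const _) ?_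
    filter_upwards [hG] with g hg
    exact exp_interferer_le_one hT hζ hr hρ hg
  simpa using h

theorem fartherFactor_nonneg (r ρ : ℝ) : 0 ≤ fartherFactor T ζ δ G r ρ := by
  rw [fartherFactor]; split_ifs
  · exact interfererFactor_nonneg r ρ
  · exact le_rfl

theorem fartherFactor_le_one [IsProbabilityMeasure G] (hT : 0 < T) (hζ : 0 < ζ)
    (hG : ∀ᵐ g ∂G, 0 < g) {r ρ : ℝ} (hr : 0 ≤ r) (hρ : 0 ≤ ρ) :
    fartherFactor T ζ δ G r ρ ≤ 1 := by
  rw [fartherFactor]; split_ifs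
  · exact interfererFactor_le_one hT hζ hG hr hρ
  · exact zero_le_one

theorem expMeasure_Ioi (hζ : 0 < ζ) {x : ℝ} (hx : 0 ≤ x) :
    expMeasure ζ (Ioi x) = ENNReal.ofReal (Real.exp (-(ζ * x))) := by
  have := isProbabilityMeasure_expMeasure hζ
  have h1 := cdf_expMeasure_eq hζ x
  rw [if_pos hx, cdf_eq_real] at h1
  rw [← compl_Iic, ← ofReal_measureReal, probReal_compl_eq_one_sub measurableSet_Iic, h1]
  ring_nf

theorem sinr_gt_iff (hT : 0 < T) (hN₀ : 0 ≤ N₀) {n m : ℕ} {x : Fin (n + 1) → Plane}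
    {y : Fin m → Plane} {h : ℝ} {g : Fin (n + 1) → ℝ} {k : Fin m → ℝ} {i : Fin (n + 1)}
    (hx : 0 < ‖x i‖) (hg : ∀ j, 0 < g j) (hk : ∀ j, 0 < k j) :
    ENNReal.ofReal T < sinr δ N₀ x y h g k i ↔
      T * ‖x i‖ ^ δ * (N₀ + (∑ j, g (i.succAbove j) * ‖x (i.succAbove j)‖ ^ (-δ)
        + ∑ j, k j * ‖y j‖ ^ (-δ))) < h := by
  have hsum : ∑ j ∈ Finset.univ.erase i, g j * ‖x j‖ ^ (-δ)
      = ∑ j, g (i.succAbove j) * ‖x (i.succAbove j)‖ ^ (-δ) := by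
    have h1 := Finset.add_sum_erase Finset.univ (fun j => g j * ‖x j‖ ^ (-δ)) (Finset.mem_univ i)
    rw [Fin.sum_univ_succAbove _ i] at h1
    exact add_left_cancel h1
  have hI : 0 ≤ N₀ + (∑ j, g (i.succAbove j) * ‖x (i.succAbove j)‖ ^ (-δ)
        + ∑ j, k j * ‖y j‖ ^ (-δ)) := by
    refine add_nonneg hN₀ (add_nonneg ?_ ?_) <;> refine Finset.sum_nonneg fun j _ => ?_
    · exact mul_nonneg (hg _).le (by positivity)
    · exact mul_nonneg (hk _).le (by positivity)
  rw [sinr, hsum, ENNReal.lt_div_iff_mul_lt (Or.inr ENNReal.ofReal_ne_top)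
    (Or.inl ENNReal.ofReal_ne_top), ← ENNReal.ofReal_mul hT.le,
    ENNReal.ofReal_lt_ofReal_iff_of_nonneg (mul_nonneg hT.le hI), Real.rpow_neg (norm_nonneg _),
    ← div_eq_mul_inv, lt_div_iff₀ (Real.rpow_pos_of_pos hx δ)]
  ring_nf

theorem measurable_sinr (n m : ℕ) (i : Fin n) : Measurable
    fun w : ((Fin n → Plane) × (Fin m → Plane)) × ℝ × (Fin n → ℝ) × (Fin m → ℝ) =>
      sinr δ N₀ w.1.1 w.1.2 w.2.1 w.2.2.1 w.2.2.2 i := by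
  unfold sinr
  fun_prop

/-- The conditional probability, given the positions, that the `SINR` of the link to base station
`i` exceeds `T`. Exponential fading of the serving link turns the tail probability into a product
over the interferers. -/
theorem prob_sinr_gt [IsProbabilityMeasure G] (hT : 0 < T) (hζ : 0 < ζ) (hN₀ : 0 ≤ N₀)
    (hG : ∀ᵐ g ∂G, 0 < g) {n m : ℕ} {x : Fin (n + 1) → Plane}
    {y : Fin m → Plane} {i : Fin (n + 1)} (hx : 0 < ‖x i‖) :
    ((expMeasure ζ).prod ((Measure.pi fun _ : Fin (n + 1) => G).prod
        (Measure.pi fun _ : Fin m => G))).real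
      {v | ENNReal.ofReal T < sinr δ N₀ x y v.1 v.2.1 v.2.2 i}
    = Real.exp (-(ζ * T * ‖x i‖ ^ δ * N₀)) *
      ((∏ j, interfererFactor T ζ δ G ‖x i‖ ‖x (i.succAbove j)‖) *
        ∏ j, interfererFactor T ζ δ G ‖x i‖ ‖y j‖) := by
  have := isProbabilityMeasure_expMeasure hζ
  have hmeas : MeasurableSet {v : ℝ × (Fin (n + 1) → ℝ) × (Fin m → ℝ) |
      ENNReal.ofReal T < sinr δ N₀ x y v.1 v.2.1 v.2.2 i} := by
    refine measurableSet_lt measurable_const ?_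
    exact (measurable_sinr (δ := δ) (N₀ := N₀) (n + 1) m i).comp
      (measurable_const.prodMk measurable_id : Measurable fun v => ((x, y), v))
  set E : ℝ → ℝ → ℝ := fun ρ g => Real.exp (-(ζ * T * ‖x i‖ ^ δ * (g * ρ ^ (-δ)))) with hE
  have hgpos : ∀ᵐ v : (Fin (n + 1) → ℝ) × (Fin m → ℝ)
      ∂((Measure.pi fun _ : Fin (n + 1) => G).prod (Measure.pi fun _ : Fin m => G)),
      (∀ j, 0 < v.1 j) ∧ ∀ j, 0 < v.2 j := by
    have h1 : ∀ᵐ v ∂(Measure.pi fun _ : Fin (n + 1) => G), ∀ j, 0 < v j :=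
      ae_all_iff.2 fun j => (measurePreserving_eval (fun _ => G) j).quasiMeasurePreserving.ae hG
    have h2 : ∀ᵐ v ∂(Measure.pi fun _ : Fin m => G), ∀ j, 0 < v j :=
      ae_all_iff.2 fun j => (measurePreserving_eval (fun _ => G) j).quasiMeasurePreserving.ae hG
    filter_upwards [Measure.quasiMeasurePreserving_fst.ae h1,
      Measure.quasiMeasurePreserving_snd.ae h2] with v hv1 hv2 using ⟨hv1, hv2⟩
  rw [measureReal_def, Measure.prod_apply_symm hmeas]
  have hfib : ∀ᵐ v : (Fin (n + 1) → ℝ) × (Fin m → ℝ)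
      ∂((Measure.pi fun _ : Fin (n + 1) => G).prod (Measure.pi fun _ : Fin m => G)),
      expMeasure ζ ((fun h => (h, v)) ⁻¹' {v | ENNReal.ofReal T < sinr δ N₀ x y v.1 v.2.1 v.2.2 i})
      = ENNReal.ofReal (Real.exp (-(ζ * T * ‖x i‖ ^ δ * N₀)) *
        ((∏ j, (if j = i then 1 else E ‖x j‖ (v.1 j))) * ∏ j, E ‖y j‖ (v.2 j))) := by
    filter_upwards [hgpos] with v hv
    have hset : (fun h => (h, v)) ⁻¹' {v | ENNReal.ofReal T < sinr δ N₀ x y v.1 v.2.1 v.2.2 i}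
        = Ioi (T * ‖x i‖ ^ δ * (N₀ + (∑ j, v.1 (i.succAbove j) * ‖x (i.succAbove j)‖ ^ (-δ)
        + ∑ j, v.2 j * ‖y j‖ ^ (-δ)))) := by
      ext h
      exact sinr_gt_iff hT hN₀ hx hv.1 hv.2
    rw [hset, expMeasure_Ioi hζ]
    · congr 1
      rw [Fin.prod_univ_succAbove _ i, if_pos rfl, one_mul]
      simp only [Fin.succAbove_ne, if_false, hE]
      rw [← Real.exp_sum, ← Real.exp_sum, ← Real.exp_add, ← Real.exp_add]
      congr 1
      rw [Finset.sum_neg_distrib, Finset.sum_neg_distrib, ← Finset.mul_sum, ← Finset.mul_sum]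
      ring
    · refine mul_nonneg (by positivity) (add_nonneg hN₀ (add_nonneg ?_ ?_)) <;>
        refine Finset.sum_nonneg fun j _ => ?_
      · exact mul_nonneg (hv.1 _).le (by positivity)
      · exact mul_nonneg (hv.2 _).le (by positivity)
  rw [lintegral_congr_ae hfib, ← integral_eq_lintegral_of_nonneg_ae]
  · rw [integral_const_mul]
    congr 1
    rw [integral_prod_mul (fun v : Fin (n + 1) → ℝ => ∏ j, (if j = i then 1 else E ‖x j‖ (v j)))
      (fun v : Fin m → ℝ => ∏ j, E ‖y j‖ (v j)),
      integral_fintype_prod_eq_prod (fun j g => if j = i then 1 else E ‖x j‖ g),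
      integral_fintype_prod_eq_prod (fun j g => E ‖y j‖ g), Fin.prod_univ_succAbove _ i]
    simp [hE, interfererFactor]
  · refine ae_of_all _ fun v => mul_nonneg (Real.exp_pos _).le (mul_nonneg ?_ ?_)
    · refine Finset.prod_nonneg fun j _ => ?_
      split_ifs
      · exact zero_le_one
      · exact (Real.exp_pos _).le
    · exact Finset.prod_nonneg fun j _ => (Real.exp_pos _).le
  · refine Measurable.aestronglyMeasurable ?_
    refine measurable_const.mul (Measurable.mul ?_ ?_)
    · refine Finset.measurable_fun_prod _ fun j _ => ?_
      split_ifs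
      · exact measurable_const
      · fun_prop
    · fun_prop

/-- The event that base station `i` is strictly nearer to the user than any other of the inner
circle, and that its link has a `SINR` above `T`. -/
def servingEvent (T δ N₀ : ℝ) (n m : ℕ) (i : Fin (n + 1)) :
    Set (((Fin (n + 1) → Plane) × (Fin m → Plane)) × ℝ × (Fin (n + 1) → ℝ) × (Fin m → ℝ)) :=
  {w | (∀ j, ‖w.1.1 i‖ < ‖w.1.1 (i.succAbove j)‖) ∧
    ENNReal.ofReal T < sinr δ N₀ w.1.1 w.1.2 w.2.1 w.2.2.1 w.2.2.2 i}

theorem measurableSet_servingEvent (n m : ℕ) (i : Fin (n + 1)) :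
    MeasurableSet (servingEvent T δ N₀ n m i) := by
  have h : MeasurableSet {w : ((Fin (n + 1) → Plane) × (Fin m → Plane)) × ℝ ×
      (Fin (n + 1) → ℝ) × (Fin m → ℝ) | ∀ j, ‖w.1.1 i‖ < ‖w.1.1 (i.succAbove j)‖} := by
    rw [ofPred_forall]
    exact MeasurableSet.iInter fun j => measurableSet_lt (by fun_prop) (by fun_prop)
  exact h.inter (measurableSet_lt measurable_const (measurable_sinr _ _ _))

theorem disjoint_servingEvent (n m : ℕ) :
    Pairwise (Function.onFun Disjoint (servingEvent T δ N₀ n m)) := by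
  intro i i' hne
  refine Set.disjoint_left.2 fun w hw hw' => ?_
  obtain ⟨j, hj⟩ := Fin.exists_succAbove_eq hne.symm
  obtain ⟨j', hj'⟩ := Fin.exists_succAbove_eq hne
  have h1 := hw.1 j
  have h2 := hw'.1 j'
  rw [hj] at h1
  rw [hj'] at h2
  exact lt_asymm h1 h2

theorem ae_pi_norm_ne {U : Measure Plane} [IsProbabilityMeasure U]
    (hU : ∀ r : ℝ, ∀ᵐ x ∂U, ‖x‖ ≠ r) (n : ℕ) (i : Fin (n + 1)) (j : Fin n) :
    ∀ᵐ x ∂(Measure.pi fun _ : Fin (n + 1) => U), ‖x i‖ ≠ ‖x (i.succAbove j)‖ := by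
  have hmp := measurePreserving_piFinSuccAbove (fun _ : Fin (n + 1) => U) i
  have h : ∀ᵐ q ∂(U.prod (Measure.pi fun _ : Fin n => U)), ‖q.1‖ ≠ ‖q.2 j‖ := by
    have hms : MeasurableSet {q : Plane × (Fin n → Plane) | ‖q.1‖ = ‖q.2 j‖} :=
      measurableSet_eq_fun (by fun_prop) (by fun_prop)
    rw [ae_iff]
    simp only [ne_eq, not_not]
    rw [Measure.prod_apply_symm hms, lintegral_eq_zero_iff' (measurable_measure_prodMk_right hms).aemeasurable]
    refine ae_of_all _ fun z => ?_
    have := hU ‖z j‖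
    rw [ae_iff] at this
    simpa using this
  exact hmp.quasiMeasurePreserving.ae h

/-- The covered users are, up to ties between distances, those covered by a strictly nearest base
station. -/
theorem measure_coverageEvent_eq_sum {U V : Measure Plane} [IsProbabilityMeasure U]
    [IsProbabilityMeasure V] {n m : ℕ}
    (Q : Measure (ℝ × (Fin (n + 1) → ℝ) × (Fin m → ℝ))) [IsProbabilityMeasure Q]
    (hU : ∀ r : ℝ, ∀ᵐ x ∂U, ‖x‖ ≠ r) :
    (((Measure.pi fun _ : Fin (n + 1) => U).prod (Measure.pi fun _ : Fin m => V)).prod Q).real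
      (coverageEvent T δ N₀ (n + 1) m) =
    ∑ i, (((Measure.pi fun _ : Fin (n + 1) => U).prod (Measure.pi fun _ : Fin m => V)).prod Q).real
      (servingEvent T δ N₀ n m i) := by
  set P := ((Measure.pi fun _ : Fin (n + 1) => U).prod (Measure.pi fun _ : Fin m => V)).prod Q
    with hP
  have htie : ∀ᵐ w ∂P, ∀ i, ∀ j, ‖w.1.1 i‖ ≠ ‖w.1.1 (i.succAbove j)‖ := by
    refine ae_all_iff.2 fun i => ae_all_iff.2 fun j => ?_
    exact Measure.quasiMeasurePreserving_fst.ae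
      (Measure.quasiMeasurePreserving_fst.ae (ae_pi_norm_ne hU n i j))
  have hae : coverageEvent T δ N₀ (n + 1) m =ᵐ[P] ⋃ i, servingEvent T δ N₀ n m i := by
    rw [eventuallyEq_set]
    filter_upwards [htie] with w hw
    rw [mem_iUnion]
    constructor
    · rintro ⟨i, hi, hs⟩
      exact ⟨i, fun j => lt_of_le_of_ne (hi _) (hw i j), hs⟩
    · rintro ⟨i, hi, hs⟩
      refine ⟨i, fun j => ?_, hs⟩
      rcases eq_or_ne j i with rfl | hj
      · exact le_rfl
      · obtain ⟨k, rfl⟩ := Fin.exists_succAbove_eq hj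
        exact (hi k).le
  rw [measureReal_congr hae, measureReal_def,
    measure_iUnion (disjoint_servingEvent n m) fun i => measurableSet_servingEvent n m i,
    tsum_fintype, ENNReal.toReal_sum fun i _ => measure_ne_top _ _]
  rfl

/-- The probability that a given base station is the nearest one and covers the user: the other
base stations of the inner circle contribute independent factors, as do those of the outer one. -/
theorem measure_servingEvent [IsProbabilityMeasure G] (hT : 0 < T) (hζ : 0 < ζ) (hN₀ : 0 ≤ N₀)
    (hG : ∀ᵐ g ∂G, 0 < g) {U V : Measure Plane} [IsProbabilityMeasure U]
    [IsProbabilityMeasure V] (hU : ∀ r : ℝ, ∀ᵐ x ∂U, ‖x‖ ≠ r) (n m : ℕ) (i : Fin (n + 1)) :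
    (((Measure.pi fun _ : Fin (n + 1) => U).prod (Measure.pi fun _ : Fin m => V)).prod
      ((expMeasure ζ).prod ((Measure.pi fun _ : Fin (n + 1) => G).prod
        (Measure.pi fun _ : Fin m => G)))).real (servingEvent T δ N₀ n m i) =
    ∫ x, Real.exp (-(ζ * T * ‖x‖ ^ δ * N₀)) *
      ((∫ y, fartherFactor T ζ δ G ‖x‖ ‖y‖ ∂U) ^ n *
        (∫ y, interfererFactor T ζ δ G ‖x‖ ‖y‖ ∂V) ^ m) ∂U := by
  have := isProbabilityMeasure_expMeasure hζ
  set Q := (expMeasure ζ).prod ((Measure.pi fun _ : Fin (n + 1) => G).prod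
        (Measure.pi fun _ : Fin m => G)) with hQ
  set PU := Measure.pi fun _ : Fin (n + 1) => U with hPU
  set PV := Measure.pi fun _ : Fin m => V with hPV
  have hmS := measurableSet_servingEvent (T := T) (δ := δ) (N₀ := N₀) n m i
  have hφ := measurable_interfererFactor (T := T) (ζ := ζ) (δ := δ) (G := G)
  have hψ := measurable_fartherFactor (T := T) (ζ := ζ) (δ := δ) (G := G)
  set w : ℝ → ℝ := fun r => Real.exp (-(ζ * T * r ^ δ * N₀)) with hw
  have hwm : Measurable w := by fun_prop
  have hw1 : ∀ r, 0 ≤ r → w r ≤ 1 := by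
    intro r hr
    refine Real.exp_le_one_iff.2 (neg_nonpos.2 ?_)
    have := Real.rpow_nonneg hr δ
    positivity
  have hne : ∀ᵐ x ∂PU, ‖x i‖ ≠ 0 :=
    (measurePreserving_eval (fun _ : Fin (n + 1) => U) i).quasiMeasurePreserving.ae (hU 0)
  set f : (Fin (n + 1) → Plane) × (Fin m → Plane) → ℝ := fun p =>
    w ‖p.1 i‖ * ((∏ j, fartherFactor T ζ δ G ‖p.1 i‖ ‖p.1 (i.succAbove j)‖) *
      ∏ j, interfererFactor T ζ δ G ‖p.1 i‖ ‖p.2 j‖) with hf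
  have hψp : ∀ x : Fin (n + 1) → Plane,
      0 ≤ ∏ j, fartherFactor T ζ δ G ‖x i‖ ‖x (i.succAbove j)‖ ∧
      ∏ j, fartherFactor T ζ δ G ‖x i‖ ‖x (i.succAbove j)‖ ≤ 1 := fun x =>
    ⟨Finset.prod_nonneg fun j _ => fartherFactor_nonneg _ _,
      Finset.prod_le_one (fun j _ => fartherFactor_nonneg _ _)
        fun j _ => fartherFactor_le_one hT hζ hG (norm_nonneg _) (norm_nonneg _)⟩
  have hφp : ∀ (r : ℝ) (y : Fin m → Plane), 0 ≤ r →
      0 ≤ ∏ j, interfererFactor T ζ δ G r ‖y j‖ ∧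
      ∏ j, interfererFactor T ζ δ G r ‖y j‖ ≤ 1 := fun r y hr =>
    ⟨Finset.prod_nonneg fun j _ => interfererFactor_nonneg _ _,
      Finset.prod_le_one (fun j _ => interfererFactor_nonneg _ _)
        fun j _ => interfererFactor_le_one hT hζ hG hr (norm_nonneg _)⟩
  have hfm : Measurable f := by
    refine Measurable.mul (by fun_prop) (Measurable.mul ?_ ?_) <;>
      refine Finset.measurable_fun_prod _ fun j _ => ?_
    · exact hψ.comp (by fun_prop : Measurable fun p : (Fin (n + 1) → Plane) × (Fin m → Plane) =>
        (‖p.1 i‖, ‖p.1 (i.succAbove j)‖))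
    · exact hφ.comp (by fun_prop : Measurable fun p : (Fin (n + 1) → Plane) × (Fin m → Plane) =>
        (‖p.1 i‖, ‖p.2 j‖))
  have hf1 : ∀ p, ‖f p‖ ≤ 1 := by
    intro p
    have h1 := hψp p.1
    have h2 := hφp ‖p.1 i‖ p.2 (norm_nonneg _)
    have h0 : 0 ≤ w ‖p.1 i‖ := (Real.exp_pos _).le
    rw [Real.norm_of_nonneg (mul_nonneg h0 (mul_nonneg h1.1 h2.1))]
    exact mul_le_one₀ (hw1 _ (norm_nonneg _)) (mul_nonneg h1.1 h2.1) (mul_le_one₀ h1.2 h2.1 h2.2)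
  have hfi : Integrable f (PU.prod PV) :=
    (integrable_const (1 : ℝ)).mono' hfm.aestronglyMeasurable (ae_of_all _ hf1)
  have hstep : ((PU.prod PV).prod Q).real (servingEvent T δ N₀ n m i)
      = ∫ p, f p ∂(PU.prod PV) := by
    rw [measureReal_def, Measure.prod_apply hmS, ← integral_toReal
      (measurable_measure_prodMk_left hmS).aemeasurable (ae_of_all _ fun _ => measure_lt_top _ _)]
    refine integral_congr_ae ?_
    filter_upwards [Measure.quasiMeasurePreserving_fst.ae hne] with p hp
    by_cases hnear : ∀ j, ‖p.1 i‖ < ‖p.1 (i.succAbove j)‖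
    · have : Prod.mk p ⁻¹' servingEvent T δ N₀ n m i =
          {v | ENNReal.ofReal T < sinr δ N₀ p.1 p.2 v.1 v.2.1 v.2.2 i} := by
        ext v; exact and_iff_right hnear
      rw [this, ← measureReal_def, prob_sinr_gt hT hζ hN₀ hG
        (lt_of_le_of_ne (norm_nonneg _) hp.symm)]
      simp only [hf, hw, fartherFactor, hnear, if_true]
    · have : Prod.mk p ⁻¹' servingEvent T δ N₀ n m i = ∅ := by
        ext v
        simp only [mem_preimage, mem_empty_iff_false, iff_false]
        exact fun h => hnear h.1
      rw [this, measure_empty, ENNReal.toReal_zero]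
      push Not at hnear
      obtain ⟨j, hj⟩ := hnear
      have : ∏ j, fartherFactor T ζ δ G ‖p.1 i‖ ‖p.1 (i.succAbove j)‖ = 0 :=
        Finset.prod_eq_zero (Finset.mem_univ j) (if_neg (not_lt.2 hj))
      simp only [hf, this, zero_mul, mul_zero]
  rw [hstep, integral_prod _ hfi]
  have hinner : ∀ x : Fin (n + 1) → Plane, ∫ y, f (x, y) ∂PV =
      w ‖x i‖ * ((∏ j, fartherFactor T ζ δ G ‖x i‖ ‖x (i.succAbove j)‖) *
        (∫ y, interfererFactor T ζ δ G ‖x i‖ ‖y‖ ∂V) ^ m) := by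
    intro x
    simp only [hf, integral_const_mul]
    rw [integral_fintype_prod_eq_pow (fun y => interfererFactor T ζ δ G ‖x i‖ ‖y‖),
      Fintype.card_fin]
  simp_rw [hinner]
  have hmp := measurePreserving_piFinSuccAbove (fun _ : Fin (n + 1) => U) i
  have hinner2 : ∀ x : Plane, ∫ z : Fin n → Plane,
      w ‖x‖ * ((∏ j, fartherFactor T ζ δ G ‖x‖ ‖z j‖) *
        (∫ y, interfererFactor T ζ δ G ‖x‖ ‖y‖ ∂V) ^ m) ∂(Measure.pi fun _ : Fin n => U) =
      w ‖x‖ * ((∫ y, fartherFactor T ζ δ G ‖x‖ ‖y‖ ∂U) ^ n *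
        (∫ y, interfererFactor T ζ δ G ‖x‖ ‖y‖ ∂V) ^ m) := by
    intro x
    rw [integral_const_mul, integral_mul_const,
      integral_fintype_prod_eq_pow (fun y => fartherFactor T ζ δ G ‖x‖ ‖y‖), Fintype.card_fin]
  have hVm : Measurable fun x : Plane => ∫ y, interfererFactor T ζ δ G ‖x‖ ‖y‖ ∂V := by
    have : StronglyMeasurable fun p : Plane × Plane => interfererFactor T ζ δ G ‖p.1‖ ‖p.2‖ :=
      (hφ.comp (by fun_prop : Measurable fun p : Plane × Plane => (‖p.1‖, ‖p.2‖))).stronglyMeasurable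
    exact this.integral_prod_right.measurable
  have hV0 : ∀ x : Plane, 0 ≤ (∫ y, interfererFactor T ζ δ G ‖x‖ ‖y‖ ∂V) ∧
      (∫ y, interfererFactor T ζ δ G ‖x‖ ‖y‖ ∂V) ≤ 1 := by
    intro x
    refine ⟨integral_nonneg fun y => interfererFactor_nonneg _ _, ?_⟩
    have h := norm_integral_le_of_norm_le_const (μ := V) (C := 1)
      (f := fun y : Plane => interfererFactor T ζ δ G ‖x‖ ‖y‖) (ae_of_all _ fun y => by
        rw [Real.norm_of_nonneg (interfererFactor_nonneg _ _)]
        exact interfererFactor_le_one hT hζ hG (norm_nonneg _) (norm_nonneg _))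
    simpa using (le_abs_self _).trans h
  set F : Plane × (Fin n → Plane) → ℝ := fun q => w ‖q.1‖ *
    ((∏ j, fartherFactor T ζ δ G ‖q.1‖ ‖q.2 j‖) *
        (∫ y, interfererFactor T ζ δ G ‖q.1‖ ‖y‖ ∂V) ^ m) with hF
  have hFi : Integrable F (U.prod (Measure.pi fun _ : Fin n => U)) := by
    refine (integrable_const (1 : ℝ)).mono' (Measurable.aestronglyMeasurable ?_)
      (ae_of_all _ fun q => ?_)
    · refine Measurable.mul (by fun_prop) (Measurable.mul ?_ ?_)
      · refine Finset.measurable_fun_prod _ fun j _ => ?_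
        exact hψ.comp (by fun_prop : Measurable fun q : Plane × (Fin n → Plane) =>
          (‖q.1‖, ‖q.2 j‖))
      · exact (hVm.comp measurable_fst).pow_const m
    · have h1 : 0 ≤ ∏ j, fartherFactor T ζ δ G ‖q.1‖ ‖q.2 j‖ ∧
          ∏ j, fartherFactor T ζ δ G ‖q.1‖ ‖q.2 j‖ ≤ 1 :=
        ⟨Finset.prod_nonneg fun j _ => fartherFactor_nonneg _ _,
          Finset.prod_le_one (fun j _ => fartherFactor_nonneg _ _)
          fun j _ => fartherFactor_le_one hT hζ hG (norm_nonneg _) (norm_nonneg _)⟩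
      have h2 := hV0 q.1
      have h3 := pow_nonneg h2.1 m
      have h0 : 0 ≤ w ‖q.1‖ := (Real.exp_pos _).le
      rw [Real.norm_of_nonneg (mul_nonneg h0 (mul_nonneg h1.1 h3))]
      exact mul_le_one₀ (hw1 _ (norm_nonneg _)) (mul_nonneg h1.1 h3)
        (mul_le_one₀ h1.2 h3 (pow_le_one₀ h2.1 h2.2))
  have hswap := hmp.integral_comp' (g := F)
  rw [integral_prod _ hFi] at hswap
  simp only [hF, hinner2] at hswap
  rw [← hswap]
  rfl

theorem measure_coverageEvent_succ [IsProbabilityMeasure G] (hT : 0 < T) (hζ : 0 < ζ)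
    (hN₀ : 0 ≤ N₀) (hG : ∀ᵐ g ∂G, 0 < g) {U V : Measure Plane} [IsProbabilityMeasure U]
    [IsProbabilityMeasure V] (hU : ∀ r : ℝ, ∀ᵐ x ∂U, ‖x‖ ≠ r) (n m : ℕ) :
    (((Measure.pi fun _ : Fin (n + 1) => U).prod (Measure.pi fun _ : Fin m => V)).prod
      ((expMeasure ζ).prod ((Measure.pi fun _ : Fin (n + 1) => G).prod
        (Measure.pi fun _ : Fin m => G)))).real (coverageEvent T δ N₀ (n + 1) m) =
    (n + 1) * ∫ x, Real.exp (-(ζ * T * ‖x‖ ^ δ * N₀)) *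
      ((∫ y, fartherFactor T ζ δ G ‖x‖ ‖y‖ ∂U) ^ n *
        (∫ y, interfererFactor T ζ δ G ‖x‖ ‖y‖ ∂V) ^ m) ∂U := by
  have := isProbabilityMeasure_expMeasure hζ
  rw [measure_coverageEvent_eq_sum _ hU]
  simp_rw [measure_servingEvent hT hζ hN₀ hG hU]
  simp

/-! ### Summation over the Poisson numbers of base stations -/

theorem hasSum_poissonWeight_mul_pow (u q : ℝ) :
    HasSum (fun n => poissonWeight u n * q ^ n) (Real.exp (-(u * (1 - q)))) := by
  have h := (NormedSpace.expSeries_div_hasSum_exp (u * q)).mul_left (Real.exp (-u))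
  rw [← Real.exp_eq_exp_ℝ, ← Real.exp_add] at h
  have e : -u + u * q = -(u * (1 - q)) := by ring
  rw [e] at h
  refine h.congr_fun fun n => ?_
  rw [poissonWeight, mul_pow]
  ring

theorem hasSum_poissonWeight_mul_nat_mul_pow (u q : ℝ) :
    HasSum (fun n : ℕ => poissonWeight u n * (n * q ^ (n - 1)))
      (u * Real.exp (-(u * (1 - q)))) := by
  rw [← hasSum_nat_add_iff' 1]
  have h := (hasSum_poissonWeight_mul_pow u q).mul_left u
  simp only [Finset.range_one, Finset.sum_singleton, Nat.cast_zero, zero_mul, mul_zero, sub_zero]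
  refine h.congr_fun fun n => ?_
  rw [poissonWeight, poissonWeight, Nat.factorial_succ, Nat.add_sub_cancel]
  have h1 : ((n : ℝ) + 1) ≠ 0 := by positivity
  have h2 : (n.factorial : ℝ) ≠ 0 := by positivity
  push_cast
  field_simp
  ring

theorem abs_poissonWeight (u : ℝ) (n : ℕ) :
    |poissonWeight u n| = Real.exp (|u| - u) * poissonWeight |u| n := by
  rw [poissonWeight, poissonWeight, abs_div, abs_mul, abs_pow, Real.abs_exp, Nat.abs_cast,
    mul_div_assoc, mul_div_assoc, ← mul_assoc, ← Real.exp_add]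
  congr 2
  ring

theorem summable_abs_poissonWeight (u : ℝ) : Summable fun n => |poissonWeight u n| := by
  have h := ((hasSum_poissonWeight_mul_pow |u| 1).mul_left (Real.exp (|u| - u))).summable
  refine h.congr fun n => ?_
  rw [abs_poissonWeight, one_pow, mul_one]

theorem summable_abs_poissonWeight_mul_nat (u : ℝ) :
    Summable fun n : ℕ => |poissonWeight u n| * n := by
  have h := ((hasSum_poissonWeight_mul_nat_mul_pow |u| 1).mul_left (Real.exp (|u| - u))).summable
  refine h.congr fun n => ?_
  rw [abs_poissonWeight, one_pow, mul_one, mul_assoc]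

/-- Integrated form of the two Poisson series: the summation over the numbers of points may be
carried out under the integral over the position of the serving base station. -/
theorem tsum_poisson_integral {X : Type*} [MeasurableSpace X] (U : Measure X)
    [IsProbabilityMeasure U] {w q s : X → ℝ} (hw : Measurable w) (hq : Measurable q)
    (hs : Measurable s) (hw1 : ∀ x, |w x| ≤ 1) (hq1 : ∀ x, |q x| ≤ 1) (hs1 : ∀ x, |s x| ≤ 1)
    (u v : ℝ) :
    ∑' p : ℕ × ℕ, poissonWeight u p.1 * poissonWeight v p.2 *
        (p.1 * ∫ x, w x * (q x ^ (p.1 - 1) * s x ^ p.2) ∂U) =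
      ∫ x, w x * (u * Real.exp (-(u * (1 - q x))) * Real.exp (-(v * (1 - s x)))) ∂U := by
  set F : ℕ × ℕ → X → ℝ := fun p x => w x *
    ((poissonWeight u p.1 * (p.1 * q x ^ (p.1 - 1))) * (poissonWeight v p.2 * s x ^ p.2)) with hF
  have hFm : ∀ p, Measurable (F p) := fun p => by simp only [hF]; fun_prop
  have hFb : ∀ p x, ‖F p x‖ ≤ (|poissonWeight u p.1| * p.1) * |poissonWeight v p.2| := by
    intro p x
    rw [Real.norm_eq_abs, hF]
    simp only [abs_mul, abs_pow, Nat.abs_cast]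
    have h1 : |q x| ^ (p.1 - 1) ≤ 1 := pow_le_one₀ (abs_nonneg _) (hq1 x)
    have h2 : |s x| ^ p.2 ≤ 1 := pow_le_one₀ (abs_nonneg _) (hs1 x)
    calc |w x| * (|poissonWeight u p.1| * (p.1 * |q x| ^ (p.1 - 1)) *
          (|poissonWeight v p.2| * |s x| ^ p.2))
        ≤ 1 * (|poissonWeight u p.1| * (p.1 * 1) * (|poissonWeight v p.2| * 1)) := by
          gcongr
          exact hw1 x
      _ = _ := by ring
  have hFi : ∀ p, Integrable (F p) U := fun p =>
    (integrable_const _).mono' (hFm p).aestronglyMeasurable (ae_of_all _ (hFb p))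
  have hsumb : Summable fun p : ℕ × ℕ => (|poissonWeight u p.1| * p.1) * |poissonWeight v p.2| :=
    (summable_abs_poissonWeight_mul_nat u).mul_of_nonneg (summable_abs_poissonWeight v)
      (fun n => by positivity) (fun n => abs_nonneg _)
  have hsum : Summable fun p => ∫ x, ‖F p x‖ ∂U := by
    refine Summable.of_nonneg_of_le (fun p => integral_nonneg fun x => norm_nonneg _)
      (fun p => ?_) hsumb
    have := integral_mono (hFi p).norm (integrable_const _) (hFb p)
    simpa using this
  have h := (hasSum_integral_of_summable_integral_norm hFi hsum).tsum_eq
  have e1 : ∀ p, ∫ x, F p x ∂U = poissonWeight u p.1 * poissonWeight v p.2 *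
        (p.1 * ∫ x, w x * (q x ^ (p.1 - 1) * s x ^ p.2) ∂U) := by
    intro p
    rw [← mul_assoc, ← integral_const_mul]
    congr with x
    simp only [hF]
    ring
  simp_rw [e1] at h
  rw [h]
  congr with x
  have h1 := hasSum_poissonWeight_mul_nat_mul_pow u (q x)
  have h2 := hasSum_poissonWeight_mul_pow v (s x)
  have h3 : Summable fun p : ℕ × ℕ => (poissonWeight u p.1 * (p.1 * q x ^ (p.1 - 1))) *
      (poissonWeight v p.2 * s x ^ p.2) := by
    refine hsumb.of_norm_bounded fun p => ?_
    rw [Real.norm_eq_abs]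
    simp only [abs_mul, abs_pow, Nat.abs_cast]
    have h1 : |q x| ^ (p.1 - 1) ≤ 1 := pow_le_one₀ (abs_nonneg _) (hq1 x)
    have h2 : |s x| ^ p.2 ≤ 1 := pow_le_one₀ (abs_nonneg _) (hs1 x)
    calc |poissonWeight u p.1| * (p.1 * |q x| ^ (p.1 - 1)) * (|poissonWeight v p.2| * |s x| ^ p.2)
        ≤ |poissonWeight u p.1| * (p.1 * 1) * (|poissonWeight v p.2| * 1) := by gcongr
      _ = _ := by ring
  exact ((h1.mul h2 h3).mul_left (w x)).tsum_eq

/-! ### The coverage probability given the densities -/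

theorem volume_innerDisc_ne {R : ℝ} (hR : 0 < R) :
    volume (innerDisc R) ≠ 0 ∧ volume (innerDisc R) ≠ ⊤ :=
  ⟨(Metric.measure_ball_pos volume _ hR).ne', measure_ball_lt_top.ne⟩

theorem measurableSet_outerAnnulus (R a : ℝ) : MeasurableSet (outerAnnulus R a) :=
  measurableSet_ball.diff measurableSet_ball

theorem volume_outerAnnulus_ne {R a : ℝ} (hR : 0 < R) (ha : 1 < a) :
    volume (outerAnnulus R a) ≠ 0 ∧ volume (outerAnnulus R a) ≠ ⊤ := by
  refine ⟨?_, ((measure_mono sdiff_subset).trans_lt measure_ball_lt_top).ne⟩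
  rw [outerAnnulus, measure_sdiff (Metric.ball_subset_ball (by nlinarith))
    measurableSet_ball.nullMeasurableSet measure_ball_lt_top.ne,
    EuclideanSpace.volume_ball_fin_two, EuclideanSpace.volume_ball_fin_two]
  refine (tsub_pos_of_lt ?_).ne'
  have h1 : R < a * R := by nlinarith
  rw [← ENNReal.ofReal_pow hR.le, ← ENNReal.ofReal_pow (hR.le.trans h1.le),
    ← ENNReal.ofReal_mul (by positivity), ← ENNReal.ofReal_mul (by positivity),
    ENNReal.ofReal_lt_ofReal_iff (by have := Real.pi_pos; positivity)]
  exact mul_lt_mul_of_pos_right (pow_lt_pow_left₀ h1 hR.le two_ne_zero) Real.pi_pos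

theorem integral_cond {X : Type*} [MeasurableSpace X] (μ : Measure X) (s : Set X) (f : X → ℝ) :
    ∫ x, f x ∂(cond μ s) = (μ.real s)⁻¹ * ∫ x in s, f x ∂μ := by
  rw [ProbabilityTheory.cond, integral_smul_measure, ENNReal.toReal_inv, measureReal_def,
    smul_eq_mul]

theorem ae_norm_ne (r : ℝ) : ∀ᵐ x : Plane, ‖x‖ ≠ r := by
  have h := Measure.addHaar_sphere (volume : Measure Plane) 0 r
  rw [ae_iff]
  convert h using 2
  ext x
  simp

/-- Integral in polar coordinates over the plane, for radial functions. -/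
theorem integral_plane_norm (f : ℝ → ℝ) :
    ∫ x : Plane, f ‖x‖ = ∫ r in Ioi (0 : ℝ), 2 * Real.pi * r * f r := by
  have h := integral_fun_norm_addHaar (volume : Measure Plane) f
  have hv : (volume : Measure Plane).real (Metric.ball 0 1) = Real.pi := by
    rw [measureReal_def, EuclideanSpace.volume_ball_fin_two]
    simp [Real.pi_pos.le]
  rw [hv, finrank_euclideanSpace_fin] at h
  rw [h, ← Nat.cast_smul_eq_nsmul ℝ, ← integral_smul, ← integral_smul]
  congr with r
  rw [smul_eq_mul, smul_eq_mul, smul_eq_mul]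
  norm_num
  ring

theorem setIntegral_innerDisc (R : ℝ) (f : ℝ → ℝ) :
    ∫ x in innerDisc R, f ‖x‖ = ∫ r in Ioo 0 R, 2 * Real.pi * r * f r := by
  have h := integral_plane_norm ((Iio R).indicator f)
  have e1 : (fun x : Plane => (Iio R).indicator f ‖x‖)
      = (innerDisc R).indicator fun x => f ‖x‖ := by
    ext x
    simp only [indicator, innerDisc, mem_Iio, Metric.mem_ball, dist_zero_right]
  have e2 : (fun r => 2 * Real.pi * r * (Iio R).indicator f r)
      = (Iio R).indicator fun r => 2 * Real.pi * r * f r :=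
    funext fun r => (indicator_mul_right (Iio R) (fun r => 2 * Real.pi * r) f (i := r)).symm
  have hm : MeasurableSet (innerDisc R) := measurableSet_ball
  rwa [e1, e2, integral_indicator hm, setIntegral_indicator measurableSet_Iio,
    Ioi_inter_Iio] at h

/-- The exponent contributed, per unit of density, by the inner circle, if the serving base station
is at distance `r`: nearer base stations are excluded, and farther ones interfere. -/
noncomputable def innerExponent (T ζ δ : ℝ) (G : Measure ℝ) (R r : ℝ) : ℝ :=
  ∫ y in innerDisc R, (1 - fartherFactor T ζ δ G r ‖y‖)

/-- The exponent contributed, per unit of density, by the interferers of the outer circle, if the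
serving base station is at distance `r`. -/
noncomputable def outerExponent (T ζ δ : ℝ) (G : Measure ℝ) (R a r : ℝ) : ℝ :=
  ∫ y in outerAnnulus R a, (1 - interfererFactor T ζ δ G r ‖y‖)

theorem measurable_interfererFactor_norm [IsProbabilityMeasure G] (r : ℝ) :
    Measurable fun y : Plane => interfererFactor T ζ δ G r ‖y‖ :=
  measurable_interfererFactor.comp (by fun_prop : Measurable fun y : Plane => (r, ‖y‖))

theorem measurable_fartherFactor_norm [IsProbabilityMeasure G] (r : ℝ) :
    Measurable fun y : Plane => fartherFactor T ζ δ G r ‖y‖ :=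
  measurable_fartherFactor.comp (by fun_prop : Measurable fun y : Plane => (r, ‖y‖))

theorem integrableOn_fartherFactor [IsProbabilityMeasure G] (hT : 0 < T) (hζ : 0 < ζ)
    (hG : ∀ᵐ g ∂G, 0 < g) {r : ℝ} (hr : 0 ≤ r) {s : Set Plane} (hs : volume s ≠ ⊤) :
    IntegrableOn (fun y : Plane => fartherFactor T ζ δ G r ‖y‖) s := by
  refine Integrable.mono' (integrableOn_const hs (C := (1 : ℝ)))
    (measurable_fartherFactor_norm r).aestronglyMeasurable (ae_of_all _ fun y => ?_)
  rw [Real.norm_of_nonneg (fartherFactor_nonneg _ _)]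
  exact fartherFactor_le_one hT hζ hG hr (norm_nonneg _)

theorem integrableOn_interfererFactor [IsProbabilityMeasure G] (hT : 0 < T) (hζ : 0 < ζ)
    (hG : ∀ᵐ g ∂G, 0 < g) {r : ℝ} (hr : 0 ≤ r) {s : Set Plane} (hs : volume s ≠ ⊤) :
    IntegrableOn (fun y : Plane => interfererFactor T ζ δ G r ‖y‖) s := by
  refine Integrable.mono' (integrableOn_const hs (C := (1 : ℝ)))
    (measurable_interfererFactor_norm r).aestronglyMeasurable (ae_of_all _ fun y => ?_)
  rw [Real.norm_of_nonneg (interfererFactor_nonneg _ _)]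
  exact interfererFactor_le_one hT hζ hG hr (norm_nonneg _)

/-- The conditional coverage probability, as an integral over the distance `r` of the serving base
station. It holds for negative densities as well, since the Poisson series converge there. -/
theorem coverageGivenDensity_eq [IsProbabilityMeasure G] (hT : 0 < T) (hζ : 0 < ζ)
    (hN₀ : 0 ≤ N₀) (hG : ∀ᵐ g ∂G, 0 < g) {R a : ℝ} (hR : 0 < R) (ha : 1 < a) (l lS : ℝ) :
    coverageGivenDensity T ζ δ N₀ G R a l lS =
      ∫ r in Ioo 0 R, 2 * Real.pi * r * (Real.exp (-(ζ * T * r ^ δ * N₀)) *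
        (l * Real.exp (-(l * innerExponent T ζ δ G R r)) *
          Real.exp (-(lS * outerExponent T ζ δ G R a r)))) := by
  obtain ⟨hD0, hDt⟩ := volume_innerDisc_ne hR
  obtain ⟨hS0, hSt⟩ := volume_outerAnnulus_ne hR ha
  set U : Measure Plane := cond volume (innerDisc R) with hUdef
  set V : Measure Plane := cond volume (outerAnnulus R a) with hVdef
  have hUp : IsProbabilityMeasure U := cond_isProbabilityMeasure_of_finite hD0 hDt
  have hVp : IsProbabilityMeasure V := cond_isProbabilityMeasure_of_finite hS0 hSt
  have hU : ∀ r : ℝ, ∀ᵐ x ∂U, ‖x‖ ≠ r := fun r =>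
    (cond_absolutelyContinuous).ae_le (ae_norm_ne r)
  set D := volume.real (innerDisc R) with hD
  set S := volume.real (outerAnnulus R a) with hS
  have hDpos : D ≠ 0 := (ENNReal.toReal_ne_zero).2 ⟨hD0, hDt⟩
  have hSpos : S ≠ 0 := (ENNReal.toReal_ne_zero).2 ⟨hS0, hSt⟩
  set w : ℝ → ℝ := fun r => Real.exp (-(ζ * T * r ^ δ * N₀)) with hw
  set q : Plane → ℝ := fun x => ∫ y, fartherFactor T ζ δ G ‖x‖ ‖y‖ ∂U with hq
  set s : Plane → ℝ := fun x => ∫ y, interfererFactor T ζ δ G ‖x‖ ‖y‖ ∂V with hs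
  have hterm : ∀ p : ℕ × ℕ, (configLaw ζ G R a p.1 p.2).real (coverageEvent T δ N₀ p.1 p.2)
      = p.1 * ∫ x, w ‖x‖ * (q x ^ (p.1 - 1) * s x ^ p.2) ∂U := by
    rintro ⟨n, m⟩
    rcases n with _ | n
    · have : coverageEvent T δ N₀ 0 m = ∅ := by
        ext v
        simp only [mem_empty_iff_false, iff_false]
        rintro ⟨i, -⟩
        exact i.elim0
      dsimp only
      rw [this]
      simp
    · have := measure_coverageEvent_succ (δ := δ) hT hζ hN₀ hG (V := V) hU n m
      dsimp only
      rw [configLaw, this]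
      push_cast
      rfl
  have hqm : Measurable q := by
    have : StronglyMeasurable fun p : Plane × Plane => fartherFactor T ζ δ G ‖p.1‖ ‖p.2‖ :=
      (measurable_fartherFactor.comp
        (by fun_prop : Measurable fun p : Plane × Plane => (‖p.1‖, ‖p.2‖))).stronglyMeasurable
    exact this.integral_prod_right.measurable
  have hsm : Measurable s := by
    have : StronglyMeasurable fun p : Plane × Plane => interfererFactor T ζ δ G ‖p.1‖ ‖p.2‖ :=
      (measurable_interfererFactor.comp
        (by fun_prop : Measurable fun p : Plane × Plane => (‖p.1‖, ‖p.2‖))).stronglyMeasurable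
    exact this.integral_prod_right.measurable
  have hq1 : ∀ x, |q x| ≤ 1 := by
    intro x
    have h := norm_integral_le_of_norm_le_const (μ := U) (C := 1)
      (f := fun y : Plane => fartherFactor T ζ δ G ‖x‖ ‖y‖) (ae_of_all _ fun y => by
        rw [Real.norm_of_nonneg (fartherFactor_nonneg _ _)]
        exact fartherFactor_le_one hT hζ hG (norm_nonneg _) (norm_nonneg _))
    simpa using h
  have hs1 : ∀ x, |s x| ≤ 1 := by
    intro x
    have h := norm_integral_le_of_norm_le_const (μ := V) (C := 1)
      (f := fun y : Plane => interfererFactor T ζ δ G ‖x‖ ‖y‖) (ae_of_all _ fun y => by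
        rw [Real.norm_of_nonneg (interfererFactor_nonneg _ _)]
        exact interfererFactor_le_one hT hζ hG (norm_nonneg _) (norm_nonneg _))
    simpa using h
  have hw1 : ∀ x : Plane, |w ‖x‖| ≤ 1 := by
    intro x
    rw [hw, Real.abs_exp]
    refine Real.exp_le_one_iff.2 (neg_nonpos.2 ?_)
    positivity
  have hsum := tsum_poisson_integral U (w := fun x => w ‖x‖) (by fun_prop) hqm hsm hw1 hq1 hs1
    (l * D) (lS * S)
  rw [coverageGivenDensity]
  simp_rw [hterm]
  rw [hsum, integral_cond, ← setIntegral_innerDisc R (fun r => w r *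
        (l * Real.exp (-(l * innerExponent T ζ δ G R r)) *
          Real.exp (-(lS * outerExponent T ζ δ G R a r)))), ← integral_const_mul]
  congr with x
  have h1 : D * (1 - q x) = innerExponent T ζ δ G R ‖x‖ := by
    rw [innerExponent, integral_sub (integrableOn_const hDt (C := (1 : ℝ))).integrable
      (integrableOn_fartherFactor hT hζ hG (norm_nonneg _) hDt), setIntegral_const, hq]
    simp only [hUdef]
    rw [integral_cond, mul_sub, mul_one, mul_inv_cancel_left₀ hDpos, smul_eq_mul, mul_one]
  have h2 : S * (1 - s x) = outerExponent T ζ δ G R a ‖x‖ := by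
    rw [outerExponent, integral_sub (integrableOn_const hSt (C := (1 : ℝ))).integrable
      (integrableOn_interfererFactor hT hζ hG (norm_nonneg _) hSt), setIntegral_const, hs]
    simp only [hVdef]
    rw [integral_cond, mul_sub, mul_one, mul_inv_cancel_left₀ hSpos, smul_eq_mul, mul_one]
  rw [← h1, ← h2, ← hD]
  simp only [hw, ← mul_assoc]
  field_simp

/-! ### The incomplete Gamma function -/

theorem integrableOn_incGamma (d : ℝ) {x : ℝ} (hx : 0 < x) :
    IntegrableOn (fun t => t ^ (d - 1) * Real.exp (-t)) (Ioi x) := by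
  -- the tail decays like `exp (-t / 2)`, for any exponent `d`
  have h1 : (fun t : ℝ => t ^ (d - 1) * Real.exp (-t)) =O[atTop] fun t => Real.exp (-(1 / 2) * t) := by
    have h := (isLittleO_rpow_exp_pos_mul_atTop (d - 1) (by norm_num : (0 : ℝ) < 1 / 2)).isBigO
    refine (h.mul (Asymptotics.isBigO_refl (fun t : ℝ => Real.exp (-t)) atTop)).congr_right ?_
    intro t
    rw [← Real.exp_add]
    congr 1; ring
  refine integrable_of_isBigO_exp_neg (by norm_num) ?_ h1
  intro t ht
  have : t ≠ 0 := (hx.trans_le ht).ne'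
  exact ((Real.continuousAt_rpow_const t (d - 1) (Or.inl this)).mul
    (by fun_prop)).continuousWithinAt

theorem hasDerivAt_incGamma (d : ℝ) {x : ℝ} (hx : 0 < x) :
    HasDerivAt (incGamma d) (-(x ^ (d - 1) * Real.exp (-x))) x := by
  have hx2 : 0 < x / 2 := by linarith
  set f : ℝ → ℝ := fun t => t ^ (d - 1) * Real.exp (-t) with hf
  have hc : ∀ t, 0 < t → ContinuousAt f t := fun t ht =>
    (Real.continuousAt_rpow_const t (d - 1) (Or.inl ht.ne')).mul (by fun_prop)
  have h1 : HasDerivAt (fun u => ∫ t in (x / 2)..u, f t) (f x) x := by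
    refine intervalIntegral.integral_hasDerivAt_right ?_ ?_ (hc x hx)
    · refine ContinuousOn.intervalIntegrable fun t ht => (hc t ?_).continuousWithinAt
      rw [uIcc_of_le (by linarith)] at ht
      exact hx2.trans_le ht.1
    · exact Measurable.stronglyMeasurable (by fun_prop) |>.stronglyMeasurableAtFilter
  have h2 := h1.const_sub (incGamma d (x / 2))
  refine h2.congr_of_eventuallyEq ?_
  filter_upwards [lt_mem_nhds (by linarith : x / 2 < x)] with u hu
  have := intervalIntegral.integral_Ioi_sub_Ioi (integrableOn_incGamma d hx2) hu.le
  rw [← this]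
  simp [incGamma]

/-- The recursion of the incomplete Gamma function, by partial integration. -/
theorem incGamma_add_one (d : ℝ) {x : ℝ} (hx : 0 < x) :
    incGamma (d + 1) x = d * incGamma d x + x ^ d * Real.exp (-x) := by
  have hderiv : ∀ t ∈ Ici x, HasDerivAt (fun t : ℝ => t ^ d * Real.exp (-t))
      (d * (t ^ (d - 1) * Real.exp (-t)) - t ^ (d + 1 - 1) * Real.exp (-t)) t := by
    intro t ht
    have ht0 : t ≠ 0 := (hx.trans_le ht).ne'
    have h := (Real.hasDerivAt_rpow_const (p := d) (Or.inl ht0)).mul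
      ((hasDerivAt_neg t).exp)
    refine h.congr_deriv ?_
    rw [add_sub_cancel_right]
    ring
  have hlim : Tendsto (fun t : ℝ => t ^ d * Real.exp (-t)) atTop (𝓝 0) := by
    have := tendsto_rpow_mul_exp_neg_mul_atTop_nhds_zero d 1 one_pos
    simpa using this
  have hi := (integrableOn_incGamma d hx).const_mul d
  have h := integral_Ioi_of_hasDerivAt_of_tendsto' hderiv
    (hi.sub (integrableOn_incGamma (d + 1) hx)) hlim
  rw [integral_sub hi (integrableOn_incGamma (d + 1) hx), integral_const_mul] at h
  rw [incGamma, incGamma]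
  linarith

theorem tendsto_incGamma_zero {s : ℝ} (hs : 0 < s) :
    Tendsto (incGamma s) (𝓝[>] 0) (𝓝 (Real.Gamma s)) := by
  have hint := Real.GammaIntegral_convergent hs
  rw [Real.Gamma_eq_integral hs]
  have h := hint.continuousWithinAt_Ici_primitive_Ioi.tendsto.mono_left
    (nhdsWithin_mono 0 Ioi_subset_Ici_self)
  refine h.congr fun x => ?_
  rw [incGamma]
  simp_rw [mul_comm]

/-! ### The interference exponent on the whole plane -/

/-- The function under the expectation over the fading gain in `interferenceTerm`, at `r = 1`,
in terms of `s = ζ T g`. -/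
noncomputable def interferenceKernel (δ s : ℝ) : ℝ :=
  2 / δ * s ^ (2 / δ) * (incGamma (-2 / δ) s - Real.Gamma (-2 / δ))

theorem Gamma_neg_two_div {δ : ℝ} (hδ : 2 < δ) :
    Real.Gamma (-2 / δ + 1) = -2 / δ * Real.Gamma (-2 / δ) :=
  Real.Gamma_add_one (div_ne_zero (by norm_num) (by linarith))

theorem neg_two_div_add_one_pos {δ : ℝ} (hδ : 2 < δ) : 0 < -2 / δ + 1 := by
  rw [neg_div, neg_add_eq_sub, sub_pos, div_lt_one (by linarith)]
  exact hδ

theorem interferenceKernel_le {δ s : ℝ} (hδ : 2 < δ) (hs : 0 < s) :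
    interferenceKernel δ s ≤ 1 + Real.Gamma (-2 / δ + 1) * s ^ (2 / δ) := by
  have hd := neg_two_div_add_one_pos hδ
  have h1 := incGamma_add_one (-2 / δ) hs
  have h2 := Gamma_neg_two_div hδ
  have h3 : s ^ (2 / δ) * s ^ (-2 / δ) = 1 := by
    rw [← Real.rpow_add hs]; ring_nf; exact Real.rpow_zero _
  have h4 : 0 ≤ incGamma (-2 / δ + 1) s := by
    refine setIntegral_nonneg measurableSet_Ioi fun t ht => ?_
    have : (0 : ℝ) ≤ t := (hs.trans ht).le
    positivity
  have h5 : Real.exp (-s) ≤ 1 := Real.exp_le_one_iff.2 (by linarith)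
  have h6 : 0 ≤ s ^ (2 / δ) := by positivity
  have : interferenceKernel δ s = s ^ (2 / δ) * Real.Gamma (-2 / δ + 1)
      - s ^ (2 / δ) * incGamma (-2 / δ + 1) s + (s ^ (2 / δ) * s ^ (-2 / δ)) * Real.exp (-s) := by
    rw [interferenceKernel, h1, h2]; ring
  rw [this, h3]
  have := mul_nonneg h6 h4
  linarith

/-- The one-dimensional integral behind the closed form: for `0 < s`, an antiderivative of
`2 u (1 - exp (-s u^(-δ)))` is `u² - (2/δ) s^(2/δ) Γ(-2/δ, s u^(-δ))`. -/
theorem integral_Ioi_interference {δ s r : ℝ} (hδ : 2 < δ) (hs : 0 < s) (hr : 0 < r) :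
    IntegrableOn (fun u => 2 * u * (1 - Real.exp (-(s * u ^ (-δ))))) (Ioi r) ∧
    ∫ u in Ioi r, 2 * u * (1 - Real.exp (-(s * u ^ (-δ)))) =
      s ^ (2 / δ) * Real.Gamma (-2 / δ + 1) -
        (r ^ 2 - 2 / δ * s ^ (2 / δ) * incGamma (-2 / δ) (s * r ^ (-δ))) := by
  have hδ0 : 0 < δ := by linarith
  set K : ℝ → ℝ := fun u => u ^ 2 - 2 / δ * s ^ (2 / δ) * incGamma (-2 / δ) (s * u ^ (-δ)) with hK
  have hpow : ∀ u, 0 < u → s ^ (2 / δ) * (s * u ^ (-δ)) ^ (-2 / δ) = u ^ 2 := by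
    intro u hu
    rw [Real.mul_rpow hs.le (by positivity), ← mul_assoc, ← Real.rpow_add hs,
      ← Real.rpow_mul hu.le]
    have e1 : 2 / δ + -2 / δ = 0 := by ring
    have e2 : -δ * (-2 / δ) = (2 : ℕ) := by push_cast; field_simp
    rw [e1, e2, Real.rpow_zero, one_mul, Real.rpow_natCast]
  have hderiv : ∀ u ∈ Ici r, HasDerivAt K (2 * u * (1 - Real.exp (-(s * u ^ (-δ))))) u := by
    intro u hu
    have hu0 : 0 < u := hr.trans_le hu
    have ht : 0 < s * u ^ (-δ) := by positivity
    have h1 : HasDerivAt (fun u : ℝ => s * u ^ (-δ)) (s * (-δ * u ^ (-δ - 1))) u :=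
      (Real.hasDerivAt_rpow_const (Or.inl hu0.ne')).const_mul s
    have h2 := ((hasDerivAt_incGamma (-2 / δ) ht).comp u h1).const_mul (2 / δ * s ^ (2 / δ))
    have h3 := (hasDerivAt_pow 2 u).sub h2
    refine h3.congr_deriv ?_
    have e1 : (s * u ^ (-δ)) ^ (-2 / δ - 1) * (s * u ^ (-δ)) = (s * u ^ (-δ)) ^ (-2 / δ) := by
      rw [Real.rpow_sub_one ht.ne', div_mul_cancel₀ _ ht.ne']
    have e2 : u ^ (-δ - 1) * u = u ^ (-δ) := by
      rw [Real.rpow_sub_one hu0.ne', div_mul_cancel₀ _ hu0.ne']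
    have e3 := hpow u hu0
    have key : 2 / δ * s ^ (2 / δ) * (-((s * u ^ (-δ)) ^ (-2 / δ - 1) * Real.exp (-(s * u ^ (-δ)))) *
        (s * (-δ * u ^ (-δ - 1)))) = 2 * u * Real.exp (-(s * u ^ (-δ))) := by
      have : u * (2 / δ * s ^ (2 / δ) * (-((s * u ^ (-δ)) ^ (-2 / δ - 1) * Real.exp (-(s * u ^ (-δ)))) *
        (s * (-δ * u ^ (-δ - 1))))) = u * (2 * u * Real.exp (-(s * u ^ (-δ)))) := by
        calc _ = 2 * (δ / δ) * (s ^ (2 / δ) * ((s * u ^ (-δ)) ^ (-2 / δ - 1) *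
              (s * (u ^ (-δ - 1) * u)))) * Real.exp (-(s * u ^ (-δ))) := by ring
          _ = _ := by rw [e2, e1, e3, div_self hδ0.ne']; ring
      exact mul_left_cancel₀ hu0.ne' this
    rw [key]
    push_cast
    ring
  have ht0 : Tendsto (fun u : ℝ => s * u ^ (-δ)) atTop (𝓝[>] 0) := by
    refine tendsto_nhdsWithin_iff.2 ⟨?_, ?_⟩
    · simpa using (tendsto_rpow_neg_atTop hδ0).const_mul s
    · filter_upwards [eventually_gt_atTop 0] with u hu
      exact mul_pos hs (by positivity)
  have hd := neg_two_div_add_one_pos hδ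
  -- with `t = s u^(-δ)`, the antiderivative is `s^(2/δ) (Γ(1 - 2/δ, t) + t^(-2/δ) (1 - e^(-t)))`
  have hlim : Tendsto K atTop (𝓝 (s ^ (2 / δ) * Real.Gamma (-2 / δ + 1))) := by
    have h1 : Tendsto (fun t : ℝ => t ^ (-2 / δ) * (1 - Real.exp (-t))) (𝓝[>] 0) (𝓝 0) := by
      have h2 : Tendsto (fun t : ℝ => t ^ (-2 / δ + 1)) (𝓝[>] 0) (𝓝 0) := by
        have := (Real.continuousAt_rpow_const 0 (-2 / δ + 1) (Or.inr hd.le)).tendsto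
        rw [Real.zero_rpow hd.ne'] at this
        exact this.mono_left nhdsWithin_le_nhds
      refine squeeze_zero' ?_ ?_ h2
      · filter_upwards [self_mem_nhdsWithin] with t ht
        have ht' : (0 : ℝ) < t := ht
        have : Real.exp (-t) ≤ 1 := Real.exp_le_one_iff.2 (by linarith)
        exact mul_nonneg (by positivity) (by linarith)
      · filter_upwards [self_mem_nhdsWithin] with t ht
        have ht' : (0 : ℝ) < t := ht
        rw [Real.rpow_add_one ht'.ne']
        refine mul_le_mul_of_nonneg_left ?_ (by positivity)
        have := Real.add_one_le_exp (-t)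
        linarith
    have h3 := (((tendsto_incGamma_zero hd).add h1).const_mul (s ^ (2 / δ))).comp ht0
    rw [add_zero] at h3
    refine h3.congr' ?_
    filter_upwards [eventually_gt_atTop 0] with u hu
    have ht : 0 < s * u ^ (-δ) := by positivity
    have h4 := incGamma_add_one (-2 / δ) ht
    have h5 := hpow u hu
    simp only [Function.comp_apply, hK]
    rw [h4, ← h5]
    ring
  have hnonneg : ∀ u ∈ Ioi r, 0 ≤ 2 * u * (1 - Real.exp (-(s * u ^ (-δ)))) := by
    intro u hu
    have hu0 : (0 : ℝ) < u := hr.trans hu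
    have : Real.exp (-(s * u ^ (-δ))) ≤ 1 :=
      Real.exp_le_one_iff.2 (neg_nonpos.2 (by positivity))
    exact mul_nonneg (by positivity) (by linarith)
  exact ⟨integrableOn_Ioi_deriv_of_nonneg' hderiv hnonneg hlim,
    integral_Ioi_of_hasDerivAt_of_nonneg' hderiv hnonneg hlim⟩

/-- The integral over the plane of the exclusion and interference term, for one value of the fading
gain. -/
theorem integral_plane_interference {s r : ℝ} (hδ : 2 < δ) (hs : 0 < s) (hr : 0 < r) :
    Integrable (fun y : Plane =>
      1 - if r < ‖y‖ then Real.exp (-(s * r ^ δ * ‖y‖ ^ (-δ))) else 0) ∧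
    ∫ y : Plane, (1 - if r < ‖y‖ then Real.exp (-(s * r ^ δ * ‖y‖ ^ (-δ))) else 0) =
      Real.pi * r ^ 2 * interferenceKernel δ s := by
  have hδ0 : 0 < δ := by linarith
  set f : ℝ → ℝ := fun ρ => 1 - if r < ρ then Real.exp (-(s * r ^ δ * ρ ^ (-δ))) else 0 with hf
  obtain ⟨hi, hv⟩ := integral_Ioi_interference hδ (by positivity : 0 < s * r ^ δ) hr
  have hin : ∀ ρ ∈ Ioc 0 r, 2 * ρ * f ρ = 2 * ρ := by
    intro ρ hρ
    simp [hf, not_lt.2 hρ.2]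
  have hout : ∀ ρ ∈ Ioi r, 2 * ρ * f ρ = 2 * ρ * (1 - Real.exp (-(s * r ^ δ * ρ ^ (-δ)))) := by
    intro ρ hρ
    simp only [hf, if_pos (show r < ρ from hρ)]
  have hi1 : IntegrableOn (fun ρ => 2 * ρ * f ρ) (Ioc 0 r) := by
    refine IntegrableOn.congr_fun (f := fun ρ => 2 * ρ) ?_ (fun ρ hρ => (hin ρ hρ).symm)
      measurableSet_Ioc
    exact (Continuous.integrableOn_Icc (by fun_prop)).mono_set Ioc_subset_Icc_self
  have hi2 : IntegrableOn (fun ρ => 2 * ρ * f ρ) (Ioi r) :=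
    hi.congr_fun (fun ρ hρ => (hout ρ hρ).symm) measurableSet_Ioi
  have hi3 : IntegrableOn (fun ρ => 2 * ρ * f ρ) (Ioi 0) := by
    rw [← Ioc_union_Ioi_eq_Ioi hr.le]
    exact hi1.union hi2
  constructor
  · have := (integrable_fun_norm_addHaar (volume : Measure Plane) (f := f)).2
    refine this ?_
    rw [finrank_euclideanSpace_fin]
    refine (hi3.div_const 2).congr (ae_of_all _ fun ρ => ?_)
    simp only [smul_eq_mul]
    norm_num
    ring
  · rw [integral_plane_norm f]
    have e : ∀ ρ, 2 * Real.pi * ρ * f ρ = Real.pi * (2 * ρ * f ρ) := fun ρ => by ring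
    simp_rw [e]
    rw [integral_const_mul, ← Ioc_union_Ioi_eq_Ioi hr.le,
      setIntegral_union (Ioc_disjoint_Ioi le_rfl) measurableSet_Ioi hi1 hi2,
      setIntegral_congr_fun measurableSet_Ioc hin, setIntegral_congr_fun measurableSet_Ioi hout, hv,
      ← intervalIntegral.integral_of_le hr.le, intervalIntegral.integral_const_mul, integral_id,
      Gamma_neg_two_div hδ, interferenceKernel]
    have e1 : s * r ^ δ * r ^ (-δ) = s := by
      rw [mul_assoc, ← Real.rpow_add hr, add_neg_cancel, Real.rpow_zero, mul_one]
    have e2 : (s * r ^ δ) ^ (2 / δ) = s ^ (2 / δ) * r ^ 2 := by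
      rw [Real.mul_rpow hs.le (by positivity), ← Real.rpow_mul hr.le,
        mul_div_cancel₀ _ hδ0.ne', Real.rpow_two]
    rw [e1, e2]
    ring

theorem interferenceTerm_eq (r : ℝ) :
    interferenceTerm T ζ δ G r = r ^ 2 * ∫ g, interferenceKernel δ (ζ * T * g) ∂G := by
  rw [interferenceTerm, ← integral_const_mul]
  congr with g
  rw [interferenceKernel]
  ring

theorem interferenceTerm_eq_sq_mul (r : ℝ) :
    interferenceTerm T ζ δ G r = r ^ 2 * interferenceTerm T ζ δ G 1 := by
  rw [interferenceTerm_eq, interferenceTerm_eq 1]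
  ring

theorem interferenceKernel_nonneg {s : ℝ} (hδ : 2 < δ) (hs : 0 < s) :
    0 ≤ interferenceKernel δ s := by
  have h := (integral_plane_interference hδ hs one_pos).2
  have h0 : 0 ≤ ∫ y : Plane, (1 - if 1 < ‖y‖ then Real.exp (-(s * 1 ^ δ * ‖y‖ ^ (-δ))) else 0) := by
    refine integral_nonneg fun y => ?_
    dsimp only
    split_ifs
    · rw [Pi.zero_apply, sub_nonneg]
      exact Real.exp_le_one_iff.2 (neg_nonpos.2 (by positivity))
    · simp
  rw [h] at h0
  have := Real.pi_pos
  exact nonneg_of_mul_nonneg_right h0 (by positivity)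

/-- The exclusion and interference exponent over the whole plane is `π` times `interferenceTerm`:
Fubini, with integrability supplied by the moment of order `2 / δ` of the fading gain. -/
theorem integral_one_sub_fartherFactor [IsProbabilityMeasure G] (hT : 0 < T) (hζ : 0 < ζ)
    (hδ : 2 < δ) (hG : ∀ᵐ g ∂G, 0 < g) (hGint : Integrable (fun g => g ^ (2 / δ)) G)
    {r : ℝ} (hr : 0 < r) :
    Integrable (fun y : Plane => 1 - fartherFactor T ζ δ G r ‖y‖) ∧
    ∫ y : Plane, (1 - fartherFactor T ζ δ G r ‖y‖) = Real.pi * interferenceTerm T ζ δ G r := by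
  set k : ℝ → Plane → ℝ := fun g y =>
    1 - if r < ‖y‖ then Real.exp (-(ζ * T * r ^ δ * (g * ‖y‖ ^ (-δ)))) else 0 with hk
  have hkm : Measurable (Function.uncurry k) := by
    refine measurable_const.sub (Measurable.ite (measurableSet_lt measurable_const
      (by fun_prop)) (by fun_prop) measurable_const)
  have hkeq : ∀ g, k g = fun y : Plane =>
      1 - if r < ‖y‖ then Real.exp (-((ζ * T * g) * r ^ δ * ‖y‖ ^ (-δ))) else 0 := by
    intro g
    funext y
    simp only [hk]
    congr 4
    ring
  have hk0 : ∀ g, 0 < g → ∀ y, 0 ≤ k g y := by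
    intro g hg y
    simp only [hk]
    split_ifs
    · rw [sub_nonneg]
      exact Real.exp_le_one_iff.2 (neg_nonpos.2 (by positivity))
    · simp
  have hpl : ∀ g, 0 < g → Integrable (k g) ∧
      ∫ y, k g y = Real.pi * r ^ 2 * interferenceKernel δ (ζ * T * g) := by
    intro g hg
    rw [hkeq g]
    exact integral_plane_interference hδ (by positivity) hr
  have hint : Integrable (Function.uncurry k) (G.prod (volume : Measure Plane)) := by
    rw [integrable_prod_iff hkm.aestronglyMeasurable]
    refine ⟨hG.mono fun g hg => (hpl g hg).1, ?_⟩
    refine Integrable.mono' (g := fun g => Real.pi * r ^ 2 *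
      (1 + Real.Gamma (-2 / δ + 1) * ((ζ * T) ^ (2 / δ) * g ^ (2 / δ)))) ?_ ?_ ?_
    · exact ((integrable_const (1 : ℝ)).add ((hGint.const_mul _).const_mul _)).const_mul _
    · exact (hkm.norm.stronglyMeasurable.integral_prod_right (ν := volume)).aestronglyMeasurable
    · filter_upwards [hG] with g hg
      have e : ∫ y, ‖Function.uncurry k (g, y)‖ = ∫ y, k g y :=
        integral_congr_ae (ae_of_all _ fun y => Real.norm_of_nonneg (hk0 g hg y))
      rw [e, (hpl g hg).2, Real.norm_of_nonneg]
      · refine mul_le_mul_of_nonneg_left ?_ (by have := Real.pi_pos; positivity)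
        have := interferenceKernel_le hδ (by positivity : 0 < ζ * T * g)
        rwa [Real.mul_rpow (by positivity) hg.le] at this
      · have := interferenceKernel_nonneg hδ (by positivity : 0 < ζ * T * g)
        have := Real.pi_pos
        positivity
  have hfk : ∀ y : Plane, 1 - fartherFactor T ζ δ G r ‖y‖ = ∫ g, k g y ∂G := by
    intro y
    simp only [hk, fartherFactor]
    split_ifs with h
    · rw [integral_sub (integrable_const _)
        (integrable_exp_interferer hT hζ hG hr.le (norm_nonneg _)), interfererFactor]
      simp
    · simp
  simp_rw [hfk]
  refine ⟨hint.integral_prod_right, ?_⟩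
  rw [← integral_integral_swap hint, interferenceTerm_eq, ← mul_assoc, ← integral_const_mul]
  exact integral_congr_ae (hG.mono fun g hg => (hpl g hg).2)

theorem one_sub_fartherFactor_nonneg [IsProbabilityMeasure G] (hT : 0 < T) (hζ : 0 < ζ)
    (hG : ∀ᵐ g ∂G, 0 < g) {r : ℝ} (hr : 0 < r) (y : Plane) :
    0 ≤ 1 - fartherFactor T ζ δ G r ‖y‖ :=
  sub_nonneg.2 (fartherFactor_le_one hT hζ hG hr.le (norm_nonneg _))

theorem innerExponent_le [IsProbabilityMeasure G] (hT : 0 < T) (hζ : 0 < ζ)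
    (hδ : 2 < δ) (hG : ∀ᵐ g ∂G, 0 < g) (hGint : Integrable (fun g => g ^ (2 / δ)) G)
    {r : ℝ} (hr : 0 < r) (R : ℝ) :
    innerExponent T ζ δ G R r ≤ Real.pi * interferenceTerm T ζ δ G r := by
  obtain ⟨hi, hv⟩ := integral_one_sub_fartherFactor hT hζ hδ hG hGint hr
  rw [← hv]
  exact setIntegral_le_integral hi
    (ae_of_all _ fun y => one_sub_fartherFactor_nonneg hT hζ hG hr y)

/-- The serving base station is the nearest one, so the disc inside it counts in full. -/
theorem le_innerExponent [IsProbabilityMeasure G] (hT : 0 < T) (hζ : 0 < ζ)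
    (hδ : 2 < δ) (hG : ∀ᵐ g ∂G, 0 < g) (hGint : Integrable (fun g => g ^ (2 / δ)) G)
    {r R : ℝ} (hr : 0 < r) (hR : r ≤ R) :
    Real.pi * r ^ 2 ≤ innerExponent T ζ δ G R r := by
  obtain ⟨hi, -⟩ := integral_one_sub_fartherFactor hT hζ hδ hG hGint hr
  have hb : Real.pi * r ^ 2 = ∫ y in innerDisc r, (1 - fartherFactor T ζ δ G r ‖y‖) := by
    have e : ∫ y in innerDisc r, (1 - fartherFactor T ζ δ G r ‖y‖) = ∫ y in innerDisc r, (1 : ℝ) := by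
      refine setIntegral_congr_fun measurableSet_ball fun y hy => ?_
      have hy' : ‖y‖ < r := by simpa [innerDisc] using hy
      simp [fartherFactor, not_lt.2 hy'.le]
    rw [e, setIntegral_const, smul_eq_mul, mul_one, innerDisc, measureReal_def,
      EuclideanSpace.volume_ball_fin_two, ENNReal.toReal_mul, ENNReal.toReal_pow,
      ENNReal.toReal_ofReal hr.le, ENNReal.toReal_ofReal Real.pi_pos.le, mul_comm]
  rw [hb]
  exact setIntegral_mono_set hi.integrableOn
    (ae_of_all _ fun y => one_sub_fartherFactor_nonneg hT hζ hG hr y)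
    (Metric.ball_subset_ball hR).eventuallyLE

theorem one_le_interferenceTerm_one [IsProbabilityMeasure G] (hT : 0 < T) (hζ : 0 < ζ)
    (hδ : 2 < δ) (hG : ∀ᵐ g ∂G, 0 < g) (hGint : Integrable (fun g => g ^ (2 / δ)) G) :
    1 ≤ interferenceTerm T ζ δ G 1 := by
  have h1 := le_innerExponent hT hζ hδ hG hGint one_pos le_rfl
  have h2 := innerExponent_le hT hζ hδ hG hGint one_pos 1
  have h3 := h1.trans h2
  rw [one_pow] at h3
  exact le_of_mul_le_mul_left h3 Real.pi_pos

theorem tendsto_innerExponent [IsProbabilityMeasure G] (hT : 0 < T) (hζ : 0 < ζ)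
    (hδ : 2 < δ) (hG : ∀ᵐ g ∂G, 0 < g) (hGint : Integrable (fun g => g ^ (2 / δ)) G)
    {r : ℝ} (hr : 0 < r) :
    Tendsto (fun R => innerExponent T ζ δ G R r) atTop
      (𝓝 (Real.pi * interferenceTerm T ζ δ G r)) := by
  obtain ⟨hi, hv⟩ := integral_one_sub_fartherFactor hT hζ hδ hG hGint hr
  rw [← hv]
  exact (aecover_ball tendsto_id).integral_tendsto_of_countably_generated hi

theorem outerExponent_nonneg [IsProbabilityMeasure G] (hT : 0 < T) (hζ : 0 < ζ)
    (hG : ∀ᵐ g ∂G, 0 < g) {r : ℝ} (hr : 0 < r) (R a : ℝ) :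
    0 ≤ outerExponent T ζ δ G R a r :=
  integral_nonneg fun _ => sub_nonneg.2
    (interfererFactor_le_one hT hζ hG hr.le (norm_nonneg _))

/-- Uniformly in `a`, the exponent of the outer circle is bounded by that of the whole plane. -/
theorem outerExponent_le [IsProbabilityMeasure G] (hT : 0 < T) (hζ : 0 < ζ)
    (hδ : 2 < δ) (hG : ∀ᵐ g ∂G, 0 < g) (hGint : Integrable (fun g => g ^ (2 / δ)) G)
    {r R : ℝ} (hr : 0 < r) (hR : r < R) (a : ℝ) :
    outerExponent T ζ δ G R a r ≤ Real.pi * interferenceTerm T ζ δ G r := by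
  obtain ⟨hi, hv⟩ := integral_one_sub_fartherFactor hT hζ hδ hG hGint hr
  have e : outerExponent T ζ δ G R a r
      = ∫ y in outerAnnulus R a, (1 - fartherFactor T ζ δ G r ‖y‖) := by
    refine setIntegral_congr_fun (measurableSet_outerAnnulus R a) fun y hy => ?_
    have hy' : R ≤ ‖y‖ := by simpa using hy.2
    simp [fartherFactor, hR.trans_le hy']
  rw [e, ← hv]
  exact setIntegral_le_integral hi
    (ae_of_all _ fun y => one_sub_fartherFactor_nonneg hT hζ hG hr y)

theorem measurable_innerExponent [IsProbabilityMeasure G] (R : ℝ) :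
    Measurable (innerExponent T ζ δ G R) := by
  have : StronglyMeasurable fun p : ℝ × Plane => 1 - fartherFactor T ζ δ G p.1 ‖p.2‖ :=
    (measurable_const.sub (measurable_fartherFactor.comp
      (by fun_prop : Measurable fun p : ℝ × Plane => (p.1, ‖p.2‖)))).stronglyMeasurable
  exact this.integral_prod_right.measurable

theorem measurable_outerExponent [IsProbabilityMeasure G] (R a : ℝ) :
    Measurable (outerExponent T ζ δ G R a) := by
  have : StronglyMeasurable fun p : ℝ × Plane => 1 - interfererFactor T ζ δ G p.1 ‖p.2‖ :=
    (measurable_const.sub (measurable_interfererFactor.comp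
      (by fun_prop : Measurable fun p : ℝ × Plane => (p.1, ‖p.2‖)))).stronglyMeasurable
  exact this.integral_prod_right.measurable

/-! ### Averaging over the densities -/

theorem exp_neg_mul_le {t K x : ℝ} (h0 : 0 ≤ t) (hK : t ≤ K) :
    Real.exp (-t * x) ≤ 1 + Real.exp (-K * x) := by
  rcases le_total 0 x with hx | hx
  · have : Real.exp (-t * x) ≤ 1 := Real.exp_le_one_iff.2 (by nlinarith)
    linarith [Real.exp_pos (-K * x)]
  · have : Real.exp (-t * x) ≤ Real.exp (-K * x) := Real.exp_le_exp.2 (by nlinarith)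
    linarith

theorem laplace_le {ν : Measure ℝ} [IsProbabilityMeasure ν]
    (hν : ∀ s, 0 < s → Integrable (fun x => Real.exp (-s * x)) ν) {t K : ℝ} (hK : 0 < K)
    (h0 : 0 ≤ t) (ht : t ≤ K) :
    ∫ x, Real.exp (-t * x) ∂ν ≤ 1 + ∫ x, Real.exp (-K * x) ∂ν := by
  have hi := (integrable_const (1 : ℝ)).add (hν K hK)
  have h := integral_mono (Integrable.mono' hi (by fun_prop) (ae_of_all _ fun x => by
    rw [Real.norm_of_nonneg (Real.exp_pos _).le]; exact exp_neg_mul_le h0 ht)) hi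
    (fun x => exp_neg_mul_le h0 ht)
  rw [integral_add' (integrable_const _) (hν K hK)] at h
  simpa using h

theorem tendsto_laplace_zero {ν : Measure ℝ} [IsProbabilityMeasure ν]
    (hν : ∀ s, 0 < s → Integrable (fun x => Real.exp (-s * x)) ν) :
    Tendsto (fun t => ∫ x, Real.exp (-t * x) ∂ν) (𝓝[≥] 0) (𝓝 1) := by
  have h1 : (1 : ℝ) = ∫ _, (1 : ℝ) ∂ν := by simp
  rw [h1]
  refine tendsto_integral_filter_of_dominated_convergence (fun x => 1 + Real.exp (-1 * x))
    (Eventually.of_forall fun t => by fun_prop) ?_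
    ((integrable_const (1 : ℝ)).add (hν 1 one_pos)) (ae_of_all _ fun x => ?_)
  · filter_upwards [self_mem_nhdsWithin, mem_nhdsWithin_of_mem_nhds (Iio_mem_nhds one_pos)]
      with t ht ht1
    refine ae_of_all _ fun x => ?_
    rw [Real.norm_of_nonneg (Real.exp_pos _).le]
    exact exp_neg_mul_le ht ht1.le
  · have : Continuous fun t : ℝ => Real.exp (-t * x) := by fun_prop
    have := (this.tendsto 0).mono_left (nhdsWithin_le_nhds (s := Ici 0))
    simpa using this

/-- For `l > 0` the integrand is the density of the distance from the origin to the nearest point of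
a Poisson process of density `l`. The integral is `1 - e^(-l π R²)` for either sign of `l`. -/
theorem integral_nearest_le_one (l : ℝ) {R : ℝ} (hR : 0 < R) :
    ∫ r in Ioo 0 R, 2 * Real.pi * r * (l * Real.exp (-l * (Real.pi * r ^ 2))) ≤ 1 := by
  have hderiv : ∀ r ∈ uIcc 0 R, HasDerivAt (fun r : ℝ => -Real.exp (-l * (Real.pi * r ^ 2)))
      (2 * Real.pi * r * (l * Real.exp (-l * (Real.pi * r ^ 2)))) r := by
    intro r _
    have h := ((((hasDerivAt_pow 2 r).const_mul Real.pi).const_mul (-l)).exp).neg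
    refine h.congr_deriv ?_
    push_cast
    ring
  rw [← integral_Ioc_eq_integral_Ioo, ← intervalIntegral.integral_of_le hR.le,
    intervalIntegral.integral_eq_sub_of_hasDerivAt hderiv
      (Continuous.intervalIntegrable (by fun_prop) _ _)]
  have := Real.exp_pos (-l * (Real.pi * R ^ 2))
  rw [zero_pow two_ne_zero, mul_zero, mul_zero, Real.exp_zero]
  linarith

/-- Joint integrability in the two densities and the distance of the serving base station. At a
positive density the mass of the distance is at most one; negative densities are controlled by
exponential moments. -/
theorem integrable_density_distance {ν ν' : Measure ℝ} [IsProbabilityMeasure ν]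
    [IsProbabilityMeasure ν']
    (hν : ∀ s, 0 < s → Integrable (fun x => Real.exp (-s * x)) ν)
    (hν' : ∀ s, 0 < s → Integrable (fun x => Real.exp (-s * x)) ν')
    {A C w : ℝ → ℝ} (hA : Measurable A) (hC : Measurable C) (hw : Measurable w) {R K : ℝ}
    (hR : 0 < R) (hK : 0 < K) (hA0 : ∀ r ∈ Ioo 0 R, Real.pi * r ^ 2 ≤ A r)
    (hAK : ∀ r ∈ Ioo 0 R, A r ≤ K) (hC0 : ∀ r ∈ Ioo 0 R, 0 ≤ C r)
    (hCK : ∀ r ∈ Ioo 0 R, C r ≤ K) (hw1 : ∀ r ∈ Ioo 0 R, |w r| ≤ 1) :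
    Integrable (fun p : (ℝ × ℝ) × ℝ => 2 * Real.pi * p.2 *
      (w p.2 * (p.1.1 * Real.exp (-A p.2 * p.1.1) * Real.exp (-C p.2 * p.1.2))))
      ((ν.prod ν').prod (volume.restrict (Ioo 0 R))) := by
  have hpi := Real.pi_pos
  set f : (ℝ × ℝ) × ℝ → ℝ := fun p => 2 * Real.pi * p.2 *
      (w p.2 * (p.1.1 * Real.exp (-A p.2 * p.1.1) * Real.exp (-C p.2 * p.1.2))) with hf
  have hfm : Measurable f := by fun_prop
  -- the dominating function treats positive densities by `π r² ≤ A r`, negative ones by `A r ≤ K`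
  set g : ℝ × ℝ → ℝ → ℝ := fun q r => (2 * Real.pi * r * (max q.1 0 * Real.exp
    (-max q.1 0 * (Real.pi * r ^ 2))) + 2 * Real.pi * R * |q.1 * Real.exp (-K * q.1)|) *
      (1 + Real.exp (-K * q.2)) with hg
  have hgi : ∀ q, IntegrableOn (g q) (Ioo 0 R) := fun q =>
    (Continuous.integrableOn_Icc (by fun_prop)).mono_set Ioo_subset_Icc_self
  have hfg : ∀ q : ℝ × ℝ, ∀ r ∈ Ioo 0 R, ‖f (q, r)‖ ≤ g q r := by
    rintro ⟨l, m⟩ r hr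
    have hr0 : 0 < r := hr.1
    have h1 : |l| * Real.exp (-A r * l) * r ≤ r * (max l 0 * Real.exp
        (-max l 0 * (Real.pi * r ^ 2))) + R * |l * Real.exp (-K * l)| := by
      rcases le_total 0 l with hl | hl
      · rw [max_eq_left hl, abs_of_nonneg hl]
        have h2 : Real.exp (-A r * l) ≤ Real.exp (-l * (Real.pi * r ^ 2)) :=
          Real.exp_le_exp.2 (by nlinarith [mul_le_mul_of_nonneg_left (hA0 r hr) hl])
        have h3 : 0 ≤ R * |l * Real.exp (-K * l)| := by positivity
        have h4 := mul_le_mul_of_nonneg_left h2 (mul_nonneg hr0.le hl)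
        linarith
      · rw [max_eq_right hl, abs_mul, Real.abs_exp]
        have h2 : Real.exp (-A r * l) ≤ Real.exp (-K * l) :=
          Real.exp_le_exp.2 (by nlinarith [mul_le_mul_of_nonpos_left (hAK r hr) hl])
        have h3 : |l| * Real.exp (-A r * l) * r ≤ |l| * Real.exp (-K * l) * R := by
          gcongr
          exact hr.2.le
        linarith
    have h5 : Real.exp (-C r * m) ≤ 1 + Real.exp (-K * m) :=
      exp_neg_mul_le (hC0 r hr) (hCK r hr)
    simp only [hf, hg, Real.norm_eq_abs, abs_mul, Real.abs_exp, abs_of_pos hpi, abs_of_pos hr0,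
      abs_two]
    rw [abs_mul, Real.abs_exp] at h1
    calc 2 * Real.pi * r * (|w r| * (|l| * Real.exp (-A r * l) * Real.exp (-C r * m)))
        ≤ 2 * Real.pi * r * (1 * (|l| * Real.exp (-A r * l) * (1 + Real.exp (-K * m)))) := by
          gcongr
          exact hw1 r hr
      _ = 2 * Real.pi * (|l| * Real.exp (-A r * l) * r) * (1 + Real.exp (-K * m)) := by ring
      _ ≤ 2 * Real.pi * (r * (max l 0 * Real.exp
        (-max l 0 * (Real.pi * r ^ 2))) + R * (|l| * Real.exp (-K * l))) *
          (1 + Real.exp (-K * m)) := by gcongr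
      _ = _ := by ring
  have hfi : ∀ q, Integrable (fun r => f (q, r)) (volume.restrict (Ioo 0 R)) := fun q =>
    (hgi q).mono' (hfm.comp measurable_prodMk_left).aestronglyMeasurable
      ((ae_restrict_iff' measurableSet_Ioo).2 (ae_of_all _ (hfg q)))
  rw [integrable_prod_iff hfm.aestronglyMeasurable]
  refine ⟨ae_of_all _ hfi, ?_⟩
  have hbound : Integrable (fun q : ℝ × ℝ =>
      (1 + 2 * Real.pi * R * |q.1 * Real.exp (-K * q.1)| * R) * (1 + Real.exp (-K * q.2)))
      (ν.prod ν') := by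
    refine Integrable.mul_prod (f := fun l : ℝ => 1 + 2 * Real.pi * R * |l * Real.exp (-K * l)| * R)
      (g := fun m : ℝ => 1 + Real.exp (-K * m)) ?_ ?_
    · exact (integrable_const _).add
        ((((integrable_mul_exp hν hK).abs).const_mul _).mul_const _)
    · exact (integrable_const _).add (hν' K hK)
  refine hbound.mono' ?_ (ae_of_all _ fun q => ?_)
  · exact (hfm.norm.stronglyMeasurable.integral_prod_right
      (ν := volume.restrict (Ioo 0 R))).aestronglyMeasurable
  · rw [Real.norm_of_nonneg (integral_nonneg fun _ => norm_nonneg _)]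
    refine (setIntegral_mono_on (hfi q).norm (hgi q) measurableSet_Ioo (hfg q)).trans ?_
    simp only [hg]
    rw [integral_mul_const, integral_add
      ((Continuous.integrableOn_Icc (by fun_prop)).mono_set Ioo_subset_Icc_self)
      ((Continuous.integrableOn_Icc (by fun_prop)).mono_set Ioo_subset_Icc_self)]
    refine mul_le_mul_of_nonneg_right (add_le_add ?_ ?_) (by positivity)
    · exact integral_nearest_le_one _ hR
    · rw [setIntegral_const, smul_eq_mul, measureReal_def, Real.volume_Ioo, sub_zero,
        ENNReal.toReal_ofReal hR.le, mul_comm]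

variable {H : ℝ} {ν : Measure ℝ}

theorem exp_noise_le_one (hT : 0 < T) (hζ : 0 < ζ) (hN₀ : 0 ≤ N₀) {r : ℝ} (hr : 0 < r) :
    |Real.exp (-(ζ * T * r ^ δ * N₀))| ≤ 1 := by
  rw [Real.abs_exp]
  exact Real.exp_le_one_iff.2 (neg_nonpos.2 (by positivity))

/-- A bound, for `r < R`, of the exponents of both circles. -/
theorem exists_exponent_le [IsProbabilityMeasure G] (hT : 0 < T) (hζ : 0 < ζ)
    (hδ : 2 < δ) (hG : ∀ᵐ g ∂G, 0 < g) (hGint : Integrable (fun g => g ^ (2 / δ)) G)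
    {R : ℝ} (hR : 0 < R) :
    ∃ K, 0 < K ∧ ∀ r ∈ Ioo 0 R, innerExponent T ζ δ G R r ≤ K ∧
      ∀ a, outerExponent T ζ δ G R a r ≤ K := by
  have hpi := Real.pi_pos
  have h1 := one_le_interferenceTerm_one hT hζ hδ hG hGint
  have h2 : ∀ r ∈ Ioo 0 R, Real.pi * interferenceTerm T ζ δ G r
      ≤ Real.pi * (R ^ 2 * interferenceTerm T ζ δ G 1) := by
    intro r hr
    rw [interferenceTerm_eq_sq_mul]
    gcongr
    · exact hr.1.le
    · exact hr.2.le
  refine ⟨Real.pi * (R ^ 2 * interferenceTerm T ζ δ G 1), by positivity, fun r hr => ⟨?_, fun a => ?_⟩⟩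
  · exact (innerExponent_le hT hζ hδ hG hGint hr.1 R).trans (h2 r hr)
  · exact (outerExponent_le hT hζ hδ hG hGint hr.1 hr.2 a).trans (h2 r hr)

/-- The coverage probability as a single integral over the distance of the serving base station. -/
theorem coverageProbability_eq [IsProbabilityMeasure G] [IsProbabilityMeasure ν] (hT : 0 < T)
    (hζ : 0 < ζ) (hδ : 2 < δ) (hN₀ : 0 ≤ N₀) (hG : ∀ᵐ g ∂G, 0 < g)
    (hGint : Integrable (fun g => g ^ (2 / δ)) G)
    (hν : ∀ s, 0 < s → Integrable (fun x => Real.exp (-s * x)) ν)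
    {R a : ℝ} (hR : 0 < R) (ha : 1 < a) :
    coverageProbability T ζ δ N₀ H G ν R a =
      ∫ r in Ioo 0 R, 2 * Real.pi * r * (Real.exp (-(ζ * T * r ^ δ * N₀)) *
        (weightedMean ν (innerExponent T ζ δ G R r) *
          ∫ x, Real.exp (-(a ^ (H - 2) * outerExponent T ζ δ G R a r) * x) ∂ν)) := by
  have hc : 0 < a ^ (H - 2) := Real.rpow_pos_of_pos (by linarith) _
  set c := a ^ (H - 2) with hcdef
  have hmap : AEMeasurable (fun l => c * l) ν := by fun_prop
  have hν'p : IsProbabilityMeasure (ν.map fun l => c * l) := Measure.isProbabilityMeasure_map hmap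
  have hν' : ∀ s, 0 < s → Integrable (fun x => Real.exp (-s * x)) (ν.map fun l => c * l) := by
    intro s hs
    rw [integrable_map_measure (by fun_prop) hmap]
    refine (hν (s * c) (by positivity)).congr (ae_of_all _ fun x => ?_)
    simp only [Function.comp_apply]
    congr 1; ring
  obtain ⟨K, hK, hAK⟩ := exists_exponent_le hT hζ hδ hG hGint hR
  have hint := integrable_density_distance hν hν' (measurable_innerExponent (T := T) (ζ := ζ)
    (δ := δ) (G := G) R) (measurable_outerExponent (T := T) (ζ := ζ) (δ := δ) (G := G) R a)
    (w := fun r => Real.exp (-(ζ * T * r ^ δ * N₀))) (by fun_prop) hR hK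
    (fun r hr => le_innerExponent hT hζ hδ hG hGint hr.1 hr.2.le) (fun r hr => (hAK r hr).1)
    (fun r hr => outerExponent_nonneg hT hζ hG hr.1 R a) (fun r hr => (hAK r hr).2 a)
    (fun r hr => exp_noise_le_one hT hζ hN₀ hr.1)
  rw [coverageProbability]
  have e : ∀ q : ℝ × ℝ, coverageGivenDensity T ζ δ N₀ G R a q.1 q.2 =
      ∫ r in Ioo 0 R, 2 * Real.pi * r * (Real.exp (-(ζ * T * r ^ δ * N₀)) *
        (q.1 * Real.exp (-innerExponent T ζ δ G R r * q.1) *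
          Real.exp (-outerExponent T ζ δ G R a r * q.2))) := by
    intro q
    rw [coverageGivenDensity_eq hT hζ hN₀ hG hR ha]
    simp only [neg_mul, mul_comm q.1 (innerExponent _ _ _ _ _ _),
      mul_comm q.2 (outerExponent _ _ _ _ _ _ _)]
  simp_rw [e]
  rw [integral_integral_swap hint]
  congr with r
  rw [integral_const_mul, integral_const_mul,
    integral_prod_mul (fun l => l * Real.exp (-innerExponent T ζ δ G R r * l))
      (fun m => Real.exp (-outerExponent T ζ δ G R a r * m)),
    integral_map hmap (by fun_prop)]
  congr 3
  refine integral_congr_ae (ae_of_all _ fun x => ?_)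
  dsimp only
  congr 1; ring

theorem integrableOn_weightedMean_innerExponent [IsProbabilityMeasure G] [IsProbabilityMeasure ν]
    (hT : 0 < T) (hζ : 0 < ζ) (hδ : 2 < δ) (hN₀ : 0 ≤ N₀) (hG : ∀ᵐ g ∂G, 0 < g)
    (hGint : Integrable (fun g => g ^ (2 / δ)) G)
    (hν : ∀ s, 0 < s → Integrable (fun x => Real.exp (-s * x)) ν)
    {R : ℝ} (hR : 0 < R) :
    IntegrableOn (fun r => 2 * Real.pi * r * (Real.exp (-(ζ * T * r ^ δ * N₀)) *
        weightedMean ν (innerExponent T ζ δ G R r))) (Ioo 0 R) := by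
  obtain ⟨K, hK, hAK⟩ := exists_exponent_le hT hζ hδ hG hGint hR
  have hint := integrable_density_distance hν hν (measurable_innerExponent (T := T) (ζ := ζ)
    (δ := δ) (G := G) R) (C := fun _ => 0) measurable_const
    (w := fun r => Real.exp (-(ζ * T * r ^ δ * N₀))) (by fun_prop) hR hK
    (fun r hr => le_innerExponent hT hζ hδ hG hGint hr.1 hr.2.le) (fun r hr => (hAK r hr).1)
    (fun r hr => le_rfl) (fun r hr => hK.le)
    (fun r hr => exp_noise_le_one hT hζ hN₀ hr.1)
  refine hint.integral_prod_right.congr (ae_of_all _ fun r => ?_)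
  dsimp only
  rw [integral_const_mul, integral_const_mul,
    integral_prod_mul (fun l => l * Real.exp (-innerExponent T ζ δ G R r * l))
      (fun m => Real.exp (-0 * m))]
  simp [weightedMean]

/-- The outer circle fades as `a → ∞`: its density is of order `a ^ (H - 2)`, while its exponent per
unit of density stays bounded. -/
theorem tendsto_coverageProbability [IsProbabilityMeasure G] [IsProbabilityMeasure ν] (hT : 0 < T)
    (hζ : 0 < ζ) (hδ : 2 < δ) (hN₀ : 0 ≤ N₀) (hH : H < 1) (hG : ∀ᵐ g ∂G, 0 < g)
    (hGint : Integrable (fun g => g ^ (2 / δ)) G)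
    (hν : ∀ s, 0 < s → Integrable (fun x => Real.exp (-s * x)) ν)
    {R : ℝ} (hR : 0 < R) :
    Tendsto (fun a => coverageProbability T ζ δ N₀ H G ν R a) atTop
      (𝓝 (∫ r in Ioo 0 R, 2 * Real.pi * r * (Real.exp (-(ζ * T * r ^ δ * N₀)) *
        weightedMean ν (innerExponent T ζ δ G R r)))) := by
  obtain ⟨K, hK, hAK⟩ := exists_exponent_le hT hζ hδ hG hGint hR
  have hFi := integrableOn_weightedMean_innerExponent hT hζ hδ hN₀ hG hGint hν hR
  set Q : ℝ → ℝ := fun r => 2 * Real.pi * r * (Real.exp (-(ζ * T * r ^ δ * N₀)) *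
        weightedMean ν (innerExponent T ζ δ G R r)) with hQ
  set L : ℝ → ℝ := fun t => ∫ x, Real.exp (-t * x) ∂ν with hL
  have hLm : Measurable L := by
    have : StronglyMeasurable fun p : ℝ × ℝ => Real.exp (-p.1 * p.2) :=
      Measurable.stronglyMeasurable (by fun_prop)
    exact this.integral_prod_right.measurable
  have hL0 : ∀ t, 0 ≤ L t := fun t => integral_nonneg fun x => (Real.exp_pos _).le
  have hcov : ∀ᶠ a in atTop, ∫ r in Ioo 0 R,
      Q r * L (a ^ (H - 2) * outerExponent T ζ δ G R a r)
      = coverageProbability T ζ δ N₀ H G ν R a := by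
    filter_upwards [eventually_gt_atTop 1] with a ha
    rw [coverageProbability_eq hT hζ hδ hN₀ hG hGint hν hR ha]
    refine integral_congr_ae (ae_of_all _ fun r => ?_)
    simp only [hQ, hL]
    ring
  refine Tendsto.congr' hcov ?_
  have hbd : ∀ᶠ a : ℝ in atTop, ∀ r ∈ Ioo 0 R,
      0 ≤ a ^ (H - 2) * outerExponent T ζ δ G R a r ∧
      a ^ (H - 2) * outerExponent T ζ δ G R a r ≤ a ^ (H - 2) * K ∧
      a ^ (H - 2) * outerExponent T ζ δ G R a r ≤ K := by
    filter_upwards [eventually_gt_atTop 1] with a ha r hr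
    have hc : 0 < a ^ (H - 2) := Real.rpow_pos_of_pos (by linarith) _
    have hc1 : a ^ (H - 2) ≤ 1 := Real.rpow_le_one_of_one_le_of_nonpos ha.le (by linarith)
    have h0 := outerExponent_nonneg (δ := δ) hT hζ hG hr.1 R a
    have h1 := (hAK r hr).2 a
    refine ⟨by positivity, by gcongr, ?_⟩
    exact (mul_le_of_le_one_left h0 hc1).trans h1
  refine tendsto_integral_filter_of_dominated_convergence
    (fun r => ‖Q r‖ * (1 + L K)) ?_ ?_ (hFi.norm.mul_const _) ?_
  · refine Eventually.of_forall fun a => ?_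
    exact hFi.aestronglyMeasurable.mul (hLm.comp
      ((measurable_outerExponent R a).const_mul _)).aestronglyMeasurable
  · filter_upwards [hbd] with a ha
    filter_upwards [self_mem_ae_restrict measurableSet_Ioo] with r hr
    rw [norm_mul, Real.norm_of_nonneg (hL0 _)]
    exact mul_le_mul_of_nonneg_left (laplace_le hν hK (ha r hr).1 (ha r hr).2.2) (norm_nonneg _)
  · filter_upwards [self_mem_ae_restrict measurableSet_Ioo] with r hr
    have h1 : Tendsto (fun a : ℝ => a ^ (H - 2) * K) atTop (𝓝 0) := by
      have := (tendsto_rpow_neg_atTop (by linarith : 0 < 2 - H)).mul_const K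
      simpa using this
    have h2 : Tendsto (fun a : ℝ => a ^ (H - 2) * outerExponent T ζ δ G R a r) atTop (𝓝[≥] 0) := by
      refine tendsto_nhdsWithin_iff.2 ⟨?_, hbd.mono fun a ha => (ha r hr).1⟩
      exact squeeze_zero' (hbd.mono fun a ha => (ha r hr).1) (hbd.mono fun a ha => (ha r hr).2.1) h1
    have h3 := ((tendsto_laplace_zero hν).comp h2).const_mul (Q r)
    simpa [Function.comp_def, hL] using h3

/-- The limit `R → ∞`. Since `weightedMean ν` is antitone and the exponent lies between `π r²` and
its limit `b r²`, the integrand is dominated by its values at these two ends; the change of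
variables that takes `b r²` to `π r²` reduces the former to the latter. -/
theorem tendsto_integral_weightedMean [IsProbabilityMeasure G] [IsProbabilityMeasure ν]
    (hT : 0 < T) (hζ : 0 < ζ) (hδ : 2 < δ) (hN₀ : 0 ≤ N₀) (hG : ∀ᵐ g ∂G, 0 < g)
    (hGint : Integrable (fun g => g ^ (2 / δ)) G)
    (hν : ∀ s, 0 < s → Integrable (fun x => Real.exp (-s * x)) ν)
    (hint : IntegrableOn (fun r => 2 * Real.pi * r * (Real.exp (-(ζ * T * r ^ δ * N₀)) *
      weightedMean ν (Real.pi * interferenceTerm T ζ δ G r))) (Ioi 0)) :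
    Tendsto (fun R => ∫ r in Ioo 0 R, 2 * Real.pi * r * (Real.exp (-(ζ * T * r ^ δ * N₀)) *
        weightedMean ν (innerExponent T ζ δ G R r))) atTop
      (𝓝 (∫ r in Ioi 0, 2 * Real.pi * r * (Real.exp (-(ζ * T * r ^ δ * N₀)) *
        weightedMean ν (Real.pi * interferenceTerm T ζ δ G r)))) := by
  have hpi := Real.pi_pos
  have hδ0 : 0 < δ := by linarith
  set I := interferenceTerm T ζ δ G 1 with hI
  have hI1 : 1 ≤ I := one_le_interferenceTerm_one hT hζ hδ hG hGint
  have hI0 : 0 < I := by linarith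
  set w : ℝ → ℝ := fun r => Real.exp (-(ζ * T * r ^ δ * N₀)) with hw
  set F := weightedMean ν with hF
  have hFanti := antitoneOn_weightedMean hν
  set Q : ℝ → ℝ := fun r => 2 * Real.pi * r * (w r * F (Real.pi * interferenceTerm T ζ δ G r))
    with hQ
  have hFm : Measurable F := by
    have : StronglyMeasurable fun p : ℝ × ℝ => p.2 * Real.exp (-p.1 * p.2) :=
      Measurable.stronglyMeasurable (by fun_prop)
    exact this.integral_prod_right.measurable
  -- `k` is chosen so that `b (k r)² = π r²`, where `b = π I`
  set k := √(1 / I) with hk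
  have hk0 : 0 < k := Real.sqrt_pos.2 (by positivity)
  have hk1 : k ≤ 1 := Real.sqrt_le_one.2 (by rw [div_le_one hI0]; exact hI1)
  have hkI : k ^ 2 * I = 1 := by
    rw [hk, Real.sq_sqrt (by positivity)]; field_simp
  have hQk : IntegrableOn (fun r => k⁻¹ * ‖Q (k * r)‖) (Ioi 0) := by
    refine Integrable.const_mul ?_ _
    have := (integrableOn_Ioi_comp_mul_left_iff (fun r => ‖Q r‖) 0 hk0).2 (by
      rw [mul_zero]; exact hint.norm)
    exact this
  have hlow : ∀ r, 0 < r → 2 * Real.pi * r * (w r * |F (Real.pi * r ^ 2)|) ≤ k⁻¹ * ‖Q (k * r)‖ := by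
    intro r hr
    have e : Real.pi * interferenceTerm T ζ δ G (k * r) = Real.pi * r ^ 2 := by
      rw [interferenceTerm_eq_sq_mul, mul_pow, mul_right_comm, hkI, one_mul]
    have hww : w r ≤ w (k * r) := by
      refine Real.exp_le_exp.2 (neg_le_neg ?_)
      have : (k * r) ^ δ ≤ r ^ δ :=
        Real.rpow_le_rpow (by positivity) (mul_le_of_le_one_left hr.le hk1) hδ0.le
      gcongr
    simp only [hQ]
    rw [e, norm_mul, norm_mul, norm_mul _ (F _), Real.norm_of_nonneg (by positivity : 0 ≤ w (k * r)),
      Real.norm_of_nonneg (by positivity : 0 ≤ 2 * Real.pi), Real.norm_of_nonneg (by positivity : 0 ≤ k * r),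
      Real.norm_eq_abs]
    have e2 : k⁻¹ * (2 * Real.pi * (k * r) * (w (k * r) * |F (Real.pi * r ^ 2)|))
        = 2 * Real.pi * r * (w (k * r) * |F (Real.pi * r ^ 2)|) := by
      field_simp
    rw [e2]
    gcongr
  have hind : ∀ R, ∫ r in Ioo 0 R, 2 * Real.pi * r * (w r * F (innerExponent T ζ δ G R r))
      = ∫ r in Ioi 0, (Iio R).indicator
        (fun r => 2 * Real.pi * r * (w r * F (innerExponent T ζ δ G R r))) r := by
    intro R
    rw [setIntegral_indicator measurableSet_Iio, Ioi_inter_Iio]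
  refine Tendsto.congr (fun R => (hind R).symm) ?_
  refine tendsto_integral_filter_of_dominated_convergence
    (fun r => k⁻¹ * ‖Q (k * r)‖ + ‖Q r‖) ?_ ?_ (hQk.add hint.norm) ?_
  · refine Eventually.of_forall fun R => Measurable.aestronglyMeasurable ?_
    have := hFm.comp (measurable_innerExponent (T := T) (ζ := ζ) (δ := δ) (G := G) R)
    refine Measurable.indicator ?_ measurableSet_Iio
    exact Measurable.mul (by fun_prop) (Measurable.mul (by fun_prop) this)
  · refine Eventually.of_forall fun R => ?_
    filter_upwards [self_mem_ae_restrict measurableSet_Ioi] with r hr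
    have hr0 : (0 : ℝ) < r := hr
    by_cases hrR : r ∈ Iio R
    · rw [indicator_of_mem hrR]
      have h1 : Real.pi * r ^ 2 ≤ innerExponent T ζ δ G R r :=
        le_innerExponent hT hζ hδ hG hGint hr0 (le_of_lt hrR)
      have h2 := innerExponent_le hT hζ hδ hG hGint hr0 R
      have h0 : 0 < Real.pi * r ^ 2 := by positivity
      have h3 : F (innerExponent T ζ δ G R r) ≤ F (Real.pi * r ^ 2) :=
        hFanti h0 (h0.trans_le h1) h1
      have h4 : F (Real.pi * interferenceTerm T ζ δ G r) ≤ F (innerExponent T ζ δ G R r) :=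
        hFanti (h0.trans_le h1) (h0.trans_le (h1.trans h2)) h2
      have h5 : |F (innerExponent T ζ δ G R r)| ≤ |F (Real.pi * r ^ 2)| +
          |F (Real.pi * interferenceTerm T ζ δ G r)| := by
        rw [abs_le]
        constructor
        · linarith [neg_abs_le (F (Real.pi * interferenceTerm T ζ δ G r)),
            abs_nonneg (F (Real.pi * r ^ 2))]
        · linarith [le_abs_self (F (Real.pi * r ^ 2)),
            abs_nonneg (F (Real.pi * interferenceTerm T ζ δ G r))]
      have h6 := hlow r hr0
      have hn : ∀ y, ‖2 * Real.pi * r * (w r * y)‖ = 2 * Real.pi * r * (w r * |y|) := by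
        intro y
        rw [Real.norm_eq_abs, abs_mul, abs_mul (w r), abs_of_pos (by positivity : 0 < 2 * Real.pi * r),
          abs_of_pos (by positivity : 0 < w r)]
      have h7 : ‖Q r‖ = 2 * Real.pi * r * (w r * |F (Real.pi * interferenceTerm T ζ δ G r)|) :=
        hn _
      rw [hn, h7]
      have h8 : 2 * Real.pi * r * (w r * |F (innerExponent T ζ δ G R r)|) ≤
          2 * Real.pi * r * (w r * (|F (Real.pi * r ^ 2)| +
          |F (Real.pi * interferenceTerm T ζ δ G r)|)) := by gcongr
      rw [mul_add, mul_add] at h8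
      linarith
    · rw [indicator_of_notMem hrR, norm_zero]
      positivity
  · filter_upwards [self_mem_ae_restrict measurableSet_Ioi] with r hr
    have hr0 : (0 : ℝ) < r := hr
    have hb0 : 0 < Real.pi * interferenceTerm T ζ δ G r := by
      rw [interferenceTerm_eq_sq_mul]; positivity
    have h1 : Tendsto (fun R => F (innerExponent T ζ δ G R r)) atTop
        (𝓝 (F (Real.pi * interferenceTerm T ζ δ G r))) :=
      ((continuousOn_weightedMean hν).continuousAt (Ioi_mem_nhds hb0)).tendsto.comp
        (tendsto_innerExponent hT hζ hδ hG hGint hr0)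
    refine ((h1.const_mul (w r)).const_mul (2 * Real.pi * r)).congr' ?_
    filter_upwards [eventually_gt_atTop r] with R hR
    rw [indicator_of_mem (show r ∈ Iio R from hR)]

/-! ### Absolute convergence of the limiting integral -/

/-- Without growth in the exponent the integrand is, up to the noise factor, a derivative of
constant sign of a bounded function. -/
theorem integrableOn_limit_of_nonneg {α κ μ b c δ : ℝ} (hα : 0 < α) (hκ : 0 ≤ κ) (hμ : 0 ≤ μ)
    (hb : 0 < b) (hc : 0 ≤ c) :
    IntegrableOn (fun r => 2 * Real.pi * r * (κ * α * (b * r ^ 2) ^ (α - 1) + μ) *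
      Real.exp (-(κ * (b * r ^ 2) ^ α) - c * r ^ δ - μ * (b * r ^ 2))) (Ioi 0) := by
  have hpi := Real.pi_pos
  -- cutting off at `0` makes the Laplace transform antitone on the whole line, so that it converges
  set h : ℝ → ℝ := fun x => Real.exp (-(κ * (max x 0) ^ α) - μ * max x 0) with hh
  have hanti : Antitone h := by
    intro x y hxy
    have h1 : max x 0 ≤ max y 0 := max_le_max_right 0 hxy
    have h2 : (max x 0) ^ α ≤ (max y 0) ^ α := Real.rpow_le_rpow (le_max_right _ _) h1 hα.le
    refine Real.exp_le_exp.2 ?_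
    have h3 := mul_le_mul_of_nonneg_left h2 hκ
    have h4 := mul_le_mul_of_nonneg_left h1 hμ
    linarith
  have hbdd : BddBelow (range h) := ⟨0, by rintro _ ⟨x, rfl⟩; exact (Real.exp_pos _).le⟩
  have hbr : Tendsto (fun r : ℝ => b * r ^ 2) atTop atTop :=
    (tendsto_pow_atTop two_ne_zero).const_mul_atTop hb
  have hlim : Tendsto (fun r : ℝ => -(Real.pi / b) * h (b * r ^ 2)) atTop
      (𝓝 (-(Real.pi / b) * ⨅ x, h x)) :=
    ((tendsto_atTop_ciInf hanti hbdd).comp hbr).const_mul _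
  have hmax : ∀ r : ℝ, max (b * r ^ 2) 0 = b * r ^ 2 := fun r => max_eq_left (by positivity)
  have hderiv : ∀ r ∈ Ioi (0 : ℝ), HasDerivAt (fun r : ℝ => -(Real.pi / b) * h (b * r ^ 2))
      (2 * Real.pi * r * (κ * α * (b * r ^ 2) ^ (α - 1) + μ) *
        Real.exp (-(κ * (b * r ^ 2) ^ α) - μ * (b * r ^ 2))) r := by
    intro r hr
    have hr0 : (0 : ℝ) < r := hr
    simp only [hh, hmax]
    have h1 := (hasDerivAt_pow 2 r).const_mul b
    have h2 := h1.rpow_const (p := α) (Or.inl (by positivity : b * r ^ 2 ≠ 0))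
    have h3 : HasDerivAt (fun r : ℝ => -(Real.pi / b) *
        Real.exp (-(κ * (b * r ^ 2) ^ α) - μ * (b * r ^ 2)))
        (-(Real.pi / b) * (Real.exp (-(κ * (b * r ^ 2) ^ α) - μ * (b * r ^ 2)) *
          (-(κ * (b * ((2 : ℕ) * r ^ (2 - 1)) * α * (b * r ^ 2) ^ (α - 1))) -
            μ * (b * ((2 : ℕ) * r ^ (2 - 1)))))) r :=
      (((h2.const_mul κ).neg.sub (h1.const_mul μ)).exp).const_mul (-(Real.pi / b))
    refine h3.congr_deriv ?_
    push_cast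
    field_simp
    ring
  have hnonneg : ∀ r ∈ Ioi (0 : ℝ), 0 ≤ 2 * Real.pi * r * (κ * α * (b * r ^ 2) ^ (α - 1) + μ) *
        Real.exp (-(κ * (b * r ^ 2) ^ α) - μ * (b * r ^ 2)) := by
    intro r hr
    have hr0 : (0 : ℝ) < r := hr
    positivity
  have hcont : ContinuousWithinAt (fun r : ℝ => -(Real.pi / b) * h (b * r ^ 2)) (Ici 0) 0 := by
    have : Continuous h :=
      Real.continuous_exp.comp (((((continuous_id.max continuous_const).rpow_const
        fun x => Or.inr hα.le).const_mul κ).neg).sub (by fun_prop))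
    exact Continuous.continuousWithinAt (by fun_prop)
  refine (integrableOn_Ioi_deriv_of_nonneg hcont hderiv hnonneg hlim).mono'
    (Measurable.aestronglyMeasurable (by fun_prop)) ?_
  filter_upwards [self_mem_ae_restrict measurableSet_Ioi] with r hr
  have hr0 : (0 : ℝ) < r := hr
  rw [Real.norm_of_nonneg (by positivity)]
  refine mul_le_mul_of_nonneg_left (Real.exp_le_exp.2 ?_) (by positivity)
  have : 0 ≤ c * r ^ δ := by positivity
  linarith

/-- A smaller power is dominated by any multiple of a larger one, up to a constant. -/
theorem exists_rpow_le_add {p δ c : ℝ} (hp : 0 ≤ p) (hpδ : p < δ) (hc : 0 < c) {k : ℝ}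
    (hk : 0 ≤ k) : ∃ M, ∀ r, 0 < r → k * r ^ p ≤ M + c * r ^ δ := by
  -- `(k / c) ^ (1 / (δ - p))` is the point at which `k r ^ p = c r ^ δ`
  refine ⟨k * ((k / c) ^ (1 / (δ - p))) ^ p, fun r hr => ?_⟩
  have hd : 0 < δ - p := by linarith
  have hM : 0 ≤ k * ((k / c) ^ (1 / (δ - p))) ^ p := by positivity
  have e : r ^ δ = r ^ (δ - p) * r ^ p := by rw [← Real.rpow_add hr]; ring_nf
  rcases le_total (k / c) (r ^ (δ - p)) with h | h
  · have h1 : k ≤ c * r ^ (δ - p) := by rwa [div_le_iff₀' hc] at h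
    have h2 : k * r ^ p ≤ c * r ^ (δ - p) * r ^ p :=
      mul_le_mul_of_nonneg_right h1 (by positivity)
    rw [e]
    linarith
  · have h1 : r ≤ (k / c) ^ (1 / (δ - p)) := by
      have := Real.rpow_le_rpow (by positivity) h (by positivity : 0 ≤ 1 / (δ - p))
      rwa [← Real.rpow_mul hr.le, mul_one_div_cancel hd.ne', Real.rpow_one] at this
    have h2 : k * r ^ p ≤ k * ((k / c) ^ (1 / (δ - p))) ^ p := by gcongr
    have : 0 ≤ c * r ^ δ := by positivity
    linarith

/-- The noise dominates the exponent if `2 α < δ`. -/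
theorem integrableOn_limit_of_noise {α κ μ b c δ : ℝ} (hα : 0 < α) (hαδ : 2 * α < δ) (hδ : 2 < δ)
    (hb : 0 < b) (hc : 0 < c) :
    IntegrableOn (fun r => 2 * Real.pi * r * (κ * α * (b * r ^ 2) ^ (α - 1) + μ) *
      Real.exp (-(κ * (b * r ^ 2) ^ α) - c * r ^ δ - μ * (b * r ^ 2))) (Ioi 0) := by
  have hpi := Real.pi_pos
  have hc4 : 0 < c / 4 := by linarith
  obtain ⟨M₁, hM₁⟩ := exists_rpow_le_add (by linarith : 0 ≤ 2 * α) hαδ hc4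
    (by positivity : 0 ≤ |κ| * b ^ α)
  obtain ⟨M₂, hM₂⟩ := exists_rpow_le_add zero_le_two hδ hc4 (by positivity : 0 ≤ |μ| * b)
  have hc2 : 0 < c / 2 := by linarith
  have hi := ((integrableOn_rpow_mul_exp_neg_mul_rpow (by linarith : -1 < 2 * α - 1)
    (by linarith : 0 < δ) hc2).const_mul (|κ| * α * b ^ (α - 1))).add
    ((integrableOn_rpow_mul_exp_neg_mul_rpow (by norm_num : (-1 : ℝ) < 1)
    (by linarith : 0 < δ) hc2).const_mul |μ|)
  refine (hi.const_mul (2 * Real.pi * Real.exp (M₁ + M₂))).mono'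
    (Measurable.aestronglyMeasurable (by fun_prop)) ?_
  filter_upwards [self_mem_ae_restrict measurableSet_Ioi] with r hr
  have hr0 : (0 : ℝ) < r := hr
  have hpw : ∀ q : ℝ, (b * r ^ 2) ^ q = b ^ q * r ^ (2 * q) := by
    intro q
    rw [Real.mul_rpow hb.le (by positivity), ← Real.rpow_two, ← Real.rpow_mul hr0.le]
  have h1 := hM₁ r hr0
  have h2 := hM₂ r hr0
  rw [Real.rpow_two] at h2
  have hexp : -(κ * (b * r ^ 2) ^ α) - c * r ^ δ - μ * (b * r ^ 2)
      ≤ (M₁ + M₂) + -(c / 2) * r ^ δ := by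
    have h3 : -(κ * (b * r ^ 2) ^ α) ≤ |κ| * b ^ α * r ^ (2 * α) := by
      rw [hpw, ← neg_mul, mul_assoc |κ|]
      exact mul_le_mul_of_nonneg_right (neg_le_abs κ) (by positivity)
    have h4 : -(μ * (b * r ^ 2)) ≤ |μ| * b * r ^ 2 := by
      rw [← neg_mul, mul_assoc |μ|]
      exact mul_le_mul_of_nonneg_right (neg_le_abs μ) (by positivity)
    linarith
  have hfac : r * |κ * α * (b * r ^ 2) ^ (α - 1) + μ|
      ≤ |κ| * α * b ^ (α - 1) * r ^ (2 * α - 1) + |μ| * r ^ (1 : ℝ) := by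
    have e : r * r ^ (2 * (α - 1)) = r ^ (2 * α - 1) := by
      rw [mul_comm, ← Real.rpow_add_one hr0.ne']; ring_nf
    have h3 : |κ * α * (b * r ^ 2) ^ (α - 1) + μ|
        ≤ |κ| * α * (b ^ (α - 1) * r ^ (2 * (α - 1))) + |μ| := by
      refine (abs_add_le _ _).trans ?_
      rw [hpw, abs_mul, abs_mul, abs_of_pos hα, abs_of_pos (by positivity :
        0 < b ^ (α - 1) * r ^ (2 * (α - 1)))]
    calc r * |κ * α * (b * r ^ 2) ^ (α - 1) + μ|
        ≤ r * (|κ| * α * (b ^ (α - 1) * r ^ (2 * (α - 1))) + |μ|) := by gcongr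
      _ = |κ| * α * b ^ (α - 1) * (r * r ^ (2 * (α - 1))) + |μ| * r := by ring
      _ = _ := by rw [e, Real.rpow_one]
  rw [norm_mul, norm_mul, norm_mul, Real.norm_of_nonneg (by positivity : 0 ≤ 2 * Real.pi),
    Real.norm_of_nonneg hr0.le, Real.norm_of_nonneg (Real.exp_pos _).le, Real.norm_eq_abs]
  simp only [Pi.add_apply]
  calc 2 * Real.pi * r * |κ * α * (b * r ^ 2) ^ (α - 1) + μ| *
        Real.exp (-(κ * (b * r ^ 2) ^ α) - c * r ^ δ - μ * (b * r ^ 2))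
      = 2 * Real.pi * (r * |κ * α * (b * r ^ 2) ^ (α - 1) + μ|) *
        Real.exp (-(κ * (b * r ^ 2) ^ α) - c * r ^ δ - μ * (b * r ^ 2)) := by ring
    _ ≤ 2 * Real.pi * (|κ| * α * b ^ (α - 1) * r ^ (2 * α - 1) + |μ| * r ^ (1 : ℝ)) *
        Real.exp ((M₁ + M₂) + -(c / 2) * r ^ δ) := by
        gcongr
    _ = _ := by rw [Real.exp_add]; ring

/-- For `α = 1` the exponent `B log B`, with `B = b r²`, grows more slowly than the noise term
`r^δ`, for any `δ > 2`. -/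
theorem integrableOn_limitOne_of_noise {θ μ b c δ : ℝ} (hθ : 0 ≤ θ) (hδ : 2 < δ)
    (hb : 0 < b) (hc : 0 < c) :
    IntegrableOn (fun r => 2 * Real.pi * r * (μ - θ * (Real.log (b * r ^ 2) + 1)) *
      Real.exp (-(c * r ^ δ) + θ * ((b * r ^ 2) * Real.log (b * r ^ 2)) - μ * (b * r ^ 2)))
      (Ioi 0) := by
  have hpi := Real.pi_pos
  have hc4 : 0 < c / 4 := by linarith
  set ε := (δ - 2) / 4 with hε
  have hε0 : 0 < ε := by rw [hε]; linarith
  obtain ⟨M₁, hM₁⟩ := exists_rpow_le_add (by linarith : 0 ≤ 2 * (1 + ε))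
    (by rw [hε]; linarith : 2 * (1 + ε) < δ) hc4 (by positivity : 0 ≤ θ * (b ^ (1 + ε) / ε))
  obtain ⟨M₂, hM₂⟩ := exists_rpow_le_add zero_le_two hδ hc4 (by positivity : 0 ≤ |μ| * b)
  have hc2 : 0 < c / 2 := by linarith
  have hint : ∀ p : ℝ, -1 < p → IntegrableOn (fun r : ℝ => r ^ p * Real.exp (-(c / 2) * r ^ δ))
      (Ioi 0) := fun p hp =>
    integrableOn_rpow_mul_exp_neg_mul_rpow hp (by linarith : 0 < δ) hc2
  have hi := (((hint 1 (by norm_num)).const_mul (|μ| + θ)).add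
    ((hint (3 / 2) (by norm_num)).const_mul (θ * (4 * b ^ (1 / 4 : ℝ))))).add
    ((hint (1 / 2) (by norm_num)).const_mul (θ * (4 * b ^ (-(1 / 4) : ℝ))))
  refine (hi.const_mul (2 * Real.pi * Real.exp (M₁ + M₂))).mono'
    (Measurable.aestronglyMeasurable (by fun_prop)) ?_
  filter_upwards [self_mem_ae_restrict measurableSet_Ioi] with r hr
  have hr0 : (0 : ℝ) < r := hr
  have hB : 0 < b * r ^ 2 := by positivity
  have hpw : ∀ q : ℝ, (b * r ^ 2) ^ q = b ^ q * r ^ (2 * q) := by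
    intro q
    rw [Real.mul_rpow hb.le (by positivity), ← Real.rpow_two, ← Real.rpow_mul hr0.le]
  have h1 := hM₁ r hr0
  have h2 := hM₂ r hr0
  rw [Real.rpow_two] at h2
  have hexp : -(c * r ^ δ) + θ * ((b * r ^ 2) * Real.log (b * r ^ 2)) - μ * (b * r ^ 2)
      ≤ (M₁ + M₂) + -(c / 2) * r ^ δ := by
    have h3 : θ * ((b * r ^ 2) * Real.log (b * r ^ 2)) ≤
        θ * (b ^ (1 + ε) / ε) * r ^ (2 * (1 + ε)) := by
      have h5 : (b * r ^ 2) * Real.log (b * r ^ 2) ≤ (b * r ^ 2) * ((b * r ^ 2) ^ ε / ε) :=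
        mul_le_mul_of_nonneg_left (Real.log_le_rpow_div hB.le hε0) hB.le
      have h6 : (b * r ^ 2) * ((b * r ^ 2) ^ ε / ε) = b ^ (1 + ε) / ε * r ^ (2 * (1 + ε)) := by
        rw [mul_div_assoc', ← Real.rpow_one_add' hB.le (by linarith), hpw]
        ring
      rw [h6] at h5
      rw [mul_assoc θ]
      exact mul_le_mul_of_nonneg_left h5 hθ
    have h4 : -(μ * (b * r ^ 2)) ≤ |μ| * b * r ^ 2 := by
      rw [← neg_mul, mul_assoc |μ|]
      exact mul_le_mul_of_nonneg_right (neg_le_abs μ) (by positivity)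
    linarith
  have hlog : |Real.log (b * r ^ 2)|
      ≤ 4 * b ^ (1 / 4 : ℝ) * r ^ (1 / 2 : ℝ) + 4 * b ^ (-(1 / 4) : ℝ) * r ^ (-(1 / 2) : ℝ) := by
    have h3 := Real.log_le_rpow_div hB.le (by norm_num : (0 : ℝ) < 1 / 4)
    have h4 := Real.log_le_rpow_div (inv_pos.2 hB).le (by norm_num : (0 : ℝ) < 1 / 4)
    rw [Real.inv_rpow hB.le, ← Real.rpow_neg hB.le, Real.log_inv, hpw] at h4
    rw [hpw] at h3
    have e1 : (2 * (1 / 4) : ℝ) = 1 / 2 := by norm_num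
    have e2 : (2 * -(1 / 4) : ℝ) = -(1 / 2) := by norm_num
    rw [e1] at h3
    rw [e2] at h4
    have p1 : 0 < b ^ (1 / 4 : ℝ) * r ^ (1 / 2 : ℝ) := by positivity
    have p2 : 0 < b ^ (-(1 / 4) : ℝ) * r ^ (-(1 / 2) : ℝ) := by positivity
    rw [abs_le]
    constructor <;> linarith
  have hfac : r * |μ - θ * (Real.log (b * r ^ 2) + 1)|
      ≤ (|μ| + θ) * r ^ (1 : ℝ) + θ * (4 * b ^ (1 / 4 : ℝ)) * r ^ (3 / 2 : ℝ)
        + θ * (4 * b ^ (-(1 / 4) : ℝ)) * r ^ (1 / 2 : ℝ) := by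
    have e1 : r * r ^ (1 / 2 : ℝ) = r ^ (3 / 2 : ℝ) := by
      rw [← Real.rpow_one_add' hr0.le (by norm_num)]; norm_num
    have e2 : r * r ^ (-(1 / 2) : ℝ) = r ^ (1 / 2 : ℝ) := by
      rw [← Real.rpow_one_add' hr0.le (by norm_num)]; norm_num
    have h3 : |μ - θ * (Real.log (b * r ^ 2) + 1)| ≤ |μ| + θ * (|Real.log (b * r ^ 2)| + 1) := by
      refine (abs_sub _ _).trans ?_
      rw [abs_mul, abs_of_nonneg hθ]
      gcongr
      exact (abs_add_le _ _).trans (by rw [abs_one])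
    calc r * |μ - θ * (Real.log (b * r ^ 2) + 1)|
        ≤ r * (|μ| + θ * ((4 * b ^ (1 / 4 : ℝ) * r ^ (1 / 2 : ℝ)
          + 4 * b ^ (-(1 / 4) : ℝ) * r ^ (-(1 / 2) : ℝ)) + 1)) := by
          refine mul_le_mul_of_nonneg_left (h3.trans ?_) hr0.le
          gcongr
      _ = (|μ| + θ) * r + θ * (4 * b ^ (1 / 4 : ℝ)) * (r * r ^ (1 / 2 : ℝ))
          + θ * (4 * b ^ (-(1 / 4) : ℝ)) * (r * r ^ (-(1 / 2) : ℝ)) := by ring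
      _ = _ := by rw [e1, e2, Real.rpow_one]
  rw [norm_mul, norm_mul, norm_mul, Real.norm_of_nonneg (by positivity : 0 ≤ 2 * Real.pi),
    Real.norm_of_nonneg hr0.le, Real.norm_of_nonneg (Real.exp_pos _).le, Real.norm_eq_abs]
  simp only [Pi.add_apply]
  calc 2 * Real.pi * r * |μ - θ * (Real.log (b * r ^ 2) + 1)| *
        Real.exp (-(c * r ^ δ) + θ * ((b * r ^ 2) * Real.log (b * r ^ 2)) - μ * (b * r ^ 2))
      = 2 * Real.pi * (r * |μ - θ * (Real.log (b * r ^ 2) + 1)|) *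
        Real.exp (-(c * r ^ δ) + θ * ((b * r ^ 2) * Real.log (b * r ^ 2)) - μ * (b * r ^ 2)) := by
        ring
    _ ≤ 2 * Real.pi * ((|μ| + θ) * r ^ (1 : ℝ) + θ * (4 * b ^ (1 / 4 : ℝ)) * r ^ (3 / 2 : ℝ)
        + θ * (4 * b ^ (-(1 / 4) : ℝ)) * r ^ (1 / 2 : ℝ)) *
        Real.exp ((M₁ + M₂) + -(c / 2) * r ^ δ) := by
        gcongr
    _ = _ := by rw [Real.exp_add]; ring

/-! ### The closed form -/

variable {α σ μ : ℝ}

theorem limitIntegrand_eq (r : ℝ) : limitIntegrand T ζ δ N₀ G α σ μ r =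
    2 * Real.pi * r * (σ ^ α / Real.cos (Real.pi * α / 2) * α *
      (Real.pi * interferenceTerm T ζ δ G 1 * r ^ 2) ^ (α - 1) + μ) *
      Real.exp (-(σ ^ α / Real.cos (Real.pi * α / 2) *
        (Real.pi * interferenceTerm T ζ δ G 1 * r ^ 2) ^ α) - ζ * T * N₀ * r ^ δ
        - μ * (Real.pi * interferenceTerm T ζ δ G 1 * r ^ 2)) := by
  have e : Real.pi * interferenceTerm T ζ δ G r = Real.pi * interferenceTerm T ζ δ G 1 * r ^ 2 := by
    rw [interferenceTerm_eq_sq_mul r]; ring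
  rw [limitIntegrand, mul_assoc μ, e]
  ring_nf

theorem limitIntegrandOne_eq (r : ℝ) : limitIntegrandOne T ζ δ N₀ G σ μ r =
    2 * Real.pi * r * (μ - 2 * σ / Real.pi *
      (Real.log (Real.pi * interferenceTerm T ζ δ G 1 * r ^ 2) + 1)) *
      Real.exp (-(ζ * T * N₀ * r ^ δ) + 2 * σ / Real.pi *
        ((Real.pi * interferenceTerm T ζ δ G 1 * r ^ 2) *
          Real.log (Real.pi * interferenceTerm T ζ δ G 1 * r ^ 2))
        - μ * (Real.pi * interferenceTerm T ζ δ G 1 * r ^ 2)) := by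
  have e : Real.pi * interferenceTerm T ζ δ G r = Real.pi * interferenceTerm T ζ δ G 1 * r ^ 2 := by
    rw [interferenceTerm_eq_sq_mul r]; ring
  have e2 : 2 * σ * interferenceTerm T ζ δ G r
      = 2 * σ / Real.pi * (Real.pi * interferenceTerm T ζ δ G r) := by
    have := Real.pi_ne_zero
    field_simp
  rw [limitIntegrandOne, mul_assoc μ, e2, e]
  ring_nf

theorem limitIntegrand_eq_weightedMean [IsProbabilityMeasure G] [IsProbabilityMeasure ν]
    (hT : 0 < T) (hζ : 0 < ζ) (hδ : 2 < δ) (hG : ∀ᵐ g ∂G, 0 < g)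
    (hGint : Integrable (fun g => g ^ (2 / δ)) G) (h0 : 0 < α) (h2 : α ≤ 2) (h1 : α ≠ 1)
    (hσ : 0 ≤ σ) (hν : IsStableLaw α σ μ ν) {r : ℝ} (hr : 0 < r) :
    2 * Real.pi * r * (Real.exp (-(ζ * T * r ^ δ * N₀)) *
      weightedMean ν (Real.pi * interferenceTerm T ζ δ G r)) =
      limitIntegrand T ζ δ N₀ G α σ μ r := by
  have hI := one_le_interferenceTerm_one hT hζ hδ hG hGint
  have hB : 0 < Real.pi * interferenceTerm T ζ δ G r := by
    have := Real.pi_pos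
    rw [interferenceTerm_eq_sq_mul]; positivity
  rw [weightedMean_stable_of_ne_one h0 h2 h1 hσ hν hB, limitIntegrand, mul_assoc μ, sub_right_comm,
    sub_eq_add_neg _ (ζ * T * r ^ δ * N₀), Real.exp_add]
  ring

theorem limitIntegrandOne_eq_weightedMean [IsProbabilityMeasure G] [IsProbabilityMeasure ν]
    (hT : 0 < T) (hζ : 0 < ζ) (hδ : 2 < δ) (hG : ∀ᵐ g ∂G, 0 < g)
    (hGint : Integrable (fun g => g ^ (2 / δ)) G)
    (hσ : 0 ≤ σ) (hν : IsStableLaw 1 σ μ ν) {r : ℝ} (hr : 0 < r) :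
    2 * Real.pi * r * (Real.exp (-(ζ * T * r ^ δ * N₀)) *
      weightedMean ν (Real.pi * interferenceTerm T ζ δ G r)) =
      limitIntegrandOne T ζ δ N₀ G σ μ r := by
  have hI := one_le_interferenceTerm_one hT hζ hδ hG hGint
  have hB : 0 < Real.pi * interferenceTerm T ζ δ G r := by
    have := Real.pi_pos
    rw [interferenceTerm_eq_sq_mul]; positivity
  have e2 : 2 * σ * interferenceTerm T ζ δ G r
      = 2 * σ / Real.pi * (Real.pi * interferenceTerm T ζ δ G r) := by
    have := Real.pi_ne_zero
    field_simp
  rw [weightedMean_stable_one hσ hν hB, limitIntegrandOne, mul_assoc μ, e2, add_sub_assoc,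
    Real.exp_add, mul_assoc (2 * σ / Real.pi) (Real.pi * interferenceTerm T ζ δ G r)]
  ring

/-- Both limits, for any law of the density that has a Laplace transform. -/
theorem exists_tendsto_coverageProbability [IsProbabilityMeasure G] [IsProbabilityMeasure ν]
    (hT : 0 < T) (hζ : 0 < ζ) (hδ : 2 < δ) (hN₀ : 0 ≤ N₀) (hH : H < 1) (hG : ∀ᵐ g ∂G, 0 < g)
    (hGint : Integrable (fun g => g ^ (2 / δ)) G)
    (hν : ∀ s, 0 < s → Integrable (fun x => Real.exp (-s * x)) ν) {f : ℝ → ℝ}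
    (hf : ∀ r, 0 < r → 2 * Real.pi * r * (Real.exp (-(ζ * T * r ^ δ * N₀)) *
      weightedMean ν (Real.pi * interferenceTerm T ζ δ G r)) = f r)
    (hint : IntegrableOn f (Ioi 0)) :
    ∃ p : ℝ → ℝ,
      (∀ R > 0, Tendsto (fun a => coverageProbability T ζ δ N₀ H G ν R a) atTop (𝓝 (p R))) ∧
      Tendsto p atTop (𝓝 (∫ r in Ioi (0 : ℝ), f r)) := by
  refine ⟨_, fun R hR => tendsto_coverageProbability hT hζ hδ hN₀ hH hG hGint hν hR, ?_⟩
  rw [← setIntegral_congr_fun measurableSet_Ioi fun r hr => hf r hr]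
  exact tendsto_integral_weightedMean hT hζ hδ hN₀ hG hGint hν
    (hint.congr_fun (fun r hr => (hf r hr).symm) measurableSet_Ioi)

end AlphaStableNetwork

theorem mainTheorem2 (T ζ δ N₀ H α σ μ : ℝ) (G ν : Measure ℝ)
    [IsProbabilityMeasure G] [IsProbabilityMeasure ν]
    (hT : 0 < T) (hζ : 0 < ζ) (hδ : 2 < δ) (hN₀ : 0 ≤ N₀) (hH₀ : 0 ≤ H) (hH₁ : H < 1)
    (hα₀ : 0 < α) (hα₂ : α ≤ 2) (hσ : 0 ≤ σ)
    (hG : ∀ᵐ g ∂G, 0 < g) (hGint : Integrable (fun g => g ^ (2 / δ)) G)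
    (hν : IsStableLaw α σ μ ν) :
    (α ≠ 1 →
      ((α < 1 ∧ 0 ≤ μ) ∨ (σ = 0 ∧ 0 ≤ μ) ∨ (0 < N₀ ∧ 2 * α < δ) →
        IntegrableOn (limitIntegrand T ζ δ N₀ G α σ μ) (Ioi 0)) ∧
      (IntegrableOn (limitIntegrand T ζ δ N₀ G α σ μ) (Ioi 0) →
        ∃ p : ℝ → ℝ,
          (∀ R > 0, Tendsto (fun a => coverageProbability T ζ δ N₀ H G ν R a) atTop (𝓝 (p R))) ∧
          Tendsto p atTop (𝓝 (∫ r in Ioi (0 : ℝ), limitIntegrand T ζ δ N₀ G α σ μ r)))) ∧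
    (α = 1 →
      ((σ = 0 ∧ 0 ≤ μ) ∨ 0 < N₀ →
        IntegrableOn (limitIntegrandOne T ζ δ N₀ G σ μ) (Ioi 0)) ∧
      (IntegrableOn (limitIntegrandOne T ζ δ N₀ G σ μ) (Ioi 0) →
        ∃ p : ℝ → ℝ,
          (∀ R > 0, Tendsto (fun a => coverageProbability T ζ δ N₀ H G ν R a) atTop (𝓝 (p R))) ∧
          Tendsto p atTop (𝓝 (∫ r in Ioi (0 : ℝ), limitIntegrandOne T ζ δ N₀ G σ μ r)))) := by
  have hpi := Real.pi_pos
  have hI := one_le_interferenceTerm_one hT hζ hδ hG hGint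
  have hb : 0 < Real.pi * interferenceTerm T ζ δ G 1 := by positivity
  have hc : 0 ≤ ζ * T * N₀ := by positivity
  refine ⟨fun h1 => ⟨fun hcase => ?_, fun hint => ?_⟩, ?_⟩
  · rw [funext limitIntegrand_eq]
    -- in the first two cases the coefficient of `B ^ α` is nonnegative
    rcases hcase with ⟨hα, hμ⟩ | ⟨rfl, hμ⟩ | ⟨hN, hαδ⟩
    · have hcos : 0 < Real.cos (Real.pi * α / 2) :=
        Real.cos_pos_of_mem_Ioo ⟨by nlinarith, by nlinarith⟩
      exact integrableOn_limit_of_nonneg hα₀ (by positivity) hμ hb hc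
    · exact integrableOn_limit_of_nonneg hα₀ (by rw [Real.zero_rpow hα₀.ne', zero_div]) hμ hb hc
    · exact integrableOn_limit_of_noise hα₀ hαδ hδ hb (by positivity)
  · exact exists_tendsto_coverageProbability hT hζ hδ hN₀ hH₁ hG hGint
      (fun s hs => (laplace_stable_of_ne_one hα₀ hα₂ h1 hσ hν hs).1)
      (fun r hr => limitIntegrand_eq_weightedMean hT hζ hδ hG hGint hα₀ hα₂ h1 hσ hν hr) hint
  · rintro rfl
    refine ⟨fun hcase => ?_, fun hint => ?_⟩
    · rw [funext limitIntegrandOne_eq]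
      rcases hcase with ⟨rfl, hμ⟩ | hN
      -- for `σ = 0` the logarithm disappears, and the integrand is that of `α ≠ 1` with `κ = 0`
      · refine (integrableOn_limit_of_nonneg one_pos le_rfl hμ hb hc (δ := δ)).congr
          (ae_of_all _ fun r => ?_)
        simp
      · exact integrableOn_limitOne_of_noise (by positivity) hδ hb (by positivity)
    · exact exists_tendsto_coverageProbability hT hζ hδ hN₀ hH₁ hG hGint
        (fun s hs => (laplace_stable_one hσ hν hs).1)
        (fun r hr => limitIntegrandOne_eq_weightedMean hT hζ hδ hG hGint hσ hν hr) hint
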